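/- Let $h>0$, and let $M$ be either $\mathbf R^n$ with Lebesgue measure $dx$, or a compact smooth $n$-dimensional manifold with a strictly positive smooth density of integration $dx$. Let $$P=\sum_{j,k=1}^n hD_{x_j}\circ b_{j,k}(x)\circ hD_{x_k}+\frac12\sum_{j=1}^n\bigl(c_j(x)h\partial_{x_j}+h\partial_{x_j}\circ c_j(x)\bigr)+p_0(x),\qquad D_{x_j}=\frac1i\partial_{x_j},$$ (in the manifold case: in suitable local coordinates near every point, in which $dx=dx_1\cdots dx_n$), where $b_{j,k}=b_{k,j}$, $c_j$, $p_0$ are smooth and real, $\sum_{j,k}b_{j,k}(x)\xi_j\xi_k\ge 0$ for all real $\xi$, and $p_0\ge 0$. When $M=\mathbf R^n$ assume also that $\partial^\alpha b_{j,k}$ is bounded for all $|\alpha|\ge 0$, $\partial^\alpha c_j$ is bounded for all $|\alpha|\ge 1$, and $\partial^\alpha p_0$ is bounded for all $|\alpha|\ge 2$. Let $\mathcal S$ be the Schwartz space $\mathcal S(\mathbf R^n)$, respectively $C^\infty(M)$ when $M$ is compact (complex valued functions). Then $P$ maps $\mathcal S$ to $\mathcal S$, and the closure in $L^2(M)\times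 L^2(M)$ of the graph of $P:\mathcal S\to\mathcal S$ is the graph of a densely defined operator $P_{\min}$ (the graph closure) such that: 1. For every $z\in\mathbf C$ with $\mathrm{Re}\,z<0$, the range of $P_{\min}-z$ is all of $L^2(M)$, and $P_{\min}-z$ has a bounded inverse $(P_{\min}-z)^{-1}$ on $L^2(M)$ with $\|(P_{\min}-z)^{-1}\|\le|\mathrm{Re}\,z|^{-1}$. 2. $P_{\min}$ is maximal accretive: $\mathrm{Re}\,(P_{\min}u\,|\,u)\ge 0$ for all $u$ in its domain, and it has no proper extension with this property. 3. The maximal closed extension $P_{\max}$, with domain $\{u\in L^2(M):\ Pu\in L^2(M)\}$ and $P_{\max}u=Pu$ in the sense of distributions, coincides with $P_{\min}$. -/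

import Mathlib

open MeasureTheory Set
open scoped ContDiff Manifold SchwartzMap

/-- The `j`-th partial derivative of a complex function on `ℝⁿ`. -/
noncomputable def partialDeriv {n : ℕ} (j : Fin n) (f : EuclideanSpace ℝ (Fin n) → ℂ) :
    EuclideanSpace ℝ (Fin n) → ℂ :=
  fun x => fderiv ℝ f x (EuclideanSpace.single j 1)

/-- `h D_j`, where `D_j = (1 / i) ∂_j`. -/
noncomputable def semiD {n : ℕ} (h : ℝ) (j : Fin n) (f : EuclideanSpace ℝ (Fin n) → ℂ) :
    EuclideanSpace ℝ (Fin n) → ℂ :=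
  fun x => (h : ℂ) / Complex.I * partialDeriv j f x

/-- The differential expression
`∑ hD_j ∘ b_{jk} ∘ hD_k + (1/2) ∑ (c_j h∂_j + h∂_j ∘ c_j) + p₀`. -/
noncomputable def diffExpr {n : ℕ} (h : ℝ)
    (b : Fin n → Fin n → EuclideanSpace ℝ (Fin n) → ℝ)
    (c : Fin n → EuclideanSpace ℝ (Fin n) → ℝ)
    (p₀ : EuclideanSpace ℝ (Fin n) → ℝ)
    (u : EuclideanSpace ℝ (Fin n) → ℂ) : EuclideanSpace ℝ (Fin n) → ℂ :=
  fun x =>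
    (∑ j, ∑ k, semiD h j (fun y => (b j k y : ℂ) * semiD h k u y) x)
    + 1 / 2 * (∑ j, ((c j x : ℂ) * ((h : ℂ) * partialDeriv j u x)
        + (h : ℂ) * partialDeriv j (fun y => (c j y : ℂ) * u y) x))
    + (p₀ x : ℂ) * u x

/-- The formal transpose of `diffExpr h b c p₀` with respect to `∫ u v dx`: the second and zeroth
order parts are symmetric and the first order part is antisymmetric. -/
noncomputable def diffExprTranspose {n : ℕ} (h : ℝ)
    (b : Fin n → Fin n → EuclideanSpace ℝ (Fin n) → ℝ)
    (c : Fin n → EuclideanSpace ℝ (Fin n) → ℝ)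
    (p₀ : EuclideanSpace ℝ (Fin n) → ℝ)
    (u : EuclideanSpace ℝ (Fin n) → ℂ) : EuclideanSpace ℝ (Fin n) → ℂ :=
  diffExpr h b (fun j x => - c j x) p₀ u

/-- The coefficients are smooth (and real) on `Ω`, with `b_{jk} = b_{kj}`,
`p₂(x, ξ) = ∑ b_{jk}(x) ξ_j ξ_k ≥ 0` and `p₀ ≥ 0` there. -/
structure AdmissibleCoeffsOn {n : ℕ} (Ω : Set (EuclideanSpace ℝ (Fin n)))
    (b : Fin n → Fin n → EuclideanSpace ℝ (Fin n) → ℝ)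
    (c : Fin n → EuclideanSpace ℝ (Fin n) → ℝ)
    (p₀ : EuclideanSpace ℝ (Fin n) → ℝ) : Prop where
  smooth_b : ∀ j k, ContDiffOn ℝ ∞ (b j k) Ω
  smooth_c : ∀ j, ContDiffOn ℝ ∞ (c j) Ω
  smooth_p₀ : ContDiffOn ℝ ∞ p₀ Ω
  symm_b : ∀ j k, ∀ x ∈ Ω, b j k x = b k j x
  nonneg_p₂ : ∀ x ∈ Ω, ∀ ξ : Fin n → ℝ, 0 ≤ ∑ j, ∑ k, b j k x * ξ j * ξ k
  nonneg_p₀ : ∀ x ∈ Ω, 0 ≤ p₀ x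

/-- The growth conditions at infinity on `ℝⁿ`: `∂^α b_{jk}` is bounded for `|α| ≥ 0`,
`∂^α c_j` for `|α| ≥ 1`, and `∂^α p₀` for `|α| ≥ 2`. -/
structure GrowthConditions {n : ℕ}
    (b : Fin n → Fin n → EuclideanSpace ℝ (Fin n) → ℝ)
    (c : Fin n → EuclideanSpace ℝ (Fin n) → ℝ)
    (p₀ : EuclideanSpace ℝ (Fin n) → ℝ) : Prop where
  bound_b : ∀ j k, ∀ m : ℕ, ∃ C : ℝ, ∀ x, ‖iteratedFDeriv ℝ m (b j k) x‖ ≤ C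
  bound_c : ∀ j, ∀ m : ℕ, 1 ≤ m → ∃ C : ℝ, ∀ x, ‖iteratedFDeriv ℝ m (c j) x‖ ≤ C
  bound_p₀ : ∀ m : ℕ, 2 ≤ m → ∃ C : ℝ, ∀ x, ‖iteratedFDeriv ℝ m p₀ x‖ ≤ C

/-- The graph in `L² × L²` of the operator `P : 𝒮(ℝⁿ) → 𝒮(ℝⁿ)`. -/
def euclideanGraph {n : ℕ} (h : ℝ)
    (b : Fin n → Fin n → EuclideanSpace ℝ (Fin n) → ℝ)
    (c : Fin n → EuclideanSpace ℝ (Fin n) → ℝ)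
    (p₀ : EuclideanSpace ℝ (Fin n) → ℝ) :
    Set (Lp ℂ 2 (volume : Measure (EuclideanSpace ℝ (Fin n))) ×
      Lp ℂ 2 (volume : Measure (EuclideanSpace ℝ (Fin n)))) :=
  {w | ∃ φ : 𝓢(EuclideanSpace ℝ (Fin n), ℂ),
    w.1 =ᵐ[volume] (φ : EuclideanSpace ℝ (Fin n) → ℂ) ∧ w.2 =ᵐ[volume] diffExpr h b c p₀ φ}

/-- The graph of the maximal extension on `ℝⁿ`: all `(u, v) ∈ L² × L²` with `P u = v` in the
sense of distributions. -/
def euclideanMaxGraph {n : ℕ} (h : ℝ)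
    (b : Fin n → Fin n → EuclideanSpace ℝ (Fin n) → ℝ)
    (c : Fin n → EuclideanSpace ℝ (Fin n) → ℝ)
    (p₀ : EuclideanSpace ℝ (Fin n) → ℝ) :
    Set (Lp ℂ 2 (volume : Measure (EuclideanSpace ℝ (Fin n))) ×
      Lp ℂ 2 (volume : Measure (EuclideanSpace ℝ (Fin n)))) :=
  {w | ∀ φ : EuclideanSpace ℝ (Fin n) → ℂ, ContDiff ℝ ∞ φ → HasCompactSupport φ →
    ∫ x, w.2 x * φ x = ∫ x, w.1 x * diffExprTranspose h b c p₀ φ x}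

section Manifold

variable {n : ℕ} {M : Type*} [TopologicalSpace M] [ChartedSpace (EuclideanSpace ℝ (Fin n)) M]
  [MeasurableSpace M]

/-- `μ` is a strictly positive smooth density: in every smooth chart it has a smooth, strictly
positive density with respect to Lebesgue measure. -/
def IsSmoothPosDensity (n : ℕ) {M : Type*} [TopologicalSpace M]
    [ChartedSpace (EuclideanSpace ℝ (Fin n)) M] [MeasurableSpace M] (μ : Measure M) : Prop :=
  ∀ e ∈ IsManifold.maximalAtlas (𝓡 n) ∞ M, ∃ ρ : EuclideanSpace ℝ (Fin n) → ℝ,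
    ContDiffOn ℝ ∞ ρ e.target ∧ (∀ y ∈ e.target, 0 < ρ y) ∧
    Measure.map e (μ.restrict e.source) =
      (volume.restrict e.target).withDensity (fun y => ENNReal.ofReal (ρ y))

/-- In the smooth local coordinates `e`, the measure `μ` is Lebesgue measure `dx₁ ⋯ dxₙ`, and the
operator `P` on smooth functions is the differential expression with coefficients `b, c, p₀`,
admissible on the range of the chart. -/
structure HasLocalForm (h : ℝ) (μ : Measure M)
    (P : C^∞⟮𝓡 n, M; 𝓘(ℝ, ℂ), ℂ⟯ → C^∞⟮𝓡 n, M; 𝓘(ℝ, ℂ), ℂ⟯)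
    (e : OpenPartialHomeomorph M (EuclideanSpace ℝ (Fin n)))
    (b : Fin n → Fin n → EuclideanSpace ℝ (Fin n) → ℝ)
    (c : Fin n → EuclideanSpace ℝ (Fin n) → ℝ)
    (p₀ : EuclideanSpace ℝ (Fin n) → ℝ) : Prop where
  smooth_chart : e ∈ IsManifold.maximalAtlas (𝓡 n) ∞ M
  lebesgue : Measure.map e (μ.restrict e.source) = volume.restrict e.target
  admissible : AdmissibleCoeffsOn e.target b c p₀
  form : ∀ u : C^∞⟮𝓡 n, M; 𝓘(ℝ, ℂ), ℂ⟯, ∀ x ∈ e.source,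
    P u x = diffExpr h b c p₀ (fun y => u (e.symm y)) (e x)

/-- `P` is a second order differential operator on `M` of the class considered: near every point
it has the required form in local coordinates in which `μ` is Lebesgue measure. (In particular
`P` is linear.) -/
def IsAdmissibleOperator (h : ℝ) (μ : Measure M)
    (P : C^∞⟮𝓡 n, M; 𝓘(ℝ, ℂ), ℂ⟯ → C^∞⟮𝓡 n, M; 𝓘(ℝ, ℂ), ℂ⟯) : Prop :=
  ∀ x : M, ∃ e b c p₀, x ∈ e.source ∧ HasLocalForm h μ P e b c p₀

/-- The graph in `L² × L²` of the operator `P : C^∞(M) → C^∞(M)`. -/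
def manifoldGraph (μ : Measure M)
    (P : C^∞⟮𝓡 n, M; 𝓘(ℝ, ℂ), ℂ⟯ → C^∞⟮𝓡 n, M; 𝓘(ℝ, ℂ), ℂ⟯) :
    Set (Lp ℂ 2 μ × Lp ℂ 2 μ) :=
  {w | ∃ φ : C^∞⟮𝓡 n, M; 𝓘(ℝ, ℂ), ℂ⟯,
    w.1 =ᵐ[μ] (φ : M → ℂ) ∧ w.2 =ᵐ[μ] (P φ : M → ℂ)}

/-- The graph of the maximal extension on `M`: all `(u, v) ∈ L² × L²` with `P u = v` in the sense
of distributions, tested in all local coordinates in which `P` has the required form. -/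
def manifoldMaxGraph (h : ℝ) (μ : Measure M)
    (P : C^∞⟮𝓡 n, M; 𝓘(ℝ, ℂ), ℂ⟯ → C^∞⟮𝓡 n, M; 𝓘(ℝ, ℂ), ℂ⟯) :
    Set (Lp ℂ 2 μ × Lp ℂ 2 μ) :=
  {w | ∀ e b c p₀, HasLocalForm h μ P e b c p₀ →
    ∀ φ : EuclideanSpace ℝ (Fin n) → ℂ, ContDiff ℝ ∞ φ → HasCompactSupport φ →
      tsupport φ ⊆ e.target →
      ∫ x in e.source, w.2 x * φ (e x) ∂μ =
        ∫ x in e.source, w.1 x * diffExprTranspose h b c p₀ φ (e x) ∂μ}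

end Manifold

section Accretive

variable {H : Type*} [NormedAddCommGroup H] [InnerProductSpace ℂ H]

/-- `Re (A u | u) ≥ 0` on the domain of `A`. -/
def IsAccretiveOp (A : H →ₗ.[ℂ] H) : Prop :=
  ∀ u : A.domain, 0 ≤ (inner ℂ (A u) (u : H)).re

/-- `A` is accretive and has no proper accretive extension. -/
def IsMaximalAccretiveOp (A : H →ₗ.[ℂ] H) : Prop :=
  IsAccretiveOp A ∧ ∀ B : H →ₗ.[ℂ] H, IsAccretiveOp B → A ≤ B → B = A

/-- `R = (A - z)⁻¹` as a bounded everywhere defined operator. -/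
def IsResolventAt (A : H →ₗ.[ℂ] H) (z : ℂ) (R : H →L[ℂ] H) : Prop :=
  (∀ f : H, ∃ hf : R f ∈ A.domain, A ⟨R f, hf⟩ - z • R f = f) ∧
  (∀ u : A.domain, R (A u - z • (u : H)) = u)

/-- For every `z` with `Re z < 0`, the range of `A - z` is the whole space, and `(A - z)⁻¹` exists
as a bounded operator of norm at most `|Re z|⁻¹`. -/
def LeftHalfPlaneResolvent (A : H →ₗ.[ℂ] H) : Prop :=
  ∀ z : ℂ, z.re < 0 →
    range (fun u : A.domain => A u - z • (u : H)) = univ ∧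
    ∃ R : H →L[ℂ] H, IsResolventAt A z R ∧ ‖R‖ ≤ |z.re|⁻¹

end Accretive

/-!
The operator `P = ∑ hDⱼ b_{jk} hDₖ + ½ ∑ (cⱼ h∂ⱼ + h∂ⱼ cⱼ) + p₀` is formally accretive, so the whole
statement reduces to facts about weak solutions. In a Hilbert space, let `G` be an accretive graph
with dense domain and `Gmax ⊇ G` a closed linear extension. If, for all large real `l`, nothing is
orthogonal to the range of `G + l`, and `Gmax + l` is injective, then the closure of `G` is a maximal
accretive operator, has the resolvent estimate on the left half-plane and is equal to `Gmax`
(`exists_maximalAccretive_graph_closure`). Both conditions say that an `L²` function `u`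
annihilating `(P + l) ψ` for all test functions `ψ` vanishes when `l` is large; for the second
condition `P` is replaced by its transpose, which has the same form with `-c` in place of `c`.

The ellipticity of `P` may degenerate, so no regularity of `u` is available. What replaces it is the
following local estimate, `exists_local_estimate`: for a cutoff `χ` and a weak solution `u` one has
`(l - C) ‖χ u‖² ≤ C ‖u‖²`. It is obtained by testing with `χ w`, where `(1 - ε² Δ) w = χ u` and
`ε → 0`. Two facts make this work uniformly in `ε`.

* `P` is bounded below not only in `L²` but also for the form of `1 - ε² Δ`, and dominates the
  degenerate energy `∫ ∑ b_{jk} ∂ⱼw ∂ₖw̄` (`exists_regularized_accretivity`). The dangerous term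
  here comes from the first derivatives of `b` and contains second derivatives of `w`; by Oleinik's
  inequality (`oleinik_inequality`), valid since `b ≥ 0` has bounded second derivatives, it is
  controlled by the energies of the first derivatives of `w`. Of `p₀`
  only second derivatives enter, since `Re ∑ (∂ᵢw | (∂ᵢp₀) w) = -½ ∫ Δp₀ |w|²`.
* The commutator of `P` with `χ` is controlled by the degenerate energy of `w`
  (`commutator_norm_sq_le`), because its first order part is `-2 h² ∑ b_{jk} (∂ⱼχ) ∂ₖ`.

On `ℝⁿ` the estimate is applied to the dilated cutoffs `χ(x / R)`: the commutators stay bounded,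
since `c` grows at most linearly and is multiplied by a derivative of the cutoff
(`exists_controlledCutoff_seq`); letting `R → ∞` gives `(l - C) ‖u‖² ≤ C ‖u‖²`.

On a compact manifold the coefficients in each chart are first replaced by global ones
(`AdmissibleCoeffsOn.exists_extension`), and the estimates for a finite partition of unity are summed
(`ControlledAtlas.exists_forall_eq_zero`). Accretivity is local up to terms that cancel:
`2 Re (φ̄ Pφ) - P|φ|²` is an explicit function, the integral of `P (η |φ|²)` in a chart is known,
and `∑ P (η |φ|²) = P |φ|²` over a partition of unity (`integral_localized_accretivity_nonneg`).
-/


/-! ### Closures of accretive graphs in a Hilbert space -/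

section AbstractAccretive

variable {H : Type*} [NormedAddCommGroup H] [InnerProductSpace ℂ H]

/-- Coercivity: on an accretive graph, the real part of `(A - z)u` against `u` controls `‖u‖`. -/
theorem norm_le_of_re_inner_nonneg {u v : H} (z : ℂ) (huv : 0 ≤ (inner ℂ v u).re) :
    -z.re * ‖u‖ ≤ ‖v - z • u‖ := by
  by_cases hu : ‖u‖ = 0
  · simp [hu]
  have hpos : 0 < ‖u‖ := lt_of_le_of_ne (norm_nonneg _) (Ne.symm hu)
  have h1 : (inner ℂ (v - z • u) u).re ≤ ‖v - z • u‖ * ‖u‖ :=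
    (Complex.re_le_norm _).trans (norm_inner_le_norm _ _)
  have h2 : (inner ℂ (v - z • u) u).re = (inner ℂ v u).re - z.re * ‖u‖ ^ 2 := by
    rw [inner_sub_left, inner_smul_left, inner_self_eq_norm_sq_to_K]
    simp only [Complex.sub_re, Complex.mul_re, Complex.conj_re, Complex.conj_im,
      Complex.coe_algebraMap, ← Complex.ofReal_pow, Complex.ofReal_re, Complex.ofReal_im]
    ring
  nlinarith

/-- A densely defined accretive graph is closable. -/
theorem eq_zero_of_mem_closure_accretive {G : Submodule ℂ (H × H)}
    (hacc : ∀ w ∈ G, 0 ≤ (inner ℂ w.2 w.1).re)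
    (hdense : Dense (Prod.fst '' (G : Set (H × H))))
    {v : H} (hv : ((0 : H), v) ∈ closure (G : Set (H × H))) : v = 0 := by
  have hacc' : ∀ w ∈ closure (G : Set (H × H)), 0 ≤ (inner ℂ w.2 w.1).re := by
    intro w hw
    have hcl : IsClosed {w : H × H | 0 ≤ (inner ℂ w.2 w.1).re} :=
      isClosed_le continuous_const (by fun_prop)
    exact closure_minimal (fun w hw => hacc w hw) hcl hw
  have key : ∀ w ∈ G, 0 ≤ (inner ℂ v w.1).re := by
    intro w hw
    -- `(0, v) + t (f, T f)` lies in the closed graph; divide by `t` and let `t → 0`.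
    have h1 : ∀ t : ℝ, 0 < t → 0 ≤ (inner ℂ v w.1).re + t * (inner ℂ w.2 w.1).re := by
      intro t ht
      have hmem : ((0 : H), v) + (t : ℂ) • w ∈ closure (G : Set (H × H)) := by
        have := G.topologicalClosure.add_mem (x := ((0 : H), v)) (y := (t : ℂ) • w) hv
          (G.topologicalClosure.smul_mem _ (subset_closure hw))
        exact this
      have := hacc' _ hmem
      simp only [Prod.fst_add, Prod.snd_add, Prod.smul_fst, Prod.smul_snd, zero_add,
        inner_add_left, inner_smul_right, inner_smul_left, Complex.conj_ofReal, Complex.add_re,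
        Complex.re_ofReal_mul] at this
      have h3 : 0 ≤ t * ((inner ℂ v w.1).re + t * (inner ℂ w.2 w.1).re) := by linarith
      exact nonneg_of_mul_nonneg_right h3 ht
    have hlim : Filter.Tendsto (fun t : ℝ => (inner ℂ v w.1).re + t * (inner ℂ w.2 w.1).re)
        (nhdsWithin 0 (Ioi 0)) (nhds ((inner ℂ v w.1).re + 0 * (inner ℂ w.2 w.1).re)) := by
      apply Filter.Tendsto.mono_left _ nhdsWithin_le_nhds
      exact (by fun_prop : Continuous
        (fun t : ℝ => (inner ℂ v w.1).re + t * (inner ℂ w.2 w.1).re)).tendsto 0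
    have := ge_of_tendsto hlim (by filter_upwards [self_mem_nhdsWithin] with t ht using h1 t ht)
    simpa using this
  have key2 : ∀ x : H, 0 ≤ (inner ℂ v x).re := by
    intro x
    have hcl : IsClosed {x : H | 0 ≤ (inner ℂ v x).re} :=
      isClosed_le continuous_const (by fun_prop)
    have hsub : Prod.fst '' (G : Set (H × H)) ⊆ {x : H | 0 ≤ (inner ℂ v x).re} := by
      rintro _ ⟨w, hw, rfl⟩
      exact key w hw
    exact (hdense.closure_eq ▸ closure_minimal hsub hcl) (mem_univ x)
  have h0 := key2 (-v)
  rw [inner_neg_right, inner_self_eq_norm_sq_to_K] at h0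
  simp only [Complex.neg_re, Complex.coe_algebraMap, ← Complex.ofReal_pow, Complex.ofReal_re] at h0
  have : ‖v‖ = 0 := by nlinarith [norm_nonneg v]
  exact norm_eq_zero.1 this

/-- Surjectivity of `A - z` on the whole left half-plane from surjectivity of `A + lam` for all
large `lam`: every such `z` lies in the disc of radius `lam` about `-lam` when `lam` is large, and
there the Neumann series for `(A - z)⁻¹` converges. -/
theorem leftHalfPlaneResolvent_of_surjective [CompleteSpace H] (A : H →ₗ.[ℂ] H)
    (hacc : IsAccretiveOp A) (l₀ : ℝ)
    (hsurj : ∀ l : ℝ, l₀ < l → ∀ f : H, ∃ u : A.domain, A u + (l : ℂ) • (u : H) = f) :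
    LeftHalfPlaneResolvent A := by
  have hbound : ∀ (z : ℂ) (u : A.domain), -z.re * ‖(u : H)‖ ≤ ‖A u - z • (u : H)‖ :=
    fun z u => norm_le_of_re_inner_nonneg z (hacc u)
  -- surjectivity at a point of the half-plane yields the resolvent there
  have hres : ∀ z : ℂ, z.re < 0 → (∀ f : H, ∃ u : A.domain, A u - z • (u : H) = f) →
      ∃ R : H →L[ℂ] H, IsResolventAt A z R ∧ ‖R‖ ≤ |z.re|⁻¹ := by
    intro z hz hs
    let T : A.domain →ₗ[ℂ] H := A.toFun - z • A.domain.subtype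
    have hT : ∀ u : A.domain, T u = A u - z • (u : H) := fun u => rfl
    have hinj : Function.Injective T := by
      rw [← LinearMap.ker_eq_bot, LinearMap.ker_eq_bot']
      intro u hu
      have h1 := hbound z u
      rw [← hT, hu, norm_zero] at h1
      have : ‖(u : H)‖ = 0 := by nlinarith [norm_nonneg (u : H)]
      exact Subtype.ext (norm_eq_zero.1 this)
    have hsur : Function.Surjective T := fun f => hs f
    let e := LinearEquiv.ofBijective T ⟨hinj, hsur⟩
    have he : ∀ u : A.domain, e u = A u - z • (u : H) := fun u => rfl
    have hnorm : ∀ f : H, ‖((e.symm f : A.domain) : H)‖ ≤ |z.re|⁻¹ * ‖f‖ := by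
      intro f
      have h1 := hbound z (e.symm f)
      rw [← he, e.apply_symm_apply] at h1
      rw [abs_of_neg hz, inv_mul_eq_div, le_div_iff₀ (by linarith)]
      linarith
    let R : H →L[ℂ] H :=
      LinearMap.mkContinuous (A.domain.subtype ∘ₗ e.symm.toLinearMap) |z.re|⁻¹ hnorm
    have hR : ∀ f, R f = ((e.symm f : A.domain) : H) := fun f => rfl
    refine ⟨R, ⟨fun f => ⟨(e.symm f).2, ?_⟩, fun u => ?_⟩, ?_⟩
    · have := he (e.symm f)
      rw [e.apply_symm_apply] at this
      exact this.symm
    · rw [hR, ← he, e.symm_apply_apply]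
    · exact LinearMap.mkContinuous_norm_le _ (by positivity) _
  intro z hz
  have hs : ∀ f : H, ∃ u : A.domain, A u - z • (u : H) = f := by
    intro f
    -- the radius is chosen so that `‖z + l‖ < l`, that is `‖z‖² < 2 l |Re z|`
    obtain ⟨l, hl⟩ : ∃ l : ℝ, max (max l₀ 0) (‖z‖ ^ 2 / (-2 * z.re)) < l := exists_gt _
    have hl0 : l₀ < l := lt_of_le_of_lt ((le_max_left _ _).trans (le_max_left _ _)) hl
    have hlp : 0 < l := lt_of_le_of_lt ((le_max_right _ _).trans (le_max_left _ _)) hl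
    have hlz : ‖z‖ ^ 2 / (-2 * z.re) < l := lt_of_le_of_lt (le_max_right _ _) hl
    rw [div_lt_iff₀ (by linarith)] at hlz
    have hclose : ‖z + l‖ < l := by
      have h1 : ‖z + l‖ ^ 2 < l ^ 2 := by
        rw [Complex.sq_norm, Complex.normSq_apply] at hlz ⊢
        simp only [Complex.add_re, Complex.add_im, Complex.ofReal_re, Complex.ofReal_im]
        nlinarith
      exact lt_of_pow_lt_pow_left₀ 2 hlp.le h1
    obtain ⟨R, ⟨hR1, _⟩, hR3⟩ := hres (-(l : ℂ)) (by simpa using hlp) (by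
      intro g
      obtain ⟨u, hu⟩ := hsurj l hl0 g
      exact ⟨u, by rw [neg_smul, sub_neg_eq_add, hu]⟩)
    have hnT : ‖(z + l) • R‖ < 1 := by
      rw [norm_smul]
      simp only [Complex.neg_re, Complex.ofReal_re, abs_neg, abs_of_pos hlp] at hR3
      calc ‖z + l‖ * ‖R‖ ≤ ‖z + l‖ * l⁻¹ := by gcongr
        _ < l * l⁻¹ := by gcongr
        _ = 1 := mul_inv_cancel₀ hlp.ne'
    let U := Units.oneSub ((z + l) • R) hnT
    have hU : ∀ g, (U : H →L[ℂ] H) g = g - (z + l) • R g := fun g => rfl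
    let g : H := ((U⁻¹ : (H →L[ℂ] H)ˣ) : H →L[ℂ] H) f
    have hg : g - (z + l) • R g = f := by
      rw [← hU]
      change ((U : H →L[ℂ] H) * ((U⁻¹ : (H →L[ℂ] H)ˣ) : H →L[ℂ] H)) f = f
      rw [Units.mul_inv]
      rfl
    obtain ⟨hm, hA⟩ := hR1 g
    refine ⟨⟨R g, hm⟩, ?_⟩
    rw [sub_eq_iff_eq_add] at hA
    simp only
    rw [hA, ← hg]
    module
  refine ⟨?_, hres z hz hs⟩
  rw [Set.eq_univ_iff_forall]
  intro f
  obtain ⟨u, hu⟩ := hs f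
  exact ⟨u, hu⟩

/-- The functional-analytic core: if an accretive, densely defined graph `G` is such that `G + l`
has dense range, and `Gmax ⊇ G` is a closed extension for which `Gmax + l` is injective, both for
all large `l`, then the closure of `G` is a maximal accretive operator and equals `Gmax`. -/
theorem exists_maximalAccretive_graph_closure [CompleteSpace H] (G : Submodule ℂ (H × H))
    (Gmax : Set (H × H)) (l₀ : ℝ)
    (hacc : ∀ w ∈ G, 0 ≤ (inner ℂ w.2 w.1).re)
    (hdense : Dense (Prod.fst '' (G : Set (H × H))))
    (hrange : ∀ l : ℝ, l₀ < l → ∀ f : H,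
      (∀ w ∈ G, inner ℂ f (w.2 + (l : ℂ) • w.1) = 0) → f = 0)
    (hsub : (G : Set (H × H)) ⊆ Gmax) (hclosed : IsClosed Gmax)
    (hdiff : ∀ w ∈ Gmax, ∀ w' ∈ Gmax, w - w' ∈ Gmax)
    (hker : ∀ l : ℝ, l₀ < l → ∀ u : H, (u, -((l : ℂ) • u)) ∈ Gmax → u = 0) :
    ∃ A : H →ₗ.[ℂ] H, (A.graph : Set (H × H)) = closure (G : Set (H × H)) ∧
      Dense (A.domain : Set H) ∧ LeftHalfPlaneResolvent A ∧ IsMaximalAccretiveOp A ∧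
      (A.graph : Set (H × H)) = Gmax := by
  have hsingle : ∀ x ∈ G.topologicalClosure, x.1 = 0 → x.2 = 0 := by
    rintro ⟨x, y⟩ hx (rfl : x = 0)
    exact eq_zero_of_mem_closure_accretive hacc hdense hx
  let A : H →ₗ.[ℂ] H := G.topologicalClosure.toLinearPMap
  have hgraph : A.graph = G.topologicalClosure := Submodule.toLinearPMap_graph_eq _ hsingle
  have hgraphS : (A.graph : Set (H × H)) = closure (G : Set (H × H)) := by
    rw [hgraph, Submodule.topologicalClosure_coe]
  have hAacc : IsAccretiveOp A := by
    intro u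
    have hmem : ((u : H), A u) ∈ closure (G : Set (H × H)) := by
      rw [← hgraphS]
      exact A.mem_graph u
    have hcl : IsClosed {w : H × H | 0 ≤ (inner ℂ w.2 w.1).re} :=
      isClosed_le continuous_const (by fun_prop)
    exact closure_minimal (fun w hw => hacc w hw) hcl hmem
  have hdom : Dense (A.domain : Set H) := by
    refine hdense.mono ?_
    rintro _ ⟨w, hw, rfl⟩
    have hmem : w ∈ A.graph := by
      rw [hgraph]
      exact G.le_topologicalClosure hw
    exact A.mem_domain_of_mem_graph hmem
  have hsurj : ∀ l : ℝ, max l₀ 0 < l → ∀ f : H, ∃ u : A.domain, A u + (l : ℂ) • (u : H) = f := by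
    intro l hl
    have hl0 : l₀ < l := (le_max_left _ _).trans_lt hl
    have hlp : 0 < l := (le_max_right _ _).trans_lt hl
    let S : Submodule ℂ (H × H) := G.topologicalClosure
    let T : (H × H) →L[ℂ] H := ContinuousLinearMap.snd ℂ H H + (l : ℂ) • ContinuousLinearMap.fst ℂ H H
    have hTw : ∀ w : H × H, T w = w.2 + (l : ℂ) • w.1 := fun w => rfl
    let K : Submodule ℂ H := S.map (T : (H × H) →ₗ[ℂ] H)
    have haccS : ∀ w ∈ S, 0 ≤ (inner ℂ w.2 w.1).re := by
      intro w hw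
      have hcl : IsClosed {w : H × H | 0 ≤ (inner ℂ w.2 w.1).re} :=
        isClosed_le continuous_const (by fun_prop)
      exact closure_minimal (fun w hw => hacc w hw) hcl hw
    have hb : ∀ w ∈ S, l * ‖w.1‖ ≤ ‖T w‖ := by
      intro w hw
      have := norm_le_of_re_inner_nonneg (-(l : ℂ)) (haccS w hw)
      simpa [hTw, neg_smul, sub_neg_eq_add] using this
    -- the range is closed, since `T` is bounded below on the closed graph
    have hanti : AntilipschitzWith (Real.toNNReal (2 + l⁻¹)) (T.comp S.subtypeL) := by
      refine ContinuousLinearMap.antilipschitz_of_bound _ ?_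
      rintro ⟨w, hw⟩
      have h1 : ‖w.1‖ ≤ l⁻¹ * ‖T w‖ := by
        rw [inv_mul_eq_div, le_div_iff₀ hlp]
        linarith [hb w hw]
      have h2 : ‖w.2‖ ≤ 2 * ‖T w‖ := by
        have h3 : w.2 = T w - (l : ℂ) • w.1 := by rw [hTw]; abel
        have h4 : ‖(l : ℂ) • w.1‖ ≤ ‖T w‖ := by
          rw [norm_smul, Complex.norm_real, Real.norm_of_nonneg hlp.le]
          exact hb w hw
        calc ‖w.2‖ = ‖T w - (l : ℂ) • w.1‖ := by rw [← h3]
          _ ≤ ‖T w‖ + ‖(l : ℂ) • w.1‖ := norm_sub_le _ _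
          _ ≤ 2 * ‖T w‖ := by linarith
      have hpos : (0 : ℝ) ≤ 2 + l⁻¹ := by positivity
      change ‖w‖ ≤ (Real.toNNReal (2 + l⁻¹) : ℝ) * ‖T w‖
      rw [Real.coe_toNNReal _ hpos, Prod.norm_def]
      have h5 : 0 ≤ ‖T w‖ := norm_nonneg _
      have h6 : 0 ≤ l⁻¹ * ‖T w‖ := by positivity
      refine max_le ?_ ?_ <;> nlinarith
    have hScomplete : CompleteSpace S := (G.isClosed_topologicalClosure).completeSpace_coe
    have hKclosed : IsClosed (K : Set H) := by
      have : (K : Set H) = range (T.comp S.subtypeL) := by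
        ext y
        simp only [K, Submodule.map_coe, mem_image, SetLike.mem_coe, mem_range]
        constructor
        · rintro ⟨w, hw, rfl⟩
          exact ⟨⟨w, hw⟩, rfl⟩
        · rintro ⟨w, rfl⟩
          exact ⟨w.1, w.2, rfl⟩
      rw [this]
      exact hanti.isClosed_range (T.comp S.subtypeL).uniformContinuous
    have hKtop : K = ⊤ := by
      have hKc : CompleteSpace K := hKclosed.completeSpace_coe
      rw [← Submodule.orthogonal_eq_bot_iff, Submodule.eq_bot_iff]
      intro f hf
      refine hrange l hl0 f (fun w hw => ?_)
      rw [Submodule.mem_orthogonal'] at hf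
      exact hf _ ⟨w, G.le_topologicalClosure hw, rfl⟩
    intro f
    obtain ⟨w, hw, hwf⟩ : f ∈ K := by rw [hKtop]; trivial
    have hwA : w ∈ A.graph := by rw [hgraph]; exact hw
    obtain ⟨u, hu1, hu2⟩ := (LinearPMap.mem_graph_iff A).1 hwA
    exact ⟨u, by rw [hu1, hu2]; exact hwf⟩
  refine ⟨A, hgraphS, hdom, leftHalfPlaneResolvent_of_surjective A hAacc _ hsurj,
    ⟨hAacc, ?_⟩, ?_⟩
  · intro B hB hAB
    refine (LinearPMap.eq_of_le_of_domain_eq hAB (le_antisymm hAB.1 ?_)).symm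
    intro x hx
    obtain ⟨l, hl⟩ : ∃ l : ℝ, max l₀ 0 < l := exists_gt _
    obtain ⟨u, hu⟩ := hsurj l hl (B ⟨x, hx⟩ + (l : ℂ) • x)
    have hu' : A u = B ⟨u, hAB.1 u.2⟩ := hAB.2 (y := ⟨u, hAB.1 u.2⟩) rfl
    have h1 := norm_le_of_re_inner_nonneg (-(l : ℂ)) (hB (⟨x, hx⟩ - ⟨u, hAB.1 u.2⟩))
    rw [LinearPMap.map_sub] at h1
    have h2 : B ⟨x, hx⟩ - B ⟨u, hAB.1 u.2⟩ -
        -(l : ℂ) • ((⟨x, hx⟩ - ⟨u, hAB.1 u.2⟩ : B.domain) : H) = 0 := by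
      rw [hu'] at hu
      rw [Submodule.coe_sub, neg_smul, sub_neg_eq_add, smul_sub, sub_add_sub_comm, hu, sub_self]
    rw [h2, norm_zero] at h1
    have hlp : 0 < l := (le_max_right _ _).trans_lt hl
    have h3 : ‖x - u‖ = 0 := by
      simp only [Complex.neg_re, Complex.ofReal_re, neg_neg, Submodule.coe_sub] at h1
      nlinarith [norm_nonneg (x - u)]
    rw [norm_eq_zero, sub_eq_zero] at h3
    rw [h3]
    exact u.2
  · have hle : (A.graph : Set (H × H)) ⊆ Gmax := by
      rw [hgraphS]
      exact closure_minimal hsub hclosed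
    refine Subset.antisymm hle ?_
    rintro ⟨x, y⟩ hxy
    obtain ⟨l, hl⟩ : ∃ l : ℝ, max l₀ 0 < l := exists_gt _
    obtain ⟨u, hu⟩ := hsurj l hl (y + (l : ℂ) • x)
    have h1 := hdiff _ hxy _ (hle (A.mem_graph u))
    have h2 : x - u = 0 := by
      refine hker l ((le_max_left _ _).trans_lt hl) _ ?_
      convert h1 using 1
      simp only [Prod.mk_sub_mk, Prod.mk.injEq, true_and]
      rw [smul_sub, neg_sub, sub_eq_sub_iff_add_eq_add, add_comm, hu, add_comm]
    rw [sub_eq_zero] at h2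
    subst h2
    have h3 : y = A u := by simpa using hu.symm
    rw [h3]
    exact A.mem_graph u

end AbstractAccretive

/-! ### The operator on Schwartz functions -/

section SchwartzOperators

variable {n : ℕ}

/-- The `j`-th partial derivative of a real function on `ℝⁿ`. -/
noncomputable def realPartial (j : Fin n) (g : EuclideanSpace ℝ (Fin n) → ℝ) :
    EuclideanSpace ℝ (Fin n) → ℝ :=
  fun x => fderiv ℝ g x (EuclideanSpace.single j 1)

theorem Function.HasTemperateGrowth.fderiv {E F : Type*} [NormedAddCommGroup E] [NormedSpace ℝ E]
    [NormedAddCommGroup F] [NormedSpace ℝ F] {g : E → F} (hg : g.HasTemperateGrowth) :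
    (fderiv ℝ g).HasTemperateGrowth := by
  refine ⟨hg.1.fderiv_right (m := ∞) (by simp), fun m => ?_⟩
  obtain ⟨k, C, hC⟩ := hg.2 (m + 1)
  exact ⟨k, C, fun x => by rw [norm_iteratedFDeriv_fderiv]; exact hC x⟩

theorem Function.HasTemperateGrowth.realPartial {g : EuclideanSpace ℝ (Fin n) → ℝ}
    (hg : g.HasTemperateGrowth) (j : Fin n) : (realPartial j g).HasTemperateGrowth :=
  ((ContinuousLinearMap.apply ℝ ℝ (EuclideanSpace.single j (1 : ℝ))).hasTemperateGrowth).comp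
    hg.fderiv

theorem Function.HasTemperateGrowth.complexOfReal {g : EuclideanSpace ℝ (Fin n) → ℝ}
    (hg : g.HasTemperateGrowth) : (fun x => (g x : ℂ)).HasTemperateGrowth :=
  Complex.hasTemperateGrowth_ofReal.comp hg

/-- The partial derivative `∂ⱼ` on Schwartz functions. -/
noncomputable def schwartzPartial (j : Fin n) :
    𝓢(EuclideanSpace ℝ (Fin n), ℂ) →L[ℂ] 𝓢(EuclideanSpace ℝ (Fin n), ℂ) :=
  LineDeriv.lineDerivOpCLM ℂ 𝓢(EuclideanSpace ℝ (Fin n), ℂ) (EuclideanSpace.single j (1 : ℝ))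

/-- Multiplication of Schwartz functions by a real function of temperate growth (the zero map if
the function does not have temperate growth). -/
noncomputable def schwartzMul (g : EuclideanSpace ℝ (Fin n) → ℝ) :
    𝓢(EuclideanSpace ℝ (Fin n), ℂ) →L[ℂ] 𝓢(EuclideanSpace ℝ (Fin n), ℂ) :=
  SchwartzMap.smulLeftCLM ℂ (fun x => (g x : ℂ))

theorem schwartzPartial_apply (j : Fin n) (f : 𝓢(EuclideanSpace ℝ (Fin n), ℂ))
    (x : EuclideanSpace ℝ (Fin n)) : schwartzPartial j f x = partialDeriv j f x := by
  rw [schwartzPartial, LineDeriv.lineDerivOpCLM_apply, SchwartzMap.lineDerivOp_apply_eq_fderiv,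
    partialDeriv]

theorem coe_schwartzPartial (j : Fin n) (f : 𝓢(EuclideanSpace ℝ (Fin n), ℂ)) :
    (schwartzPartial j f : EuclideanSpace ℝ (Fin n) → ℂ) = partialDeriv j f :=
  funext (schwartzPartial_apply j f)

theorem schwartzMul_apply {g : EuclideanSpace ℝ (Fin n) → ℝ} (hg : g.HasTemperateGrowth)
    (f : 𝓢(EuclideanSpace ℝ (Fin n), ℂ)) (x : EuclideanSpace ℝ (Fin n)) :
    schwartzMul g f x = (g x : ℂ) * f x := by
  rw [schwartzMul, SchwartzMap.smulLeftCLM_apply_apply hg.complexOfReal, smul_eq_mul]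

theorem coe_schwartzMul {g : EuclideanSpace ℝ (Fin n) → ℝ} (hg : g.HasTemperateGrowth)
    (f : 𝓢(EuclideanSpace ℝ (Fin n), ℂ)) :
    (schwartzMul g f : EuclideanSpace ℝ (Fin n) → ℂ) = fun x => (g x : ℂ) * f x :=
  funext (schwartzMul_apply hg f)

theorem partialDeriv_ofReal_mul {g : EuclideanSpace ℝ (Fin n) → ℝ}
    {f : EuclideanSpace ℝ (Fin n) → ℂ} {x : EuclideanSpace ℝ (Fin n)}
    (hg : DifferentiableAt ℝ g x) (hf : DifferentiableAt ℝ f x) (j : Fin n) :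
    partialDeriv j (fun y => (g y : ℂ) * f y) x =
      (realPartial j g x : ℂ) * f x + (g x : ℂ) * partialDeriv j f x := by
  have h1 : HasFDerivAt (fun y => (g y : ℂ)) (Complex.ofRealCLM.comp (fderiv ℝ g x)) x :=
    Complex.ofRealCLM.hasFDerivAt.comp x hg.hasFDerivAt
  have h2 := h1.fun_mul hf.hasFDerivAt
  rw [partialDeriv, h2.fderiv]
  simp only [add_apply, smul_apply, ContinuousLinearMap.comp_apply,
    Complex.ofRealCLM_apply, smul_eq_mul, partialDeriv, realPartial]
  ring

theorem schwartzPartial_schwartzMul {g : EuclideanSpace ℝ (Fin n) → ℝ}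
    (hg : g.HasTemperateGrowth) (j : Fin n) (f : 𝓢(EuclideanSpace ℝ (Fin n), ℂ)) :
    schwartzPartial j (schwartzMul g f) =
      schwartzMul (realPartial j g) f + schwartzMul g (schwartzPartial j f) := by
  ext x
  rw [schwartzPartial_apply, coe_schwartzMul hg, add_apply,
    schwartzMul_apply (hg.realPartial j), schwartzMul_apply hg, schwartzPartial_apply]
  exact partialDeriv_ofReal_mul (hg.1.differentiable (by simp)).differentiableAt
    f.differentiableAt j

theorem partialDeriv_comm {f : EuclideanSpace ℝ (Fin n) → ℂ} {x : EuclideanSpace ℝ (Fin n)}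
    (hf : ContDiffAt ℝ 2 f x) (i j : Fin n) :
    partialDeriv i (partialDeriv j f) x = partialDeriv j (partialDeriv i f) x := by
  have hd : DifferentiableAt ℝ (fderiv ℝ f) x :=
    (hf.fderiv_right (m := 1) (by norm_num)).differentiableAt (by norm_num)
  have h : ∀ a b : Fin n, partialDeriv a (partialDeriv b f) x =
      fderiv ℝ (fderiv ℝ f) x (EuclideanSpace.single a 1) (EuclideanSpace.single b 1) := by
    intro a b
    have h1 : HasFDerivAt (partialDeriv b f) ((ContinuousLinearMap.apply ℝ ℂ
        (EuclideanSpace.single b (1 : ℝ))).comp (fderiv ℝ (fderiv ℝ f) x)) x :=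
      (ContinuousLinearMap.apply ℝ ℂ (EuclideanSpace.single b (1 : ℝ))).hasFDerivAt.comp x
        hd.hasFDerivAt
    rw [partialDeriv, h1.fderiv]
    rfl
  rw [h, h]
  exact (hf.isSymmSndFDerivAt (by simp)).eq _ _

theorem schwartzPartial_comm (i j : Fin n) (f : 𝓢(EuclideanSpace ℝ (Fin n), ℂ)) :
    schwartzPartial i (schwartzPartial j f) = schwartzPartial j (schwartzPartial i f) := by
  ext x
  rw [schwartzPartial_apply, coe_schwartzPartial, schwartzPartial_apply, coe_schwartzPartial]
  exact partialDeriv_comm (f.contDiffAt 2) i j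

/-- The operator `P` on Schwartz functions, as a continuous linear map. It is the differential
expression `diffExpr` if the coefficients have temperate growth. -/
noncomputable def schwartzOp (h : ℝ) (b : Fin n → Fin n → EuclideanSpace ℝ (Fin n) → ℝ)
    (c : Fin n → EuclideanSpace ℝ (Fin n) → ℝ) (p : EuclideanSpace ℝ (Fin n) → ℝ) :
    𝓢(EuclideanSpace ℝ (Fin n), ℂ) →L[ℂ] 𝓢(EuclideanSpace ℝ (Fin n), ℂ) :=
  (-(h : ℂ) ^ 2) • (∑ j, ∑ k, schwartzPartial j ∘L schwartzMul (b j k) ∘L schwartzPartial k) +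
  ((h : ℂ) / 2) • (∑ j, (schwartzMul (c j) ∘L schwartzPartial j +
    schwartzPartial j ∘L schwartzMul (c j))) + schwartzMul p

/-- The coefficients have temperate growth. -/
structure TemperateCoeffs (b : Fin n → Fin n → EuclideanSpace ℝ (Fin n) → ℝ)
    (c : Fin n → EuclideanSpace ℝ (Fin n) → ℝ) (p : EuclideanSpace ℝ (Fin n) → ℝ) : Prop where
  b : ∀ j k, (b j k).HasTemperateGrowth
  c : ∀ j, (c j).HasTemperateGrowth
  p : p.HasTemperateGrowth

variable {h : ℝ} {b : Fin n → Fin n → EuclideanSpace ℝ (Fin n) → ℝ}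
  {c : Fin n → EuclideanSpace ℝ (Fin n) → ℝ} {p : EuclideanSpace ℝ (Fin n) → ℝ}

theorem schwartzOp_eq (f : 𝓢(EuclideanSpace ℝ (Fin n), ℂ)) :
    schwartzOp h b c p f =
      (-(h : ℂ) ^ 2) • (∑ j, ∑ k, schwartzPartial j (schwartzMul (b j k) (schwartzPartial k f))) +
      ((h : ℂ) / 2) • (∑ j, (schwartzMul (c j) (schwartzPartial j f) +
        schwartzPartial j (schwartzMul (c j) f))) + schwartzMul p f := by
  simp [schwartzOp, sum_apply]

theorem TemperateCoeffs.neg (hT : TemperateCoeffs b c p) :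
    TemperateCoeffs b (fun j x => -c j x) p :=
  ⟨hT.b, fun j => (hT.c j).neg, hT.p⟩

theorem TemperateCoeffs.realPartial (hT : TemperateCoeffs b c p) (i : Fin n) :
    TemperateCoeffs (fun j k => realPartial i (b j k)) (fun j => realPartial i (c j))
      (realPartial i p) :=
  ⟨fun j k => (hT.b j k).realPartial i, fun j => (hT.c j).realPartial i, hT.p.realPartial i⟩

theorem SchwartzMap.finset_sum_apply {ι : Type*} (s : Finset ι)
    (f : ι → 𝓢(EuclideanSpace ℝ (Fin n), ℂ)) (x : EuclideanSpace ℝ (Fin n)) :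
    (∑ i ∈ s, f i) x = ∑ i ∈ s, f i x := by
  classical
  induction s using Finset.induction_on with
  | empty => simp
  | insert a s ha ih => rw [Finset.sum_insert ha, Finset.sum_insert ha, add_apply, ih]

theorem schwartzOp_apply (hT : TemperateCoeffs b c p) (f : 𝓢(EuclideanSpace ℝ (Fin n), ℂ))
    (x : EuclideanSpace ℝ (Fin n)) : schwartzOp h b c p f x = diffExpr h b c p f x := by
  rw [schwartzOp_eq, diffExpr]
  simp only [add_apply, smul_apply, SchwartzMap.finset_sum_apply,
    schwartzMul_apply hT.p, schwartzMul_apply (hT.c _), schwartzPartial_apply,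
    coe_schwartzMul (hT.c _), coe_schwartzMul (hT.b _ _), smul_eq_mul]
  congr 1
  congr 1
  · rw [Finset.mul_sum]
    refine Finset.sum_congr rfl fun j _ => ?_
    rw [Finset.mul_sum]
    refine Finset.sum_congr rfl fun k _ => ?_
    have hd : DifferentiableAt ℝ
        (fun y => (b j k y : ℂ) * partialDeriv k (f : EuclideanSpace ℝ (Fin n) → ℂ) y) x := by
      have := (schwartzMul (b j k) (schwartzPartial k f)).differentiableAt (x := x)
      rw [coe_schwartzMul (hT.b j k), coe_schwartzPartial] at this
      exact this
    have h1 : (fun y => (b j k y : ℂ) * semiD h k (f : EuclideanSpace ℝ (Fin n) → ℂ) y) =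
        fun y => ((h : ℂ) / Complex.I) •
          ((b j k y : ℂ) * partialDeriv k (f : EuclideanSpace ℝ (Fin n) → ℂ) y) := by
      funext y
      simp only [semiD, smul_eq_mul]
      ring
    have h2 : partialDeriv j (fun y => ((h : ℂ) / Complex.I) •
          ((b j k y : ℂ) * partialDeriv k (f : EuclideanSpace ℝ (Fin n) → ℂ) y)) x =
        ((h : ℂ) / Complex.I) * partialDeriv j
          (fun y => (b j k y : ℂ) * partialDeriv k (f : EuclideanSpace ℝ (Fin n) → ℂ) y) x := by
      rw [partialDeriv, fderiv_fun_const_smul hd]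
      rfl
    rw [semiD, h1, h2, ← mul_assoc]
    congr 1
    field_simp
    simp
  · rw [Finset.mul_sum, Finset.mul_sum]
    refine Finset.sum_congr rfl fun j _ => ?_
    have hd : DifferentiableAt ℝ (fun y => (c j y : ℂ) * f y) x := by
      have := (schwartzMul (c j) f).differentiableAt (x := x)
      rw [coe_schwartzMul (hT.c j)] at this
      exact this
    ring

theorem coe_schwartzOp (hT : TemperateCoeffs b c p) (f : 𝓢(EuclideanSpace ℝ (Fin n), ℂ)) :
    (schwartzOp h b c p f : EuclideanSpace ℝ (Fin n) → ℂ) = diffExpr h b c p f :=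
  funext (schwartzOp_apply hT f)

/-- The operator in non-divergence form. -/
theorem schwartzOp_apply_expand (hT : TemperateCoeffs b c p)
    (f : 𝓢(EuclideanSpace ℝ (Fin n), ℂ)) (x : EuclideanSpace ℝ (Fin n)) :
    schwartzOp h b c p f x =
      -(h : ℂ) ^ 2 * (∑ j, ∑ k, ((realPartial j (b j k) x : ℂ) * schwartzPartial k f x +
        (b j k x : ℂ) * schwartzPartial j (schwartzPartial k f) x)) +
      (h : ℂ) * (∑ j, ((c j x : ℂ) * schwartzPartial j f x +
        1 / 2 * (realPartial j (c j) x : ℂ) * f x)) + (p x : ℂ) * f x := by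
  rw [schwartzOp_eq]
  simp only [add_apply, smul_apply, SchwartzMap.finset_sum_apply,
    schwartzPartial_schwartzMul (hT.c _), schwartzPartial_schwartzMul (hT.b _ _),
    schwartzMul_apply hT.p, schwartzMul_apply (hT.c _), schwartzMul_apply (hT.b _ _),
    schwartzMul_apply ((hT.c _).realPartial _), schwartzMul_apply ((hT.b _ _).realPartial _),
    smul_eq_mul]
  congr 2
  rw [Finset.mul_sum, Finset.mul_sum]
  refine Finset.sum_congr rfl fun j _ => ?_
  ring

/-- Differentiating `P f` once: the remainder is the operator with differentiated coefficients. -/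
theorem schwartzPartial_schwartzOp (hT : TemperateCoeffs b c p) (i : Fin n)
    (f : 𝓢(EuclideanSpace ℝ (Fin n), ℂ)) :
    schwartzPartial i (schwartzOp h b c p f) = schwartzOp h b c p (schwartzPartial i f) +
      schwartzOp h (fun j k => realPartial i (b j k)) (fun j => realPartial i (c j))
        (realPartial i p) f := by
  simp only [schwartzOp_eq, map_add, map_smul, map_sum]
  have h1 : ∀ j k, schwartzPartial i (schwartzPartial j (schwartzMul (b j k)
      (schwartzPartial k f))) =
      schwartzPartial j (schwartzMul (b j k) (schwartzPartial k (schwartzPartial i f))) +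
      schwartzPartial j (schwartzMul (realPartial i (b j k)) (schwartzPartial k f)) := by
    intro j k
    rw [schwartzPartial_comm i j, schwartzPartial_schwartzMul (hT.b j k), map_add,
      schwartzPartial_comm i k, add_comm]
  have h2 : ∀ j, schwartzPartial i (schwartzMul (c j) (schwartzPartial j f)) =
      schwartzMul (c j) (schwartzPartial j (schwartzPartial i f)) +
      schwartzMul (realPartial i (c j)) (schwartzPartial j f) := by
    intro j
    rw [schwartzPartial_schwartzMul (hT.c j), schwartzPartial_comm i j, add_comm]
  have h3 : ∀ j, schwartzPartial i (schwartzPartial j (schwartzMul (c j) f)) =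
      schwartzPartial j (schwartzMul (c j) (schwartzPartial i f)) +
      schwartzPartial j (schwartzMul (realPartial i (c j)) f) := by
    intro j
    rw [schwartzPartial_comm i j, schwartzPartial_schwartzMul (hT.c j), map_add, add_comm]
  simp only [h1, h2, h3, schwartzPartial_schwartzMul hT.p, Finset.sum_add_distrib]
  module

/-! ### The `L²` pairing of Schwartz functions -/

/-- The `L²` inner product of Schwartz functions, conjugate-linear in the first argument. -/
noncomputable def schwartzInner (f g : 𝓢(EuclideanSpace ℝ (Fin n), ℂ)) : ℂ :=
  inner ℂ (SchwartzMap.toLpCLM ℂ ℂ 2 volume f) (SchwartzMap.toLpCLM ℂ ℂ 2 volume g)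

/-- The `L²` norm of a Schwartz function. -/
noncomputable def schwartzNorm (f : 𝓢(EuclideanSpace ℝ (Fin n), ℂ)) : ℝ :=
  ‖SchwartzMap.toLpCLM ℂ ℂ 2 volume f‖

theorem schwartzInner_eq_integral (f g : 𝓢(EuclideanSpace ℝ (Fin n), ℂ)) :
    schwartzInner f g = ∫ x, (starRingEnd ℂ) (f x) * g x := by
  rw [schwartzInner]
  refine (SchwartzMap.inner_toL2_toL2_eq f g volume).trans ?_
  refine integral_congr_ae (Filter.Eventually.of_forall fun x => ?_)
  simp [mul_comm]

theorem integrable_conj_mul (f g : 𝓢(EuclideanSpace ℝ (Fin n), ℂ)) :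
    Integrable (fun x => (starRingEnd ℂ) (f x) * g x) := by
  exact MemLp.integrable_mul (p := 2) (q := 2) (f.memLp 2 volume).star (g.memLp 2 volume)

theorem re_schwartzInner_eq_integral (f g : 𝓢(EuclideanSpace ℝ (Fin n), ℂ)) :
    (schwartzInner f g).re = ∫ x, ((starRingEnd ℂ) (f x) * g x).re := by
  rw [schwartzInner_eq_integral]
  exact (integral_re (integrable_conj_mul f g)).symm

theorem integrable_re_conj_mul (f g : 𝓢(EuclideanSpace ℝ (Fin n), ℂ)) :
    Integrable (fun x => ((starRingEnd ℂ) (f x) * g x).re) :=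
  (integrable_conj_mul f g).re

theorem schwartzInner_add_right (f g k : 𝓢(EuclideanSpace ℝ (Fin n), ℂ)) :
    schwartzInner f (g + k) = schwartzInner f g + schwartzInner f k := by
  rw [schwartzInner, map_add, inner_add_right]; rfl

theorem schwartzInner_add_left (f g k : 𝓢(EuclideanSpace ℝ (Fin n), ℂ)) :
    schwartzInner (f + g) k = schwartzInner f k + schwartzInner g k := by
  rw [schwartzInner, map_add, inner_add_left]; rfl

theorem schwartzInner_sub_left (f g k : 𝓢(EuclideanSpace ℝ (Fin n), ℂ)) :
    schwartzInner (f - g) k = schwartzInner f k - schwartzInner g k := by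
  rw [schwartzInner, map_sub, inner_sub_left]; rfl

theorem schwartzInner_sub_right (f g k : 𝓢(EuclideanSpace ℝ (Fin n), ℂ)) :
    schwartzInner f (g - k) = schwartzInner f g - schwartzInner f k := by
  rw [schwartzInner, map_sub, inner_sub_right]; rfl

theorem schwartzInner_smul_right (a : ℂ) (f g : 𝓢(EuclideanSpace ℝ (Fin n), ℂ)) :
    schwartzInner f (a • g) = a * schwartzInner f g := by
  rw [schwartzInner, map_smul, inner_smul_right]; rfl

theorem schwartzInner_smul_left (a : ℂ) (f g : 𝓢(EuclideanSpace ℝ (Fin n), ℂ)) :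
    schwartzInner (a • f) g = (starRingEnd ℂ) a * schwartzInner f g := by
  rw [schwartzInner, map_smul, inner_smul_left]; rfl

theorem schwartzInner_sum_right {ι : Type*} (s : Finset ι) (f : 𝓢(EuclideanSpace ℝ (Fin n), ℂ))
    (g : ι → 𝓢(EuclideanSpace ℝ (Fin n), ℂ)) :
    schwartzInner f (∑ i ∈ s, g i) = ∑ i ∈ s, schwartzInner f (g i) := by
  rw [schwartzInner, map_sum, inner_sum]; rfl

theorem schwartzInner_sum_left {ι : Type*} (s : Finset ι) (f : 𝓢(EuclideanSpace ℝ (Fin n), ℂ))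
    (g : ι → 𝓢(EuclideanSpace ℝ (Fin n), ℂ)) :
    schwartzInner (∑ i ∈ s, g i) f = ∑ i ∈ s, schwartzInner (g i) f := by
  rw [schwartzInner, map_sum, sum_inner]; rfl

theorem conj_schwartzInner (f g : 𝓢(EuclideanSpace ℝ (Fin n), ℂ)) :
    (starRingEnd ℂ) (schwartzInner f g) = schwartzInner g f :=
  inner_conj_symm _ _

theorem re_schwartzInner_comm (f g : 𝓢(EuclideanSpace ℝ (Fin n), ℂ)) :
    (schwartzInner f g).re = (schwartzInner g f).re := by
  rw [← conj_schwartzInner, Complex.conj_re]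

theorem schwartzInner_self (f : 𝓢(EuclideanSpace ℝ (Fin n), ℂ)) :
    schwartzInner f f = (schwartzNorm f ^ 2 : ℝ) := by
  rw [schwartzInner, inner_self_eq_norm_sq_to_K]
  simp [schwartzNorm]

theorem schwartzNorm_sq (f : 𝓢(EuclideanSpace ℝ (Fin n), ℂ)) :
    schwartzNorm f ^ 2 = (schwartzInner f f).re := by
  rw [schwartzInner_self, Complex.ofReal_re]

theorem schwartzNorm_nonneg (f : 𝓢(EuclideanSpace ℝ (Fin n), ℂ)) : 0 ≤ schwartzNorm f :=
  norm_nonneg _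

theorem schwartzNorm_sq_eq_integral (f : 𝓢(EuclideanSpace ℝ (Fin n), ℂ)) :
    schwartzNorm f ^ 2 = ∫ x, ‖f x‖ ^ 2 := by
  rw [schwartzNorm_sq, re_schwartzInner_eq_integral]
  refine integral_congr_ae (Filter.Eventually.of_forall fun x => ?_)
  simp only
  rw [Complex.conj_mul', ← Complex.ofReal_pow, Complex.ofReal_re]

theorem integrable_norm_sq_schwartz (f : 𝓢(EuclideanSpace ℝ (Fin n), ℂ)) :
    Integrable (fun x => ‖f x‖ ^ 2) := by
  have := integrable_re_conj_mul f f
  refine this.congr (Filter.Eventually.of_forall fun x => ?_)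
  simp only
  rw [Complex.conj_mul', ← Complex.ofReal_pow, Complex.ofReal_re]

theorem schwartzInner_mul {g : EuclideanSpace ℝ (Fin n) → ℝ} (hg : g.HasTemperateGrowth)
    (f k : 𝓢(EuclideanSpace ℝ (Fin n), ℂ)) :
    schwartzInner (schwartzMul g f) k = schwartzInner f (schwartzMul g k) := by
  rw [schwartzInner_eq_integral, schwartzInner_eq_integral]
  refine integral_congr_ae (Filter.Eventually.of_forall fun x => ?_)
  simp only [schwartzMul_apply hg, map_mul, Complex.conj_ofReal]
  ring

/-- Complex conjugation of Schwartz functions. -/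
noncomputable def schwartzConj (f : 𝓢(EuclideanSpace ℝ (Fin n), ℂ)) :
    𝓢(EuclideanSpace ℝ (Fin n), ℂ) :=
  SchwartzMap.postcompCLM (𝕜 := ℝ) Complex.conjCLE.toContinuousLinearMap f

theorem schwartzConj_apply (f : 𝓢(EuclideanSpace ℝ (Fin n), ℂ)) (x : EuclideanSpace ℝ (Fin n)) :
    schwartzConj f x = (starRingEnd ℂ) (f x) := by
  rw [schwartzConj, SchwartzMap.postcompCLM_apply]
  rfl

theorem coe_schwartzConj (f : 𝓢(EuclideanSpace ℝ (Fin n), ℂ)) :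
    (schwartzConj f : EuclideanSpace ℝ (Fin n) → ℂ) = fun x => (starRingEnd ℂ) (f x) :=
  funext (schwartzConj_apply f)

theorem partialDeriv_conj {f : EuclideanSpace ℝ (Fin n) → ℂ} {x : EuclideanSpace ℝ (Fin n)}
    (hf : DifferentiableAt ℝ f x) (j : Fin n) :
    partialDeriv j (fun y => (starRingEnd ℂ) (f y)) x = (starRingEnd ℂ) (partialDeriv j f x) := by
  have h1 : HasFDerivAt (fun y => (starRingEnd ℂ) (f y))
      (Complex.conjCLE.toContinuousLinearMap.comp (fderiv ℝ f x)) x :=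
    Complex.conjCLE.toContinuousLinearMap.hasFDerivAt.comp x hf.hasFDerivAt
  rw [partialDeriv, h1.fderiv]
  rfl

theorem schwartzPartial_conj (j : Fin n) (f : 𝓢(EuclideanSpace ℝ (Fin n), ℂ)) :
    schwartzPartial j (schwartzConj f) = schwartzConj (schwartzPartial j f) := by
  ext x
  rw [schwartzPartial_apply, schwartzConj_apply, schwartzPartial_apply, coe_schwartzConj]
  exact partialDeriv_conj f.differentiableAt j

theorem integral_mul_schwartzPartial (f g : 𝓢(EuclideanSpace ℝ (Fin n), ℂ)) (j : Fin n) :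
    ∫ x, f x * schwartzPartial j g x = -∫ x, schwartzPartial j f x * g x :=
  SchwartzMap.integral_mul_lineDerivOp_right_eq_neg_left f g _

theorem schwartzInner_partial (f g : 𝓢(EuclideanSpace ℝ (Fin n), ℂ)) (j : Fin n) :
    schwartzInner (schwartzPartial j f) g = -schwartzInner f (schwartzPartial j g) := by
  rw [schwartzInner_eq_integral, schwartzInner_eq_integral]
  have := integral_mul_schwartzPartial (schwartzConj f) g j
  simp only [schwartzConj_apply, schwartzPartial_conj] at this
  rw [this, neg_neg]

theorem norm_schwartzInner_le (f g : 𝓢(EuclideanSpace ℝ (Fin n), ℂ)) :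
    ‖schwartzInner f g‖ ≤ schwartzNorm f * schwartzNorm g :=
  norm_inner_le_norm _ _

theorem schwartzNorm_le_of_norm_le {f g : 𝓢(EuclideanSpace ℝ (Fin n), ℂ)} {A : ℝ} (hA : 0 ≤ A)
    (hfg : ∀ x, ‖f x‖ ≤ A * ‖g x‖) : schwartzNorm f ≤ A * schwartzNorm g := by
  refine abs_le_of_sq_le_sq' ?_ (mul_nonneg hA (schwartzNorm_nonneg g)) |>.2
  rw [mul_pow, schwartzNorm_sq_eq_integral, schwartzNorm_sq_eq_integral, ← integral_const_mul]
  refine integral_mono (integrable_norm_sq_schwartz f)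
    ((integrable_norm_sq_schwartz g).const_mul _) fun x => ?_
  simp only
  rw [← mul_pow]
  exact pow_le_pow_left₀ (norm_nonneg _) (hfg x) 2

end SchwartzOperators

/-! ### Oleinik's inequality -/

section Oleinik

/-- A nonnegative function with second derivative bounded by `M` satisfies `f'² ≤ 2 M f`. -/
theorem sq_deriv_le_of_nonneg {f f' f'' : ℝ → ℝ} {M : ℝ} (hf : ∀ t, HasDerivAt f (f' t) t)
    (hf' : ∀ t, HasDerivAt f' (f'' t) t) (h0 : ∀ t, 0 ≤ f t) (hM : ∀ t, |f'' t| ≤ M) :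
    f' 0 ^ 2 ≤ 2 * M * f 0 := by
  -- by the reflection `t ↦ -t` one may assume `f' 0 ≤ 0`
  wlog hneg : f' 0 ≤ 0 generalizing f f' f''
  · have h1 : ∀ t, HasDerivAt (fun t => f (-t)) (-f' (-t)) t := fun t =>
      ((hf (-t)).comp t (hasDerivAt_neg t)).congr_deriv (by ring)
    have h2 : ∀ t, HasDerivAt (fun t => -f' (-t)) (f'' (-t)) t := fun t =>
      ((hf' (-t)).comp t (hasDerivAt_neg t)).neg.congr_deriv (by ring)
    have := this h1 h2 (fun t => h0 _) (fun t => hM _) (by simp; linarith)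
    simpa using this
  have hM0 : 0 ≤ M := (abs_nonneg _).trans (hM 0)
  have hmono : Monotone (fun t => M * t - f' t) := by
    refine monotone_of_hasDerivAt_nonneg (f' := fun t => M - f'' t) (fun t => ?_) (fun t => ?_)
    · exact (((hasDerivAt_id t).const_mul M).sub (hf' t)).congr_deriv (by ring)
    · have := (abs_le.1 (hM t)).2
      simp only [Pi.zero_apply]
      linarith
  have hquad : ∀ t, 0 < t → 0 ≤ f 0 + f' 0 * t + M / 2 * t ^ 2 := by
    intro t ht
    have hd : ∀ s, HasDerivAt (fun s => f 0 + f' 0 * s + M / 2 * s ^ 2 - f s)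
        (f' 0 + M * s - f' s) s := by
      intro s
      have h1 := ((((hasDerivAt_id s).const_mul (f' 0)).const_add (f 0)).add
        (((hasDerivAt_id s).pow 2).const_mul (M / 2))).sub (hf s)
      refine h1.congr_deriv ?_
      simp
      ring
    obtain ⟨s, hs, hs'⟩ := exists_hasDerivAt_eq_slope _ _ ht
      (fun x _ => (hd x).continuousAt.continuousWithinAt) (fun x _ => hd x)
    have h3 := hmono hs.1.le
    simp only [mul_zero, zero_sub] at h3
    rw [sub_zero, eq_div_iff ht.ne'] at hs'
    have h4 := h0 t
    have h5 : 0 ≤ (f' 0 + M * s - f' s) * t := by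
      apply mul_nonneg _ ht.le
      linarith
    rw [hs'] at h5
    simp only [mul_zero] at h5
    nlinarith
  rcases hM0.eq_or_lt with hM1 | hM1
  · subst hM1
    have : f' 0 = 0 := by
      by_contra hne
      have hlt : f' 0 < 0 := lt_of_le_of_ne hneg hne
      have h7 := hquad ((f 0 + 1) / (-f' 0)) (div_pos (by linarith [h0 0]) (by linarith))
      have h8 : f' 0 * ((f 0 + 1) / (-f' 0)) = -(f 0 + 1) := by field_simp
      rw [h8] at h7
      linarith
    rw [this]
    simp
  · rcases hneg.eq_or_lt with h9 | h9
    · rw [h9]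
      have := h0 0
      simp only [ne_eq, OfNat.ofNat_ne_zero, not_false_eq_true, zero_pow]
      positivity
    · have h7 := hquad (-f' 0 / M) (div_pos (by linarith) hM1)
      have h8 : f 0 + f' 0 * (-f' 0 / M) + M / 2 * (-f' 0 / M) ^ 2 =
          (2 * M * f 0 - f' 0 ^ 2) / (2 * M) := by
        field_simp
        ring
      rw [h8] at h7
      by_contra hlt
      exact absurd h7 (not_le.2 (div_neg_of_neg_of_pos (by linarith) (by linarith)))

variable {n : ℕ}

open Matrix in
/-- The algebraic half of Oleinik's inequality, by diagonalizing the symmetric matrix `W`. -/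
theorem sq_trace_mul_le {B β : Matrix (Fin n) (Fin n) ℝ} {A : ℝ}
    (hB : ∀ ξ : Fin n → ℝ, (ξ ⬝ᵥ β *ᵥ ξ) ^ 2 ≤ A * (ξ ⬝ᵥ ξ) * (ξ ⬝ᵥ B *ᵥ ξ))
    {W : Matrix (Fin n) (Fin n) ℝ} (hW : W.IsHermitian) :
    (β * W).trace ^ 2 ≤ n * A * (W * B * W).trace := by
  obtain ⟨U, D, hU1, hWd⟩ : ∃ (U : Matrix (Fin n) (Fin n) ℝ) (D : Fin n → ℝ),
      Uᵀ * U = 1 ∧ W = U * diagonal D * Uᵀ := by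
    refine ⟨(hW.eigenvectorUnitary : Matrix (Fin n) (Fin n) ℝ), hW.eigenvalues, ?_, ?_⟩
    · have := Unitary.coe_star_mul_self hW.eigenvectorUnitary
      rw [star_eq_conjTranspose, conjTranspose_eq_transpose_of_trivial] at this
      exact this
    · have h := hW.spectral_theorem
      rw [Unitary.conjStarAlgAut_apply, star_eq_conjTranspose, conjTranspose_eq_transpose_of_trivial] at h
      exact h
  let v : Fin n → Fin n → ℝ := fun l j => U j l
  have hform : ∀ (X : Matrix (Fin n) (Fin n) ℝ) (l : Fin n), (Uᵀ * X * U) l l = v l ⬝ᵥ X *ᵥ v l := by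
    intro X l
    rw [Matrix.mul_assoc, Matrix.mul_apply_eq_vecMul]
    simp only [Matrix.vecMul, dotProduct, mulVec, Matrix.mul_apply, Matrix.transpose_apply, v]
  have hnorm : ∀ l, v l ⬝ᵥ v l = 1 := by
    intro l
    have := congrFun (congrFun hU1 l) l
    simpa [Matrix.mul_apply, v, dotProduct] using this
  have h1 : (β * W).trace = ∑ l, D l * (v l ⬝ᵥ β *ᵥ v l) := by
    have : (β * W).trace = ((Uᵀ * β * U) * diagonal D).trace := by
      rw [hWd, ← Matrix.mul_assoc, Matrix.trace_mul_comm, ← Matrix.mul_assoc, ← Matrix.mul_assoc]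
    rw [this, Matrix.trace]
    refine Finset.sum_congr rfl fun l _ => ?_
    rw [Matrix.diag_apply, Matrix.mul_diagonal, hform, mul_comm]
  have h2 : (W * B * W).trace = ∑ l, D l ^ 2 * (v l ⬝ᵥ B *ᵥ v l) := by
    have : (W * B * W).trace = ((Uᵀ * B * U) * diagonal D * diagonal D).trace := by
      have e1 : W * B * W = U * (diagonal D * (Uᵀ * B * U) * diagonal D) * Uᵀ := by
        rw [hWd]
        simp only [Matrix.mul_assoc]
      rw [e1, Matrix.trace_mul_comm, ← Matrix.mul_assoc, hU1, Matrix.one_mul, Matrix.mul_assoc,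
        Matrix.trace_mul_comm]
    rw [this, Matrix.trace]
    refine Finset.sum_congr rfl fun l _ => ?_
    rw [Matrix.diag_apply, Matrix.mul_diagonal, Matrix.mul_diagonal, hform]
    ring
  rw [h1, h2]
  calc (∑ l, D l * (v l ⬝ᵥ β *ᵥ v l)) ^ 2
      ≤ (Finset.univ : Finset (Fin n)).card * ∑ l, (D l * (v l ⬝ᵥ β *ᵥ v l)) ^ 2 :=
        sq_sum_le_card_mul_sum_sq
    _ ≤ n * ∑ l, A * (D l ^ 2 * (v l ⬝ᵥ B *ᵥ v l)) := by
        rw [Finset.card_univ, Fintype.card_fin]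
        gcongr with l _
        have := hB (v l)
        rw [hnorm, mul_one] at this
        rw [mul_pow]
        nlinarith [sq_nonneg (D l)]
    _ = n * A * ∑ l, D l ^ 2 * (v l ⬝ᵥ B *ᵥ v l) := by
        rw [← Finset.mul_sum]
        ring

theorem hasDerivAt_along_axis {g : EuclideanSpace ℝ (Fin n) → ℝ} (hg : ContDiff ℝ 1 g)
    (x : EuclideanSpace ℝ (Fin n)) (i : Fin n) (t : ℝ) :
    HasDerivAt (fun t : ℝ => g (x + t • EuclideanSpace.single i (1 : ℝ)))
      (realPartial i g (x + t • EuclideanSpace.single i (1 : ℝ))) t := by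
  have h1 : HasDerivAt (fun t : ℝ => x + t • EuclideanSpace.single i (1 : ℝ))
      (EuclideanSpace.single i (1 : ℝ)) t := by
    simpa using ((hasDerivAt_id t).smul_const (EuclideanSpace.single i (1 : ℝ))).const_add x
  exact ((hg.differentiable (by simp)).differentiableAt (x := _)).hasFDerivAt.comp_hasDerivAt t h1

theorem contDiff_realPartial {g : EuclideanSpace ℝ (Fin n) → ℝ} (hg : ContDiff ℝ ∞ g)
    (i : Fin n) : ContDiff ℝ ∞ (realPartial i g) :=
  (hg.fderiv_right (m := ∞) (by simp)).clm_apply contDiff_const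

/-- Oleinik's inequality: for a nonnegative matrix function `b` with bounded second derivatives,
first derivatives contracted with a symmetric matrix are controlled by the form `b` itself. -/
theorem oleinik_inequality {b : Fin n → Fin n → EuclideanSpace ℝ (Fin n) → ℝ} {K : ℝ}
    (hb : ∀ j k, ContDiff ℝ ∞ (b j k))
    (hpos : ∀ x, ∀ ξ : Fin n → ℝ, 0 ≤ ∑ j, ∑ k, b j k x * ξ j * ξ k)
    (i : Fin n) (hK : ∀ j k x, |realPartial i (realPartial i (b j k)) x| ≤ K)
    (x : EuclideanSpace ℝ (Fin n)) (W : Fin n → Fin n → ℝ) (hW : ∀ j k, W j k = W k j) :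
    (∑ j, ∑ k, realPartial i (b j k) x * W j k) ^ 2 ≤
      n * (2 * K * n) * ∑ l, ∑ j, ∑ k, b j k x * W j l * W k l := by
  have key : ∀ ξ : Fin n → ℝ, (∑ j, ∑ k, realPartial i (b j k) x * ξ j * ξ k) ^ 2 ≤
      2 * K * n * (∑ j, ξ j * ξ j) * ∑ j, ∑ k, b j k x * ξ j * ξ k := by
    intro ξ
    let line : ℝ → EuclideanSpace ℝ (Fin n) := fun t => x + t • EuclideanSpace.single i (1 : ℝ)
    have h1 := sq_deriv_le_of_nonneg (M := K * n * ∑ j, ξ j * ξ j)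
      (f := fun t => ∑ j, ∑ k, b j k (line t) * ξ j * ξ k)
      (f' := fun t => ∑ j, ∑ k, realPartial i (b j k) (line t) * ξ j * ξ k)
      (f'' := fun t => ∑ j, ∑ k, realPartial i (realPartial i (b j k)) (line t) * ξ j * ξ k)
      (fun t => HasDerivAt.fun_sum fun j _ => HasDerivAt.fun_sum fun k _ =>
        ((hasDerivAt_along_axis ((hb j k).of_le (by simp)) x i t).mul_const _).mul_const _)
      (fun t => HasDerivAt.fun_sum fun j _ => HasDerivAt.fun_sum fun k _ =>
        ((hasDerivAt_along_axis ((contDiff_realPartial (hb j k) i).of_le (by simp)) x i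
          t).mul_const _).mul_const _)
      (fun t => hpos _ ξ) ?_
    · simp only [line, zero_smul, add_zero] at h1
      linarith
    · intro t
      rcases Nat.eq_zero_or_pos n with hn | hn
      · subst hn
        simp
      have hK0 : 0 ≤ K := (abs_nonneg _).trans (hK ⟨0, hn⟩ ⟨0, hn⟩ x)
      calc |∑ j, ∑ k, realPartial i (realPartial i (b j k)) (line t) * ξ j * ξ k|
          ≤ ∑ j, ∑ k, K * |ξ j| * |ξ k| := by
            refine (Finset.abs_sum_le_sum_abs _ _).trans (Finset.sum_le_sum fun j _ => ?_)
            refine (Finset.abs_sum_le_sum_abs _ _).trans (Finset.sum_le_sum fun k _ => ?_)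
            rw [abs_mul, abs_mul]
            gcongr
            exact hK j k _
        _ = K * (∑ j, |ξ j|) ^ 2 := by
            rw [sq, Finset.sum_mul_sum, Finset.mul_sum]
            refine Finset.sum_congr rfl fun j _ => ?_
            rw [Finset.mul_sum]
            refine Finset.sum_congr rfl fun k _ => by ring
        _ ≤ K * (n * ∑ j, |ξ j| ^ 2) := by
            gcongr
            have := sq_sum_le_card_mul_sum_sq (s := (Finset.univ : Finset (Fin n)))
              (f := fun j => |ξ j|)
            rwa [Finset.card_univ, Fintype.card_fin] at this
        _ = K * n * ∑ j, ξ j * ξ j := by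
            simp only [sq_abs]
            simp only [sq]
            ring
  have h2 := sq_trace_mul_le (B := Matrix.of fun j k => b j k x)
    (β := Matrix.of fun j k => realPartial i (b j k) x) (A := 2 * K * n) (fun ξ => ?_)
    (W := Matrix.of W) (by ext j k; simp [hW j k])
  · have e1 : ((Matrix.of fun j k => realPartial i (b j k) x) * Matrix.of W).trace =
        ∑ j, ∑ k, realPartial i (b j k) x * W j k := by
      simp only [Matrix.trace, Matrix.diag_apply, Matrix.mul_apply, Matrix.of_apply]
      refine Finset.sum_congr rfl fun j _ => Finset.sum_congr rfl fun k _ => ?_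
      rw [hW]
    have e2 : (Matrix.of W * (Matrix.of fun j k => b j k x) * Matrix.of W).trace =
        ∑ l, ∑ j, ∑ k, b j k x * W j l * W k l := by
      simp only [Matrix.trace, Matrix.diag_apply, Matrix.mul_apply, Matrix.of_apply]
      refine Finset.sum_congr rfl fun l _ => ?_
      simp only [Finset.sum_mul]
      rw [Finset.sum_comm]
      refine Finset.sum_congr rfl fun j _ => Finset.sum_congr rfl fun k _ => ?_
      rw [hW l j]
      ring
    rw [e1, e2] at h2
    exact h2
  · have e : ∀ g : Fin n → Fin n → ℝ, ξ ⬝ᵥ (Matrix.of g).mulVec ξ = ∑ j, ∑ k, g j k * ξ j * ξ k := by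
      intro g
      simp only [dotProduct, Matrix.mulVec, Matrix.of_apply, Finset.mul_sum]
      refine Finset.sum_congr rfl fun j _ => Finset.sum_congr rfl fun k _ => by ring
    rw [e, e]
    exact key ξ

end Oleinik

/-! ### Energy identities and the estimate for the regularized form -/

section Core

variable {n : ℕ}

theorem re_form_eq {B : Fin n → Fin n → ℝ} (z : Fin n → ℂ) :
    ∑ j, ∑ k, B j k * ((starRingEnd ℂ) (z j) * z k).re =
      (∑ j, ∑ k, B j k * (z j).re * (z k).re) + ∑ j, ∑ k, B j k * (z j).im * (z k).im := by
  rw [← Finset.sum_add_distrib]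
  refine Finset.sum_congr rfl fun j _ => ?_
  rw [← Finset.sum_add_distrib]
  refine Finset.sum_congr rfl fun k _ => ?_
  simp only [Complex.mul_re, Complex.conj_re, Complex.conj_im]
  ring

theorem re_form_nonneg {B : Fin n → Fin n → ℝ}
    (hB : ∀ ξ : Fin n → ℝ, 0 ≤ ∑ j, ∑ k, B j k * ξ j * ξ k) (z : Fin n → ℂ) :
    0 ≤ ∑ j, ∑ k, B j k * ((starRingEnd ℂ) (z j) * z k).re := by
  rw [re_form_eq]
  exact add_nonneg (hB fun j => (z j).re) (hB fun j => (z j).im)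

/-- Pointwise bound for the commutator of `P` with the gradient, paired with the gradient. Here
`w1`, `w2` stand for the first and second derivatives of a function at a point, `B`, `β` and `γ`
for the principal coefficients and their derivatives, `d` and `δ` for the derivatives of the first
order coefficients. -/
theorem gradient_commutator_pointwise_bound (h : ℝ) {K C₀ : ℝ} (hK : 0 ≤ K) (hC₀ : 0 ≤ C₀)
    {B : Fin n → Fin n → ℝ} {β γ : Fin n → Fin n → Fin n → ℝ} {d δ : Fin n → Fin n → ℝ}
    {w0 : ℂ} {w1 : Fin n → ℂ} {w2 : Fin n → Fin n → ℂ} (hsym : ∀ j k, w2 j k = w2 k j)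
    (hB : ∀ ξ : Fin n → ℝ, 0 ≤ ∑ j, ∑ k, B j k * ξ j * ξ k)
    (hol : ∀ i, ∀ W : Fin n → Fin n → ℝ, (∀ j k, W j k = W k j) →
      (∑ j, ∑ k, β i j k * W j k) ^ 2 ≤ C₀ * ∑ l, ∑ j, ∑ k, B j k * W j l * W k l)
    (hγ : ∀ i j k, |γ i j k| ≤ K) (hd : ∀ i j, |d i j| ≤ K) (hδ : ∀ i j, |δ i j| ≤ K) :
    -(h ^ 2 * ∑ l, ∑ j, ∑ k, B j k * ((starRingEnd ℂ) (w2 j l) * w2 k l).re) -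
        (h ^ 2 * (C₀ * n + 1) + (h ^ 2 * K * n + |h| * K + |h| * K * n) * (2 * n + 1)) *
          ((∑ i, ‖w1 i‖ ^ 2) + ‖w0‖ ^ 2) ≤
      ∑ i, ((starRingEnd ℂ) (w1 i) *
        (-(h : ℂ) ^ 2 * (∑ j, ∑ k, ((γ i j k : ℂ) * w1 k + (β i j k : ℂ) * w2 j k)) +
          (h : ℂ) * (∑ j, ((d i j : ℂ) * w1 j + 1 / 2 * (δ i j : ℂ) * w0)))).re := by
  set S : ℝ := ∑ l, ∑ j, ∑ k, B j k * ((starRingEnd ℂ) (w2 j l) * w2 k l).re with hS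
  have hS0 : 0 ≤ S := Finset.sum_nonneg fun l _ => re_form_nonneg hB fun j => w2 j l
  set T : ℝ := ∑ i, ‖w1 i‖ with hT
  set Q : ℝ := ∑ i, ‖w1 i‖ ^ 2 with hQ
  have hT0 : 0 ≤ T := Finset.sum_nonneg fun i _ => norm_nonneg _
  have hQ0 : 0 ≤ Q := Finset.sum_nonneg fun i _ => by positivity
  have hTQ : T ^ 2 ≤ n * Q := by
    have := sq_sum_le_card_mul_sum_sq (s := (Finset.univ : Finset (Fin n))) (f := fun i => ‖w1 i‖)
    rwa [Finset.card_univ, Fintype.card_fin] at this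
  set A : ℝ := h ^ 2 * K * n + |h| * K + |h| * K * n with hA
  have hA0 : 0 ≤ A := by positivity
  -- the second derivatives, by Oleinik's inequality for real and imaginary parts
  have hβ : ∀ i, ‖∑ j, ∑ k, (β i j k : ℂ) * w2 j k‖ ^ 2 ≤ C₀ * S := by
    intro i
    have h1 := hol i (fun j k => (w2 j k).re) (fun j k => by rw [hsym])
    have h2 := hol i (fun j k => (w2 j k).im) (fun j k => by rw [hsym])
    have h3 : S = (∑ l, ∑ j, ∑ k, B j k * (w2 j l).re * (w2 k l).re) +
        ∑ l, ∑ j, ∑ k, B j k * (w2 j l).im * (w2 k l).im := by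
      rw [hS, ← Finset.sum_add_distrib]
      exact Finset.sum_congr rfl fun l _ => re_form_eq fun j => w2 j l
    rw [Complex.sq_norm, Complex.normSq_apply, h3]
    simp only [Complex.re_sum, Complex.im_sum, Complex.re_ofReal_mul, Complex.im_ofReal_mul]
    nlinarith
  set τ : ℝ := C₀ * n + 1 with hτ
  have hn0 : (0 : ℝ) ≤ n := Nat.cast_nonneg n
  have hτ1 : 1 ≤ τ := by
    rw [hτ]
    have : 0 ≤ C₀ * n := mul_nonneg hC₀ hn0
    linarith
  have hterm : ∀ i, -(‖w1 i‖ * (A * (T + ‖w0‖))) -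
      h ^ 2 * (τ * ‖w1 i‖ ^ 2 + C₀ * S / τ) ≤ ((starRingEnd ℂ) (w1 i) *
        (-(h : ℂ) ^ 2 * (∑ j, ∑ k, ((γ i j k : ℂ) * w1 k + (β i j k : ℂ) * w2 j k)) +
          (h : ℂ) * (∑ j, ((d i j : ℂ) * w1 j + 1 / 2 * (δ i j : ℂ) * w0)))).re := by
    intro i
    set X : ℂ := ∑ j, ∑ k, (β i j k : ℂ) * w2 j k with hX
    set R : ℂ := -(h : ℂ) ^ 2 * (∑ j, ∑ k, (γ i j k : ℂ) * w1 k) +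
      (h : ℂ) * (∑ j, ((d i j : ℂ) * w1 j + 1 / 2 * (δ i j : ℂ) * w0)) with hR
    have hsplit : -(h : ℂ) ^ 2 * (∑ j, ∑ k, ((γ i j k : ℂ) * w1 k + (β i j k : ℂ) * w2 j k)) +
          (h : ℂ) * (∑ j, ((d i j : ℂ) * w1 j + 1 / 2 * (δ i j : ℂ) * w0)) =
        R + -(h : ℂ) ^ 2 * X := by
      rw [hR, hX]
      simp only [Finset.sum_add_distrib]
      ring
    have hnorm1 : ‖∑ j : Fin n, ∑ k, (γ i j k : ℂ) * w1 k‖ ≤ n * (K * T) := by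
      calc ‖∑ j : Fin n, ∑ k, (γ i j k : ℂ) * w1 k‖ ≤ ∑ j : Fin n, ∑ k, K * ‖w1 k‖ := by
            refine (norm_sum_le _ _).trans (Finset.sum_le_sum fun j _ => ?_)
            refine (norm_sum_le _ _).trans (Finset.sum_le_sum fun k _ => ?_)
            rw [norm_mul, Complex.norm_real, Real.norm_eq_abs]
            gcongr
            exact hγ i j k
        _ = n * (K * T) := by
            simp only [← Finset.mul_sum, Finset.sum_const, Finset.card_univ, Fintype.card_fin,
              nsmul_eq_mul, hT]
            ring
    have hnorm2 : ‖∑ j : Fin n, ((d i j : ℂ) * w1 j + 1 / 2 * (δ i j : ℂ) * w0)‖ ≤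
        K * T + n * (K * ‖w0‖) := by
      calc ‖∑ j : Fin n, ((d i j : ℂ) * w1 j + 1 / 2 * (δ i j : ℂ) * w0)‖
          ≤ ∑ j : Fin n, (K * ‖w1 j‖ + K * ‖w0‖) := by
            refine (norm_sum_le _ _).trans (Finset.sum_le_sum fun j _ => ?_)
            refine (norm_add_le _ _).trans (add_le_add ?_ ?_)
            · rw [norm_mul, Complex.norm_real, Real.norm_eq_abs]
              gcongr
              exact hd i j
            · rw [norm_mul, norm_mul, Complex.norm_real, Real.norm_eq_abs]
              have h12 : ‖(1 / 2 : ℂ)‖ ≤ 1 := by norm_num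
              have := hδ i j
              have h0 := abs_nonneg (δ i j)
              calc ‖(1 / 2 : ℂ)‖ * |δ i j| * ‖w0‖ ≤ 1 * K * ‖w0‖ := by gcongr
                _ = K * ‖w0‖ := by ring
        _ = K * T + n * (K * ‖w0‖) := by
            simp only [Finset.sum_add_distrib, ← Finset.mul_sum, Finset.sum_const,
              Finset.card_univ, Fintype.card_fin, nsmul_eq_mul, hT]
            ring
    have hRn : ‖R‖ ≤ A * (T + ‖w0‖) := by
      calc ‖R‖ ≤ h ^ 2 * (n * (K * T)) + |h| * (K * T + n * (K * ‖w0‖)) := by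
            refine (norm_add_le _ _).trans (add_le_add ?_ ?_)
            · rw [norm_mul, norm_neg, norm_pow, Complex.norm_real, Real.norm_eq_abs, sq_abs]
              gcongr
            · rw [norm_mul, Complex.norm_real, Real.norm_eq_abs]
              gcongr
        _ ≤ A * (T + ‖w0‖) := by
            rw [hA]
            have e1 : 0 ≤ |h| * K * n * T := by positivity
            have e2 : 0 ≤ h ^ 2 * K * n * ‖w0‖ := by positivity
            have e3 : 0 ≤ |h| * K * ‖w0‖ := by positivity
            nlinarith
    rw [hsplit, mul_add ((starRingEnd ℂ) (w1 i)), Complex.add_re]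
    have h1 : -(‖w1 i‖ * (A * (T + ‖w0‖))) ≤ ((starRingEnd ℂ) (w1 i) * R).re := by
      have := (abs_le.1 (Complex.abs_re_le_norm ((starRingEnd ℂ) (w1 i) * R))).1
      rw [norm_mul, RCLike.norm_conj] at this
      refine le_trans (neg_le_neg ?_) this
      gcongr
    have h2 : -(h ^ 2 * (‖w1 i‖ * ‖X‖)) ≤ ((starRingEnd ℂ) (w1 i) * (-(h : ℂ) ^ 2 * X)).re := by
      have := (abs_le.1 (Complex.abs_re_le_norm ((starRingEnd ℂ) (w1 i) * (-(h : ℂ) ^ 2 * X)))).1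
      rw [norm_mul, RCLike.norm_conj, norm_mul, norm_neg, norm_pow, Complex.norm_real,
        Real.norm_eq_abs, sq_abs] at this
      linarith
    have h3 : ‖w1 i‖ * ‖X‖ ≤ τ * ‖w1 i‖ ^ 2 + C₀ * S / τ := by
      have h4 : ‖X‖ ^ 2 / τ ≤ C₀ * S / τ := by
        gcongr
        exact hβ i
      have h5 : ‖w1 i‖ * ‖X‖ ≤ τ * ‖w1 i‖ ^ 2 + ‖X‖ ^ 2 / τ := by
        have h6 : τ * ‖w1 i‖ ^ 2 + ‖X‖ ^ 2 / τ - ‖w1 i‖ * ‖X‖ =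
            ((τ * ‖w1 i‖ - ‖X‖) ^ 2 + τ * (‖w1 i‖ * ‖X‖)) / τ := by
          field_simp
          ring
        have h7 : 0 ≤ ((τ * ‖w1 i‖ - ‖X‖) ^ 2 + τ * (‖w1 i‖ * ‖X‖)) / τ := by positivity
        linarith
      linarith
    have h4 : h ^ 2 * (‖w1 i‖ * ‖X‖) ≤ h ^ 2 * (τ * ‖w1 i‖ ^ 2 + C₀ * S / τ) := by gcongr
    linarith
  refine le_trans ?_ (Finset.sum_le_sum fun i _ => hterm i)
  have hsum : ∑ i : Fin n, (-(‖w1 i‖ * (A * (T + ‖w0‖))) -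
      h ^ 2 * (τ * ‖w1 i‖ ^ 2 + C₀ * S / τ)) =
      -(T * (A * (T + ‖w0‖))) - h ^ 2 * (τ * Q + n * (C₀ * S / τ)) := by
    simp only [Finset.sum_sub_distrib, Finset.sum_neg_distrib, ← Finset.sum_mul, ← Finset.mul_sum,
      Finset.sum_add_distrib, Finset.sum_const, Finset.card_univ, Fintype.card_fin, nsmul_eq_mul,
      hT, hQ]
  rw [hsum]
  have h8 : n * (C₀ * S / τ) ≤ S := by
    rw [mul_div_assoc', div_le_iff₀ (by linarith)]
    rw [hτ]
    nlinarith
  have h9 : T * (A * (T + ‖w0‖)) ≤ A * (2 * n + 1) * (Q + ‖w0‖ ^ 2) := by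
    have h10 : T * (T + ‖w0‖) ≤ 2 * T ^ 2 + ‖w0‖ ^ 2 := by nlinarith [sq_nonneg (T - ‖w0‖)]
    have h11 : 2 * T ^ 2 + ‖w0‖ ^ 2 ≤ (2 * n + 1) * (Q + ‖w0‖ ^ 2) := by
      have : 0 ≤ n * ‖w0‖ ^ 2 := by positivity
      nlinarith
    nlinarith [mul_le_mul_of_nonneg_left (h10.trans h11) hA0]
  have h12 : h ^ 2 * (τ * Q + n * (C₀ * S / τ)) ≤ h ^ 2 * (τ * Q + S) := by gcongr
  have h13 : 0 ≤ h ^ 2 * τ * ‖w0‖ ^ 2 := by positivity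
  nlinarith

/-- The density `∑ b_{jk} Re (conj (∂ⱼ f) ∂ₖ f)` of the Dirichlet form of `b`. -/
noncomputable def energyDensity (b : Fin n → Fin n → EuclideanSpace ℝ (Fin n) → ℝ)
    (f : 𝓢(EuclideanSpace ℝ (Fin n), ℂ)) (x : EuclideanSpace ℝ (Fin n)) : ℝ :=
  ∑ j, ∑ k, b j k x * ((starRingEnd ℂ) (schwartzPartial j f x) * schwartzPartial k f x).re

/-- The Dirichlet form of the (possibly degenerate) matrix function `b`. -/
noncomputable def energy (b : Fin n → Fin n → EuclideanSpace ℝ (Fin n) → ℝ)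
    (f : 𝓢(EuclideanSpace ℝ (Fin n), ℂ)) : ℝ :=
  ∫ x, energyDensity b f x

variable {h : ℝ} {b : Fin n → Fin n → EuclideanSpace ℝ (Fin n) → ℝ}
  {c : Fin n → EuclideanSpace ℝ (Fin n) → ℝ} {p : EuclideanSpace ℝ (Fin n) → ℝ}

theorem integrable_mul_re_conj_mul {g : EuclideanSpace ℝ (Fin n) → ℝ} (hg : g.HasTemperateGrowth)
    (f k : 𝓢(EuclideanSpace ℝ (Fin n), ℂ)) :
    Integrable (fun x => g x * ((starRingEnd ℂ) (f x) * k x).re) := by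
  refine (integrable_re_conj_mul f (schwartzMul g k)).congr
    (Filter.Eventually.of_forall fun x => ?_)
  simp only [schwartzMul_apply hg]
  rw [mul_left_comm, Complex.re_ofReal_mul]

theorem integral_mul_re_conj_mul {g : EuclideanSpace ℝ (Fin n) → ℝ} (hg : g.HasTemperateGrowth)
    (f k : 𝓢(EuclideanSpace ℝ (Fin n), ℂ)) :
    ∫ x, g x * ((starRingEnd ℂ) (f x) * k x).re = (schwartzInner f (schwartzMul g k)).re := by
  rw [re_schwartzInner_eq_integral]
  refine integral_congr_ae (Filter.Eventually.of_forall fun x => ?_)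
  simp only [schwartzMul_apply hg]
  rw [mul_left_comm, Complex.re_ofReal_mul]

theorem integrable_energyDensity (hb : ∀ j k, (b j k).HasTemperateGrowth)
    (f : 𝓢(EuclideanSpace ℝ (Fin n), ℂ)) : Integrable (energyDensity b f) :=
  integrable_finsetSum _ fun j _ => integrable_finsetSum _ fun k _ =>
    integrable_mul_re_conj_mul (hb j k) _ _

theorem energy_eq (hb : ∀ j k, (b j k).HasTemperateGrowth)
    (f : 𝓢(EuclideanSpace ℝ (Fin n), ℂ)) :
    energy b f = ∑ j, ∑ k,
      (schwartzInner (schwartzPartial j f) (schwartzMul (b j k) (schwartzPartial k f))).re := by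
  simp only [energy, energyDensity]
  rw [integral_finsetSum _ fun j _ => integrable_finsetSum _ fun k _ =>
    integrable_mul_re_conj_mul (hb j k) _ _]
  refine Finset.sum_congr rfl fun j _ => ?_
  rw [integral_finsetSum _ fun k _ => integrable_mul_re_conj_mul (hb j k) _ _]
  exact Finset.sum_congr rfl fun k _ => integral_mul_re_conj_mul (hb j k) _ _

theorem energyDensity_nonneg (hpos : ∀ x, ∀ ξ : Fin n → ℝ, 0 ≤ ∑ j, ∑ k, b j k x * ξ j * ξ k)
    (f : 𝓢(EuclideanSpace ℝ (Fin n), ℂ)) (x : EuclideanSpace ℝ (Fin n)) :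
    0 ≤ energyDensity b f x :=
  re_form_nonneg (hpos x) _

theorem energy_nonneg (hpos : ∀ x, ∀ ξ : Fin n → ℝ, 0 ≤ ∑ j, ∑ k, b j k x * ξ j * ξ k)
    (f : 𝓢(EuclideanSpace ℝ (Fin n), ℂ)) : 0 ≤ energy b f :=
  integral_nonneg (energyDensity_nonneg hpos f)

/-- The real part of the form of `P`: the antisymmetric first order part drops out. -/
theorem re_schwartzInner_schwartzOp (hT : TemperateCoeffs b c p)
    (f : 𝓢(EuclideanSpace ℝ (Fin n), ℂ)) :
    (schwartzInner f (schwartzOp h b c p f)).re =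
      h ^ 2 * energy b f + (schwartzInner f (schwartzMul p f)).re := by
  have h2 : ∀ j, (schwartzInner f (schwartzMul (c j) (schwartzPartial j f)) +
      schwartzInner f (schwartzPartial j (schwartzMul (c j) f))).re = 0 := by
    intro j
    have : schwartzInner f (schwartzPartial j (schwartzMul (c j) f)) =
        -(starRingEnd ℂ) (schwartzInner f (schwartzMul (c j) (schwartzPartial j f))) := by
      rw [conj_schwartzInner, schwartzInner_mul (hT.c j), schwartzInner_partial, neg_neg]
    rw [this]
    simp
  have h3 : ∀ j k, schwartzInner f (schwartzPartial j (schwartzMul (b j k) (schwartzPartial k f))) =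
      -schwartzInner (schwartzPartial j f) (schwartzMul (b j k) (schwartzPartial k f)) := by
    intro j k
    rw [schwartzInner_partial, neg_neg]
  rw [schwartzOp_eq, energy_eq hT.b]
  simp only [schwartzInner_add_right, schwartzInner_smul_right, schwartzInner_sum_right, h3,
    Finset.sum_neg_distrib, Complex.add_re]
  have e1 : (-(h : ℂ) ^ 2 * -∑ j, ∑ k, schwartzInner (schwartzPartial j f)
      (schwartzMul (b j k) (schwartzPartial k f))).re = h ^ 2 * ∑ j, ∑ k,
      (schwartzInner (schwartzPartial j f) (schwartzMul (b j k) (schwartzPartial k f))).re := by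
    rw [neg_mul_neg, ← Complex.ofReal_pow, Complex.re_ofReal_mul]
    simp only [Complex.re_sum]
  have e2 : ((h : ℂ) / 2 * ∑ j, (schwartzInner f (schwartzMul (c j) (schwartzPartial j f)) +
      schwartzInner f (schwartzPartial j (schwartzMul (c j) f)))).re = 0 := by
    have : (h : ℂ) / 2 = ((h / 2 : ℝ) : ℂ) := by push_cast; ring
    rw [this, Complex.re_ofReal_mul, Complex.re_sum]
    simp only [h2, Finset.sum_const_zero, mul_zero]
  rw [e1, e2, add_zero]

theorem re_schwartzInner_mul_nonneg {g : EuclideanSpace ℝ (Fin n) → ℝ}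
    (hg : g.HasTemperateGrowth) (hg0 : ∀ x, 0 ≤ g x) (f : 𝓢(EuclideanSpace ℝ (Fin n), ℂ)) :
    0 ≤ (schwartzInner f (schwartzMul g f)).re := by
  rw [← integral_mul_re_conj_mul hg]
  refine integral_nonneg fun x => mul_nonneg (hg0 x) ?_
  rw [Complex.conj_mul', ← Complex.ofReal_pow, Complex.ofReal_re]
  positivity

/-- Global coefficients of temperate growth with the sign conditions, whose derivatives of the
orders occurring in the commutator of `P` with a gradient are bounded by `K`. -/
structure ControlledCoeffs (K : ℝ) (b : Fin n → Fin n → EuclideanSpace ℝ (Fin n) → ℝ)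
    (c : Fin n → EuclideanSpace ℝ (Fin n) → ℝ) (p : EuclideanSpace ℝ (Fin n) → ℝ) : Prop where
  temperate : TemperateCoeffs b c p
  symm : ∀ j k x, b j k x = b k j x
  form_nonneg : ∀ x, ∀ ξ : Fin n → ℝ, 0 ≤ ∑ j, ∑ k, b j k x * ξ j * ξ k
  p_nonneg : ∀ x, 0 ≤ p x
  K_nonneg : 0 ≤ K
  bound_b : ∀ i l j k x, |realPartial i (realPartial l (b j k)) x| ≤ K
  bound_c : ∀ i j x, |realPartial i (c j) x| ≤ K
  bound_c' : ∀ i l j x, |realPartial i (realPartial l (c j)) x| ≤ K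
  bound_p : ∀ i x, |realPartial i (realPartial i p) x| ≤ K

/-- The squared norm `‖w‖² + ε² ‖∇w‖²`. -/
noncomputable def regNormSq (ε : ℝ) (w : 𝓢(EuclideanSpace ℝ (Fin n), ℂ)) : ℝ :=
  schwartzNorm w ^ 2 + ε ^ 2 * ∑ i, schwartzNorm (schwartzPartial i w) ^ 2

/-- The operator `1 - ε² Δ`. -/
noncomputable def regOp (ε : ℝ) (w : 𝓢(EuclideanSpace ℝ (Fin n), ℂ)) :
    𝓢(EuclideanSpace ℝ (Fin n), ℂ) :=
  w - ((ε ^ 2 : ℝ) : ℂ) • ∑ i, schwartzPartial i (schwartzPartial i w)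

theorem schwartzInner_regOp (ε : ℝ) (w v : 𝓢(EuclideanSpace ℝ (Fin n), ℂ)) :
    schwartzInner (regOp ε w) v = schwartzInner w v +
      ((ε ^ 2 : ℝ) : ℂ) * ∑ i, schwartzInner (schwartzPartial i w) (schwartzPartial i v) := by
  rw [regOp, schwartzInner_sub_left, schwartzInner_smul_left, schwartzInner_sum_left,
    Complex.conj_ofReal]
  simp only [schwartzInner_partial (schwartzPartial _ w), Finset.sum_neg_distrib]
  ring

theorem re_schwartzInner_regOp_self (ε : ℝ) (w : 𝓢(EuclideanSpace ℝ (Fin n), ℂ)) :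
    (schwartzInner (regOp ε w) w).re = regNormSq ε w := by
  rw [schwartzInner_regOp, Complex.add_re, Complex.re_ofReal_mul, Complex.re_sum, regNormSq]
  simp only [schwartzNorm_sq]

theorem regNormSq_nonneg (ε : ℝ) (w : 𝓢(EuclideanSpace ℝ (Fin n), ℂ)) : 0 ≤ regNormSq ε w := by
  rw [regNormSq]
  have := Finset.sum_nonneg fun (i : Fin n) (_ : i ∈ Finset.univ) =>
    sq_nonneg (schwartzNorm (schwartzPartial i w))
  positivity

/-- The zeroth order coefficient in the commutator: `Re ∑ (∂ᵢw | (∂ᵢp) w) = -½ ∫ Δp |w|²`, so that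
only second derivatives of `p` matter. -/
theorem re_schwartzInner_partial_mul_realPartial (hp : p.HasTemperateGrowth) (i : Fin n)
    (w : 𝓢(EuclideanSpace ℝ (Fin n), ℂ)) :
    (schwartzInner (schwartzPartial i w) (schwartzMul (realPartial i p) w)).re =
      -(1 / 2) * (schwartzInner w (schwartzMul (realPartial i (realPartial i p)) w)).re := by
  have hp1 := hp.realPartial i
  have h1 : schwartzInner (schwartzPartial i w) (schwartzMul (realPartial i p) w) =
      -schwartzInner w (schwartzMul (realPartial i (realPartial i p)) w) -
        schwartzInner w (schwartzMul (realPartial i p) (schwartzPartial i w)) := by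
    rw [schwartzInner_partial, schwartzPartial_schwartzMul hp1, schwartzInner_add_right]
    ring
  have h2 : (schwartzInner w (schwartzMul (realPartial i p) (schwartzPartial i w))).re =
      (schwartzInner (schwartzPartial i w) (schwartzMul (realPartial i p) w)).re := by
    rw [← schwartzInner_mul hp1, re_schwartzInner_comm]
  have h3 := congrArg Complex.re h1
  rw [Complex.sub_re, Complex.neg_re, h2] at h3
  linarith

/-- The commutator of `P` with the gradient, paired with the gradient, is bounded below by the
energies of the first derivatives, up to `H¹` norms. -/
theorem exists_gradient_commutator_bound {K : ℝ} (hC : ControlledCoeffs K b c p) :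
    ∃ C : ℝ, 0 ≤ C ∧ ∀ w : 𝓢(EuclideanSpace ℝ (Fin n), ℂ),
      -(h ^ 2 * ∑ l, energy b (schwartzPartial l w)) -
        C * ((∑ i, schwartzNorm (schwartzPartial i w) ^ 2) + schwartzNorm w ^ 2) ≤
      ∑ i, (schwartzInner (schwartzPartial i w) (schwartzOp h (fun j k => realPartial i (b j k))
        (fun j => realPartial i (c j)) (realPartial i p) w)).re := by
  have hT := hC.temperate
  have hK := hC.K_nonneg
  have hol := fun (x : EuclideanSpace ℝ (Fin n)) (i : Fin n) (W : Fin n → Fin n → ℝ)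
    (hW : ∀ j k, W j k = W k j) => oleinik_inequality (fun j k => (hT.b j k).1) hC.form_nonneg i
      (fun j k y => hC.bound_b i i j k y) x W hW
  set C₀ : ℝ := n * (2 * K * n) with hC₀
  have hC₀0 : 0 ≤ C₀ := by positivity
  set C₁ : ℝ := h ^ 2 * (C₀ * n + 1) +
    (h ^ 2 * K * n + |h| * K + |h| * K * n) * (2 * n + 1) with hC₁
  have hC₁0 : 0 ≤ C₁ := by positivity
  refine ⟨C₁ + n * K, by positivity, fun w => ?_⟩
  have hTi : ∀ i, TemperateCoeffs (fun j k => realPartial i (b j k)) (fun j => realPartial i (c j))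
      (fun _ => (0 : ℝ)) := fun i =>
    ⟨(hT.realPartial i).b, (hT.realPartial i).c, Function.HasTemperateGrowth.zero⟩
  have hsplit : ∀ i, schwartzOp h (fun j k => realPartial i (b j k)) (fun j => realPartial i (c j))
      (realPartial i p) w = schwartzOp h (fun j k => realPartial i (b j k))
        (fun j => realPartial i (c j)) (fun _ => 0) w + schwartzMul (realPartial i p) w := by
    intro i
    have h0 : schwartzMul (fun _ => (0 : ℝ)) w = 0 := by
      ext x
      rw [schwartzMul_apply Function.HasTemperateGrowth.zero]
      simp
    rw [schwartzOp_eq, schwartzOp_eq, h0, add_zero]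
  have hpart : ∀ i, -(K * schwartzNorm w ^ 2) ≤
      (schwartzInner (schwartzPartial i w) (schwartzMul (realPartial i p) w)).re := by
    intro i
    have hp2 := (hT.p.realPartial i).realPartial i
    rw [re_schwartzInner_partial_mul_realPartial hT.p]
    have h1 : ‖schwartzInner w (schwartzMul (realPartial i (realPartial i p)) w)‖ ≤
        schwartzNorm w * (K * schwartzNorm w) := by
      refine (norm_schwartzInner_le _ _).trans ?_
      refine mul_le_mul_of_nonneg_left ?_ (schwartzNorm_nonneg w)
      refine schwartzNorm_le_of_norm_le hK fun x => ?_
      rw [schwartzMul_apply hp2, norm_mul, Complex.norm_real, Real.norm_eq_abs]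
      gcongr
      exact hC.bound_p i x
    have h2 := (Complex.re_le_norm
      (schwartzInner w (schwartzMul (realPartial i (realPartial i p)) w))).trans h1
    have h3 : 0 ≤ K * schwartzNorm w ^ 2 := by positivity
    nlinarith
  have hint : ∀ i, Integrable (fun x => ((starRingEnd ℂ) (schwartzPartial i w x) *
      schwartzOp h (fun j k => realPartial i (b j k)) (fun j => realPartial i (c j))
        (fun _ => 0) w x).re) := fun i => integrable_re_conj_mul _ _
  have hmain : -(h ^ 2 * ∑ l, energy b (schwartzPartial l w)) -
        C₁ * ((∑ i, schwartzNorm (schwartzPartial i w) ^ 2) + schwartzNorm w ^ 2) ≤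
      ∑ i, (schwartzInner (schwartzPartial i w) (schwartzOp h (fun j k => realPartial i (b j k))
        (fun j => realPartial i (c j)) (fun _ => 0) w)).re := by
    have hE : Integrable (fun x => ∑ l, energyDensity b (schwartzPartial l w) x) :=
      integrable_finsetSum _ fun l _ => integrable_energyDensity hT.b _
    have hN : Integrable (fun x => (∑ i, ‖schwartzPartial i w x‖ ^ 2) + ‖w x‖ ^ 2) :=
      (integrable_finsetSum _ fun i _ => integrable_norm_sq_schwartz _).add
        (integrable_norm_sq_schwartz w)
    have e1 : -(h ^ 2 * ∑ l, energy b (schwartzPartial l w)) -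
        C₁ * ((∑ i, schwartzNorm (schwartzPartial i w) ^ 2) + schwartzNorm w ^ 2) =
        ∫ x, (-(h ^ 2 * ∑ l, energyDensity b (schwartzPartial l w) x) -
          C₁ * ((∑ i, ‖schwartzPartial i w x‖ ^ 2) + ‖w x‖ ^ 2)) := by
      have hE' : Integrable (fun x => -(h ^ 2 * ∑ l, energyDensity b (schwartzPartial l w) x)) :=
        (hE.const_mul _).neg
      rw [integral_sub hE' (hN.const_mul _), integral_neg, integral_const_mul,
        integral_const_mul, integral_finsetSum _ fun l _ => integrable_energyDensity hT.b _,
        integral_add (integrable_finsetSum _ fun i _ => integrable_norm_sq_schwartz _)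
          (integrable_norm_sq_schwartz w),
        integral_finsetSum _ fun i _ => integrable_norm_sq_schwartz _]
      simp only [schwartzNorm_sq_eq_integral, energy]
    have e2 : ∑ i, (schwartzInner (schwartzPartial i w) (schwartzOp h
        (fun j k => realPartial i (b j k)) (fun j => realPartial i (c j)) (fun _ => 0) w)).re =
        ∫ x, ∑ i, ((starRingEnd ℂ) (schwartzPartial i w x) *
          schwartzOp h (fun j k => realPartial i (b j k)) (fun j => realPartial i (c j))
            (fun _ => 0) w x).re := by
      rw [integral_finsetSum _ fun i _ => hint i]
      exact Finset.sum_congr rfl fun i _ => re_schwartzInner_eq_integral _ _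
    rw [e1, e2]
    refine integral_mono ((hE.const_mul _).neg.sub (hN.const_mul _))
      (integrable_finsetSum _ fun i _ => hint i) fun x => ?_
    simp only [schwartzOp_apply_expand (hTi _), Complex.ofReal_zero, zero_mul, add_zero]
    exact gradient_commutator_pointwise_bound h hK hC₀0
      (fun j k => by rw [schwartzPartial_comm]) (hC.form_nonneg x) (hol x)
      (fun i j k => hC.bound_b j i j k x) (fun i j => hC.bound_c i j x)
      (fun i j => hC.bound_c' j i j x)
  simp only [hsplit, schwartzInner_add_right, Complex.add_re, Finset.sum_add_distrib]
  have hsum : -(n * (K * schwartzNorm w ^ 2)) ≤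
      ∑ i, (schwartzInner (schwartzPartial i w) (schwartzMul (realPartial i p) w)).re := by
    have := Finset.sum_le_sum fun (i : Fin n) (_ : i ∈ Finset.univ) => hpart i
    simpa using this
  have h5 : 0 ≤ n * K * ∑ i, schwartzNorm (schwartzPartial i w) ^ 2 :=
    mul_nonneg (by positivity) (Finset.sum_nonneg fun i _ => sq_nonneg _)
  linarith

/-- `P` is accretive up to a bounded error for the inner product of the form `1 - ε² Δ`,
uniformly in `ε ≤ 1`. -/
theorem exists_regularized_accretivity {K : ℝ} (hC : ControlledCoeffs K b c p) :
    ∃ C : ℝ, 0 ≤ C ∧ ∀ ε : ℝ, 0 ≤ ε → ε ≤ 1 → ∀ w : 𝓢(EuclideanSpace ℝ (Fin n), ℂ),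
      h ^ 2 * energy b w - C * regNormSq ε w ≤
        (schwartzInner (regOp ε w) (schwartzOp h b c p w)).re := by
  obtain ⟨C, hC0, hCb⟩ := exists_gradient_commutator_bound (h := h) hC
  have hT := hC.temperate
  refine ⟨C, hC0, fun ε hε0 hε1 w => ?_⟩
  have hacc : ∀ f : 𝓢(EuclideanSpace ℝ (Fin n), ℂ),
      h ^ 2 * energy b f ≤ (schwartzInner f (schwartzOp h b c p f)).re := by
    intro f
    rw [re_schwartzInner_schwartzOp hT]
    have := re_schwartzInner_mul_nonneg hT.p hC.p_nonneg f
    linarith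
  have h1 := hCb w
  have h2 := hacc w
  have h3 := Finset.sum_le_sum fun (i : Fin n) (_ : i ∈ Finset.univ) => hacc (schwartzPartial i w)
  rw [← Finset.mul_sum] at h3
  rw [schwartzInner_regOp, Complex.add_re, Complex.re_ofReal_mul, Complex.re_sum]
  simp only [schwartzPartial_schwartzOp hT, schwartzInner_add_right, Complex.add_re,
    Finset.sum_add_distrib]
  have hε2 : ε ^ 2 ≤ 1 := by nlinarith
  set G : ℝ := ∑ i, schwartzNorm (schwartzPartial i w) ^ 2 with hG
  have h4 : ε ^ 2 * (-(C * (G + schwartzNorm w ^ 2))) ≤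
      ε ^ 2 * ((∑ i, (schwartzInner (schwartzPartial i w)
        (schwartzOp h b c p (schwartzPartial i w))).re) +
      ∑ i, (schwartzInner (schwartzPartial i w) (schwartzOp h (fun j k => realPartial i (b j k))
        (fun j => realPartial i (c j)) (realPartial i p) w)).re) := by
    gcongr
    linarith
  have h5 : ε ^ 2 * (C * schwartzNorm w ^ 2) ≤ C * schwartzNorm w ^ 2 := by
    have : 0 ≤ C * schwartzNorm w ^ 2 := by positivity
    nlinarith
  have h6 : regNormSq ε w = schwartzNorm w ^ 2 + ε ^ 2 * G := rfl
  rw [h6]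
  nlinarith

end Core

/-! ### The resolvent of the Laplacian on Schwartz functions -/

section Regularization

variable {n : ℕ}

/-- The equation `w - ε² Δ w = v` is solvable in the Schwartz space, by a Fourier multiplier. -/
theorem exists_regOp_eq (ε : ℝ) (v : 𝓢(EuclideanSpace ℝ (Fin n), ℂ)) :
    ∃ w, regOp ε w = v := by
  let a : ℝ := 2 * Real.pi * ε
  let m : EuclideanSpace ℝ (Fin n) → ℝ := fun x => (1 + ‖a • x‖ ^ 2) ^ (-1 : ℝ)
  have hm : m.HasTemperateGrowth :=
    (Function.hasTemperateGrowth_one_add_norm_sq_rpow (EuclideanSpace ℝ (Fin n)) (-1)).comp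
      (a • ContinuousLinearMap.id ℝ (EuclideanSpace ℝ (Fin n))).hasTemperateGrowth
  have hsq : (fun x : EuclideanSpace ℝ (Fin n) => ‖x‖ ^ 2).HasTemperateGrowth := by fun_prop
  let FM : (EuclideanSpace ℝ (Fin n) → ℝ) → 𝓢(EuclideanSpace ℝ (Fin n), ℂ) →L[ℝ]
    𝓢(EuclideanSpace ℝ (Fin n), ℂ) := SchwartzMap.fourierMultiplierCLM ℂ
  refine ⟨FM m v, ?_⟩
  have hlap : (∑ i, schwartzPartial i (schwartzPartial i (FM m v))) =
      -(2 * Real.pi) ^ 2 • FM ((fun x => ‖x‖ ^ 2) * m) v := by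
    have h1 := SchwartzMap.laplacian_eq_sum (EuclideanSpace.basisFun (Fin n) ℝ) (FM m v)
    have h2 := SchwartzMap.laplacian_eq_fourierMultiplierCLM (FM m v)
    rw [h1] at h2
    have h3 := SchwartzMap.fourierMultiplierCLM_fourierMultiplierCLM_apply hsq hm v
    have h4 : FM (fun x => ‖x‖ ^ 2) (FM m v) = FM ((fun x => ‖x‖ ^ 2) * m) v := h3
    rw [← h4]
    refine Eq.trans ?_ h2
    refine Finset.sum_congr rfl fun i _ => ?_
    rw [EuclideanSpace.basisFun_apply]
    rfl
  have hsum : m + (a ^ 2) • ((fun x => ‖x‖ ^ 2) * m) = fun _ => (1 : ℝ) := by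
    funext x
    have hpos : (0 : ℝ) < 1 + ‖a • x‖ ^ 2 := by positivity
    have hn : ‖a • x‖ ^ 2 = a ^ 2 * ‖x‖ ^ 2 := by
      rw [norm_smul, mul_pow, Real.norm_eq_abs, sq_abs]
    simp only [Pi.add_apply, Pi.smul_apply, Pi.mul_apply, smul_eq_mul, m]
    rw [Real.rpow_neg_one, hn] at *
    field_simp
  have hFM : FM m v + (a ^ 2) • FM ((fun x => ‖x‖ ^ 2) * m) v = v := by
    have hsm : (SchwartzMap.smulLeftCLM ℂ m + (a ^ 2) •
        SchwartzMap.smulLeftCLM ℂ ((fun x : EuclideanSpace ℝ (Fin n) => ‖x‖ ^ 2) * m) :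
        𝓢(EuclideanSpace ℝ (Fin n), ℂ) →L[ℝ] 𝓢(EuclideanSpace ℝ (Fin n), ℂ)) =
        SchwartzMap.smulLeftCLM ℂ (fun _ => (1 : ℝ)) := by
      rw [← SchwartzMap.smulLeftCLM_smul (hsq.mul hm), ← SchwartzMap.smulLeftCLM_add hm, hsum]
      exact (Function.HasTemperateGrowth.const (a ^ 2)).mul (hsq.mul hm)
    have h1 : FM (fun _ => (1 : ℝ)) v = v := by
      simp [FM]
    have h2 : FM (fun _ => (1 : ℝ)) v = FM m v + (a ^ 2) • FM ((fun x => ‖x‖ ^ 2) * m) v := by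
      simp only [FM, SchwartzMap.fourierMultiplierCLM_apply, ← hsm, add_apply, smul_apply,
        FourierTransform.fourierInv_add, FourierTransform.fourierInv_smul]
    rw [← h2, h1]
  have hfin : regOp ε (FM m v) = FM m v + (a ^ 2) • FM ((fun x => ‖x‖ ^ 2) * m) v := by
    rw [regOp, hlap, sub_eq_add_neg]
    congr 1
    ext x
    simp only [neg_apply, smul_apply, smul_eq_mul, Complex.real_smul, a]
    push_cast
    ring
  rw [hfin, hFM]

theorem schwartzNorm_add_le (f g : 𝓢(EuclideanSpace ℝ (Fin n), ℂ)) :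
    schwartzNorm (f + g) ≤ schwartzNorm f + schwartzNorm g := by
  rw [schwartzNorm, map_add]
  exact norm_add_le _ _

theorem schwartzNorm_smul (a : ℂ) (f : 𝓢(EuclideanSpace ℝ (Fin n), ℂ)) :
    schwartzNorm (a • f) = ‖a‖ * schwartzNorm f := by
  rw [schwartzNorm, map_smul, norm_smul]
  rfl

theorem schwartzNorm_sum_le {ι : Type*} (s : Finset ι)
    (f : ι → 𝓢(EuclideanSpace ℝ (Fin n), ℂ)) :
    schwartzNorm (∑ i ∈ s, f i) ≤ ∑ i ∈ s, schwartzNorm (f i) := by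
  rw [schwartzNorm, map_sum]
  exact norm_sum_le _ _

theorem schwartzNorm_le_regOp (ε : ℝ) (w : 𝓢(EuclideanSpace ℝ (Fin n), ℂ)) :
    schwartzNorm w ≤ schwartzNorm (regOp ε w) := by
  have h1 : schwartzNorm w ^ 2 ≤ schwartzNorm (regOp ε w) * schwartzNorm w := by
    have h2 := (Complex.re_le_norm _).trans (norm_schwartzInner_le (regOp ε w) w)
    rw [re_schwartzInner_regOp_self, regNormSq] at h2
    have := Finset.sum_nonneg fun (i : Fin n) (_ : i ∈ Finset.univ) =>
      sq_nonneg (schwartzNorm (schwartzPartial i w))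
    have h3 := mul_nonneg (sq_nonneg ε) this
    linarith
  rcases (schwartzNorm_nonneg w).eq_or_lt with h0 | h0
  · rw [← h0]
    exact schwartzNorm_nonneg _
  · rw [sq] at h1
    exact le_of_mul_le_mul_right h1 h0

theorem regNormSq_le_regOp (ε : ℝ) (w : 𝓢(EuclideanSpace ℝ (Fin n), ℂ)) :
    regNormSq ε w ≤ schwartzNorm (regOp ε w) ^ 2 := by
  rw [← re_schwartzInner_regOp_self, sq]
  refine ((Complex.re_le_norm _).trans (norm_schwartzInner_le _ _)).trans ?_
  exact mul_le_mul_of_nonneg_left (schwartzNorm_le_regOp ε w) (schwartzNorm_nonneg _)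

theorem schwartzNorm_partial_le_of_regNormSq {ε A : ℝ} (hε : 0 < ε) (hA : 0 ≤ A)
    {w : 𝓢(EuclideanSpace ℝ (Fin n), ℂ)} (hw : regNormSq ε w ≤ A ^ 2) (i : Fin n) :
    schwartzNorm (schwartzPartial i w) ≤ ε⁻¹ * A := by
  have h1 : schwartzNorm (schwartzPartial i w) ^ 2 ≤
      ∑ i, schwartzNorm (schwartzPartial i w) ^ 2 :=
    Finset.single_le_sum (f := fun i => schwartzNorm (schwartzPartial i w) ^ 2)
      (fun i _ => sq_nonneg _) (Finset.mem_univ i)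
  have h2 : (ε * schwartzNorm (schwartzPartial i w)) ^ 2 ≤ A ^ 2 := by
    rw [regNormSq] at hw
    nlinarith [sq_nonneg (schwartzNorm w), mul_le_mul_of_nonneg_left h1 (sq_nonneg ε)]
  have h3 := abs_le_of_sq_le_sq h2 hA
  rw [inv_mul_eq_div, le_div_iff₀ hε]
  linarith [(abs_le.1 h3).2]

theorem schwartzPartial_regOp (ε : ℝ) (i : Fin n) (w : 𝓢(EuclideanSpace ℝ (Fin n), ℂ)) :
    schwartzPartial i (regOp ε w) = regOp ε (schwartzPartial i w) := by
  simp only [regOp, map_sub, map_smul, map_sum]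
  congr 2
  refine Finset.sum_congr rfl fun j _ => ?_
  rw [schwartzPartial_comm i j, schwartzPartial_comm i j]

theorem regNormSq_partial_le_regOp {ε : ℝ} (hε : 0 < ε) (w : 𝓢(EuclideanSpace ℝ (Fin n), ℂ))
    (i : Fin n) :
    regNormSq ε (schwartzPartial i w) ≤ (2 * ε⁻¹ * schwartzNorm (regOp ε w)) ^ 2 := by
  have h1 : regNormSq ε (schwartzPartial i w) ≤ ∑ i, regNormSq ε (schwartzPartial i w) :=
    Finset.single_le_sum (f := fun i => regNormSq ε (schwartzPartial i w))
      (fun i _ => regNormSq_nonneg _ _) (Finset.mem_univ i)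
  have h2 : ε ^ 2 * ∑ i, regNormSq ε (schwartzPartial i w) =
      (schwartzInner (regOp ε w) (regOp ε w)).re - (schwartzInner (regOp ε w) w).re := by
    simp only [← re_schwartzInner_regOp_self, ← schwartzPartial_regOp, schwartzInner_partial]
    conv_rhs => rw [← Complex.sub_re, ← schwartzInner_sub_right]
    have h3 : regOp ε w - w = -(((ε ^ 2 : ℝ) : ℂ) • ∑ i, schwartzPartial i (schwartzPartial i w)) := by
      rw [regOp]
      abel
    rw [h3, ← neg_smul, schwartzInner_smul_right, schwartzInner_sum_right, ← Complex.ofReal_neg,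
      Complex.re_ofReal_mul, Complex.re_sum]
    simp only [Complex.neg_re, Finset.sum_neg_distrib]
    ring
  rw [← schwartzNorm_sq, re_schwartzInner_regOp_self] at h2
  have h4 := regNormSq_nonneg ε w
  have h5 : ε ^ 2 * regNormSq ε (schwartzPartial i w) ≤ schwartzNorm (regOp ε w) ^ 2 := by
    nlinarith [mul_le_mul_of_nonneg_left h1 (sq_nonneg ε)]
  have h6 : regNormSq ε (schwartzPartial i w) ≤ (ε⁻¹) ^ 2 * schwartzNorm (regOp ε w) ^ 2 := by
    rw [inv_pow, inv_mul_eq_div, le_div_iff₀ (by positivity)]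
    linarith
  have h7 : 0 ≤ (ε⁻¹) ^ 2 * schwartzNorm (regOp ε w) ^ 2 := by positivity
  nlinarith

/-- The variational lower bound for the form of `1 - ε² Δ`. -/
theorem le_regNormSq (ε : ℝ) (w s : 𝓢(EuclideanSpace ℝ (Fin n), ℂ)) :
    2 * (schwartzInner (regOp ε w) s).re - regNormSq ε s ≤ regNormSq ε w := by
  have h1 := regNormSq_nonneg ε (w - s)
  rw [← re_schwartzInner_regOp_self] at h1 ⊢
  rw [← re_schwartzInner_regOp_self ε w]
  have h2 : regOp ε (w - s) = regOp ε w - regOp ε s := by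
    simp only [regOp, map_sub, Finset.sum_sub_distrib, smul_sub]
    abel
  have h3 : (schwartzInner (regOp ε s) w).re = (schwartzInner (regOp ε w) s).re := by
    rw [schwartzInner_regOp, schwartzInner_regOp, Complex.add_re, Complex.add_re,
      Complex.re_ofReal_mul, Complex.re_ofReal_mul, Complex.re_sum, Complex.re_sum,
      re_schwartzInner_comm s w]
    simp only [fun i => re_schwartzInner_comm (schwartzPartial i s) (schwartzPartial i w)]
  rw [h2, schwartzInner_sub_left, schwartzInner_sub_right, schwartzInner_sub_right] at h1
  simp only [Complex.sub_re] at h1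
  linarith

end Regularization

/-! ### The localized estimate for weak solutions -/

section LocalEstimate

variable {n : ℕ}

/-- Cauchy–Schwarz for a nonnegative symmetric form, with one real and one complex argument. -/
theorem norm_sq_form_le {B : Fin n → Fin n → ℝ} (hsym : ∀ j k, B j k = B k j)
    (hB : ∀ ξ : Fin n → ℝ, 0 ≤ ∑ j, ∑ k, B j k * ξ j * ξ k) (η : Fin n → ℝ) (z : Fin n → ℂ) :
    ‖∑ j, ∑ k, ((B j k * η j : ℝ) : ℂ) * z k‖ ^ 2 ≤ (∑ j, ∑ k, B j k * η j * η k) *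
      ∑ j, ∑ k, B j k * ((starRingEnd ℂ) (z j) * z k).re := by
  have key : ∀ ξ : Fin n → ℝ, (∑ j, ∑ k, B j k * η j * ξ k) ^ 2 ≤
      (∑ j, ∑ k, B j k * η j * η k) * ∑ j, ∑ k, B j k * ξ j * ξ k := by
    intro ξ
    have hexp : ∀ t : ℝ, 0 ≤ (∑ j, ∑ k, B j k * η j * η k) * (t * t) +
        (2 * ∑ j, ∑ k, B j k * η j * ξ k) * t + ∑ j, ∑ k, B j k * ξ j * ξ k := by
      intro t
      have h1 := hB (fun j => t * η j + ξ j)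
      have h2 : ∑ j, ∑ k, B j k * ξ j * η k = ∑ j, ∑ k, B j k * η j * ξ k := by
        rw [Finset.sum_comm]
        refine Finset.sum_congr rfl fun j _ => Finset.sum_congr rfl fun k _ => ?_
        rw [hsym k j]
        ring
      have h3 : ∑ j, ∑ k, B j k * (t * η j + ξ j) * (t * η k + ξ k) =
          (∑ j, ∑ k, B j k * η j * η k) * (t * t) + (∑ j, ∑ k, B j k * η j * ξ k) * t +
          (∑ j, ∑ k, B j k * ξ j * η k) * t + ∑ j, ∑ k, B j k * ξ j * ξ k := by
        simp only [Finset.sum_mul, ← Finset.sum_add_distrib]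
        refine Finset.sum_congr rfl fun j _ => Finset.sum_congr rfl fun k _ => by ring
      rw [h3, h2] at h1
      linarith
    have := discrim_le_zero hexp
    rw [discrim] at this
    nlinarith
  rw [re_form_eq, mul_add, Complex.sq_norm, Complex.normSq_apply]
  have h1 := key fun j => (z j).re
  have h2 := key fun j => (z j).im
  simp only [Complex.re_sum, Complex.im_sum, Complex.re_ofReal_mul, Complex.im_ofReal_mul]
  nlinarith

variable {h : ℝ} {b : Fin n → Fin n → EuclideanSpace ℝ (Fin n) → ℝ}
  {c : Fin n → EuclideanSpace ℝ (Fin n) → ℝ} {p : EuclideanSpace ℝ (Fin n) → ℝ}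
  {χ : EuclideanSpace ℝ (Fin n) → ℝ}

/-- The zeroth order part `P χ - p χ - (h / 2) (div c) χ` of the commutator of `P` with a function `χ`. -/
noncomputable def commutatorCoeff (h : ℝ) (b : Fin n → Fin n → EuclideanSpace ℝ (Fin n) → ℝ)
    (c : Fin n → EuclideanSpace ℝ (Fin n) → ℝ) (χ : EuclideanSpace ℝ (Fin n) → ℝ)
    (x : EuclideanSpace ℝ (Fin n)) : ℝ :=
  -h ^ 2 * (∑ j, ∑ k, (realPartial j (b j k) x * realPartial k χ x +
    b j k x * realPartial j (realPartial k χ) x)) + h * ∑ j, c j x * realPartial j χ x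

theorem schwartzOp_mul_apply (hT : TemperateCoeffs b c p) (hsym : ∀ j k x, b j k x = b k j x)
    (hχ : χ.HasTemperateGrowth) (w : 𝓢(EuclideanSpace ℝ (Fin n), ℂ))
    (x : EuclideanSpace ℝ (Fin n)) :
    schwartzOp h b c p (schwartzMul χ w) x = (χ x : ℂ) * schwartzOp h b c p w x +
      (-2 * (h : ℂ) ^ 2 * (∑ j, ∑ k, ((b j k x * realPartial j χ x : ℝ) : ℂ) *
        schwartzPartial k w x) + (commutatorCoeff h b c χ x : ℂ) * w x) := by
  have hχ' := fun j => hχ.realPartial j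
  have hχ'' := fun j k => (hχ.realPartial j).realPartial k
  rw [schwartzOp_apply_expand hT, schwartzOp_apply_expand hT]
  simp only [schwartzPartial_schwartzMul hχ, map_add, schwartzPartial_schwartzMul (hχ' _),
    add_apply, schwartzMul_apply hχ, schwartzMul_apply (hχ' _), schwartzMul_apply (hχ'' _ _),
    commutatorCoeff]
  have hswap : ∑ j, ∑ k, (b j k x : ℂ) * ((realPartial k χ x : ℂ) * schwartzPartial j w x) =
      ∑ j, ∑ k, (b j k x : ℂ) * ((realPartial j χ x : ℂ) * schwartzPartial k w x) := by
    rw [Finset.sum_comm]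
    refine Finset.sum_congr rfl fun j _ => Finset.sum_congr rfl fun k _ => ?_
    rw [hsym k j]
  have e1 : ∑ j, ∑ k, ((realPartial j (b j k) x : ℂ) *
      ((realPartial k χ x : ℂ) * w x + (χ x : ℂ) * schwartzPartial k w x) +
      (b j k x : ℂ) * ((realPartial j (realPartial k χ) x : ℂ) * w x +
        (realPartial k χ x : ℂ) * schwartzPartial j w x +
        ((realPartial j χ x : ℂ) * schwartzPartial k w x +
          (χ x : ℂ) * schwartzPartial j (schwartzPartial k w) x))) =
      (χ x : ℂ) * (∑ j, ∑ k, ((realPartial j (b j k) x : ℂ) * schwartzPartial k w x +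
        (b j k x : ℂ) * schwartzPartial j (schwartzPartial k w) x)) +
      (∑ j, ∑ k, ((realPartial j (b j k) x : ℂ) * (realPartial k χ x : ℂ) +
        (b j k x : ℂ) * (realPartial j (realPartial k χ) x : ℂ))) * w x +
      2 * ∑ j, ∑ k, (b j k x : ℂ) * ((realPartial j χ x : ℂ) * schwartzPartial k w x) := by
    rw [two_mul]
    nth_rewrite 1 [← hswap]
    simp only [Finset.mul_sum, Finset.sum_mul, ← Finset.sum_add_distrib]
    refine Finset.sum_congr rfl fun j _ => Finset.sum_congr rfl fun k _ => by ring
  have e2 : ∑ j, ((c j x : ℂ) * ((realPartial j χ x : ℂ) * w x +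
      (χ x : ℂ) * schwartzPartial j w x) +
      1 / 2 * (realPartial j (c j) x : ℂ) * ((χ x : ℂ) * w x)) =
      (χ x : ℂ) * (∑ j, ((c j x : ℂ) * schwartzPartial j w x +
        1 / 2 * (realPartial j (c j) x : ℂ) * w x)) +
      (∑ j, (c j x : ℂ) * (realPartial j χ x : ℂ)) * w x := by
    simp only [Finset.mul_sum, Finset.sum_mul, ← Finset.sum_add_distrib]
    refine Finset.sum_congr rfl fun j _ => by ring
  rw [e1, e2]
  push_cast
  simp only [mul_assoc]
  ring

/-- A cutoff function whose commutator with `P` is controlled by `K`. -/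
structure ControlledCutoff (K h : ℝ) (b : Fin n → Fin n → EuclideanSpace ℝ (Fin n) → ℝ)
    (c : Fin n → EuclideanSpace ℝ (Fin n) → ℝ) (χ : EuclideanSpace ℝ (Fin n) → ℝ) : Prop where
  smooth : ContDiff ℝ ∞ χ
  compact : HasCompactSupport χ
  abs_le_one : ∀ x, |χ x| ≤ 1
  form_le : ∀ x, ∑ j, ∑ k, b j k x * realPartial j χ x * realPartial k χ x ≤ K
  commutator_le : ∀ x, |commutatorCoeff h b c χ x| ≤ K

theorem ControlledCutoff.temperate {K : ℝ} (hχ : ControlledCutoff K h b c χ) :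
    χ.HasTemperateGrowth :=
  hχ.compact.hasTemperateGrowth hχ.smooth

/-- The commutator of `P` with a cutoff is bounded by the degenerate energy. -/
theorem commutator_norm_sq_le {K K' : ℝ} (hC : ControlledCoeffs K b c p)
    (hχ : ControlledCutoff K' h b c χ) (w : 𝓢(EuclideanSpace ℝ (Fin n), ℂ)) :
    schwartzNorm (schwartzOp h b c p (schwartzMul χ w) -
      schwartzMul χ (schwartzOp h b c p w)) ^ 2 ≤
      8 * h ^ 4 * K' * energy b w + 2 * K' ^ 2 * schwartzNorm w ^ 2 := by
  have hT := hC.temperate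
  rw [schwartzNorm_sq_eq_integral, schwartzNorm_sq_eq_integral w, energy, ← integral_const_mul,
    ← integral_const_mul, ← integral_add ((integrable_energyDensity hT.b w).const_mul _)
      ((integrable_norm_sq_schwartz w).const_mul _)]
  refine integral_mono (integrable_norm_sq_schwartz _)
    (((integrable_energyDensity hT.b w).const_mul _).add
      ((integrable_norm_sq_schwartz w).const_mul _)) fun x => ?_
  simp only [sub_apply, schwartzOp_mul_apply hT hC.symm hχ.temperate,
    schwartzMul_apply hχ.temperate, add_sub_cancel_left]
  set X : ℂ := ∑ j, ∑ k, ((b j k x * realPartial j χ x : ℝ) : ℂ) * schwartzPartial k w x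
  have h1 : ‖X‖ ^ 2 ≤ K' * energyDensity b w x := by
    refine (norm_sq_form_le (fun j k => hC.symm j k x) (hC.form_nonneg x) _ _).trans ?_
    exact mul_le_mul_of_nonneg_right (hχ.form_le x) (energyDensity_nonneg hC.form_nonneg w x)
  have h2 : ‖-2 * (h : ℂ) ^ 2 * X‖ = 2 * h ^ 2 * ‖X‖ := by
    rw [norm_mul, norm_mul, norm_neg, norm_pow, Complex.norm_real, Real.norm_eq_abs, sq_abs]
    norm_num
  have h3 : ‖(commutatorCoeff h b c χ x : ℂ) * w x‖ ≤ K' * ‖w x‖ := by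
    rw [norm_mul, Complex.norm_real, Real.norm_eq_abs]
    exact mul_le_mul_of_nonneg_right (hχ.commutator_le x) (norm_nonneg _)
  have h4 : ‖-2 * (h : ℂ) ^ 2 * X + (commutatorCoeff h b c χ x : ℂ) * w x‖ ^ 2 ≤
      (2 * h ^ 2 * ‖X‖ + K' * ‖w x‖) ^ 2 := by
    refine pow_le_pow_left₀ (norm_nonneg _) ((norm_add_le _ _).trans ?_) 2
    rw [h2]
    linarith
  have h5 : h ^ 4 * ‖X‖ ^ 2 ≤ h ^ 4 * (K' * energyDensity b w x) := by gcongr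
  nlinarith [sq_nonneg (2 * h ^ 2 * ‖X‖ - K' * ‖w x‖)]

/-- For a fixed compactly supported cutoff `χ`, the operator `χ P` is bounded relative to
`1 - ε² Δ`. -/
theorem exists_cutoff_schwartzOp_bound (hT : TemperateCoeffs b c p) (hχ : ContDiff ℝ ∞ χ)
    (hχc : HasCompactSupport χ) {ε : ℝ} (hε : 0 < ε) (l : ℝ) :
    ∃ A : ℝ, ∀ w : 𝓢(EuclideanSpace ℝ (Fin n), ℂ),
      schwartzNorm (schwartzMul χ (schwartzOp h b c p w + (l : ℂ) • w)) ≤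
        A * schwartzNorm (regOp ε w) := by
  have hχt : χ.HasTemperateGrowth := hχc.hasTemperateGrowth hχ
  -- the class of maps bounded relative to `1 - ε² Δ` is closed under linear combinations
  let Bd : (𝓢(EuclideanSpace ℝ (Fin n), ℂ) → 𝓢(EuclideanSpace ℝ (Fin n), ℂ)) → Prop :=
    fun T => ∃ A : ℝ, ∀ w, schwartzNorm (T w) ≤ A * schwartzNorm (regOp ε w)
  have hadd : ∀ {T T'}, Bd T → Bd T' → Bd (fun w => T w + T' w) := by
    rintro T T' ⟨A, hA⟩ ⟨A', hA'⟩
    refine ⟨A + A', fun w => (schwartzNorm_add_le _ _).trans ?_⟩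
    rw [add_mul]
    exact add_le_add (hA w) (hA' w)
  have hsmul : ∀ {T} (a : ℂ), Bd T → Bd (fun w => a • T w) := by
    rintro T a ⟨A, hA⟩
    refine ⟨‖a‖ * A, fun w => ?_⟩
    rw [schwartzNorm_smul, mul_assoc]
    exact mul_le_mul_of_nonneg_left (hA w) (norm_nonneg _)
  have hsum : ∀ {T : Fin n → _ → _}, (∀ i, Bd (T i)) → Bd (fun w => ∑ i, T i w) := by
    intro T hTi
    choose A hA using hTi
    refine ⟨∑ i, A i, fun w => (schwartzNorm_sum_le _ _).trans ?_⟩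
    rw [Finset.sum_mul]
    exact Finset.sum_le_sum fun i _ => hA i w
  have hmul : ∀ {T} {g : EuclideanSpace ℝ (Fin n) → ℝ}, g.HasTemperateGrowth → Bd T →
      Bd (fun w => schwartzMul χ (schwartzMul g (T w))) := by
    rintro T g hg ⟨A, hA⟩
    obtain ⟨M, hM⟩ := (hχ.continuous.mul hg.1.continuous).bounded_above_of_compact_support
      (hχc.mul_right (f' := g))
    have hM0 : 0 ≤ M := (norm_nonneg _).trans (hM 0)
    refine ⟨M * A, fun w => ?_⟩
    rw [mul_assoc]
    refine le_trans ?_ (mul_le_mul_of_nonneg_left (hA w) hM0)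
    refine schwartzNorm_le_of_norm_le hM0 fun x => ?_
    rw [schwartzMul_apply hχt, schwartzMul_apply hg, ← mul_assoc, norm_mul, ← Complex.ofReal_mul,
      Complex.norm_real]
    exact mul_le_mul_of_nonneg_right (hM x) (norm_nonneg _)
  have h0 : Bd (fun w => w) := ⟨1, fun w => by
    rw [one_mul]
    exact schwartzNorm_le_regOp ε w⟩
  have h1 : ∀ j, Bd (fun w => schwartzPartial j w) := fun j => ⟨ε⁻¹, fun w =>
    schwartzNorm_partial_le_of_regNormSq hε (schwartzNorm_nonneg _) (regNormSq_le_regOp ε w) j⟩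
  have h2 : ∀ j k, Bd (fun w => schwartzPartial j (schwartzPartial k w)) := fun j k =>
    ⟨ε⁻¹ * (2 * ε⁻¹), fun w => by
      rw [mul_assoc]
      exact schwartzNorm_partial_le_of_regNormSq hε
        (mul_nonneg (by positivity) (schwartzNorm_nonneg _)) (regNormSq_partial_le_regOp hε w k) j⟩
  have hone : (fun _ : EuclideanSpace ℝ (Fin n) => (1 : ℝ)).HasTemperateGrowth :=
    Function.HasTemperateGrowth.const 1
  have hall : Bd (fun w =>
      (-(h : ℂ) ^ 2) • (∑ j, ∑ k, (schwartzMul χ (schwartzMul (realPartial j (b j k))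
        (schwartzPartial k w)) + schwartzMul χ (schwartzMul (b j k)
          (schwartzPartial j (schwartzPartial k w))))) +
      ((h : ℂ) / 2) • (∑ j, (schwartzMul χ (schwartzMul (c j) (schwartzPartial j w)) +
        (schwartzMul χ (schwartzMul (realPartial j (c j)) w) +
          schwartzMul χ (schwartzMul (c j) (schwartzPartial j w))))) +
      schwartzMul χ (schwartzMul p w) +
      (l : ℂ) • schwartzMul χ (schwartzMul (fun _ => 1) w)) :=
    hadd (hadd (hadd (hsmul _ (hsum fun j => hsum fun k =>
      hadd (hmul ((hT.b j k).realPartial j) (h1 k)) (hmul (hT.b j k) (h2 j k))))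
      (hsmul _ (hsum fun j => hadd (hmul (hT.c j) (h1 j))
        (hadd (hmul ((hT.c j).realPartial j) h0) (hmul (hT.c j) (h1 j))))))
      (hmul hT.p h0)) (hsmul _ (hmul hone h0))
  obtain ⟨A, hA⟩ := hall
  refine ⟨A, fun w => ?_⟩
  have hw1 : schwartzMul (fun _ => (1 : ℝ)) w = w := by
    ext x
    rw [schwartzMul_apply hone]
    simp
  convert hA w using 2
  rw [schwartzOp_eq]
  simp only [map_add, map_smul, map_sum, schwartzPartial_schwartzMul (hT.b _ _),
    schwartzPartial_schwartzMul (hT.c _), hw1]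

/-- The key estimate: for a weak solution `u ∈ L²` of the adjoint equation, tested against
functions cut off by `χ`, the norm of `χ u` is small compared with that of `u` for large `l`. The
constant depends only on the bounds of the coefficients and of the cutoff. -/
theorem exists_local_estimate {K K' : ℝ} (hC : ControlledCoeffs K b c p) (hK' : 0 ≤ K') :
    ∃ C : ℝ, 0 ≤ C ∧ ∀ l : ℝ, C ≤ l → ∀ χ : EuclideanSpace ℝ (Fin n) → ℝ,
      ControlledCutoff K' h b c χ →
      ∀ u v : Lp ℂ 2 (volume : Measure (EuclideanSpace ℝ (Fin n))),
      (v =ᵐ[volume] fun x => (χ x : ℂ) * u x) →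
      (∀ φ : 𝓢(EuclideanSpace ℝ (Fin n), ℂ), inner ℂ u (SchwartzMap.toLpCLM ℂ ℂ 2 volume
        (schwartzOp h b c p (schwartzMul χ φ) + (l : ℂ) • schwartzMul χ φ)) = 0) →
      (l - C) * ‖v‖ ^ 2 ≤ C * ‖u‖ ^ 2 := by
  -- test with `χ w`, where `(1 - ε² Δ) w` is `χ` times a Schwartz approximation of `u`; then `ε → 0`
  obtain ⟨C₁, hC₁0, hC₁⟩ := exists_regularized_accretivity (h := h) hC
  have hT := hC.temperate
  set γ : ℝ := 2 * h ^ 2 * K' + 1 with hγ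
  have hγ1 : 1 ≤ γ := by
    rw [hγ]
    have : 0 ≤ 2 * h ^ 2 * K' := by positivity
    linarith
  set C₂ : ℝ := C₁ + K' ^ 2 with hC₂
  have hC₂0 : 0 ≤ C₂ := by positivity
  refine ⟨max C₂ γ, hC₂0.trans (le_max_left _ _), fun l hl χ hχ u v hv hort => ?_⟩
  have hl2 : C₂ ≤ l := (le_max_left _ _).trans hl
  have hχt := hχ.temperate
  let J : 𝓢(EuclideanSpace ℝ (Fin n), ℂ) →L[ℂ] Lp ℂ 2 (volume : Measure (EuclideanSpace ℝ (Fin n))) :=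
    SchwartzMap.toLpCLM ℂ ℂ 2 volume
  obtain ⟨uk, huk⟩ : ∃ uk : ℕ → 𝓢(EuclideanSpace ℝ (Fin n), ℂ),
      Filter.Tendsto (fun k => J (uk k)) Filter.atTop (nhds u) := by
    have hd := SchwartzMap.denseRange_toLpCLM (F := ℂ) (E := EuclideanSpace ℝ (Fin n)) (p := 2)
      (μ := volume) (by simp)
    obtain ⟨y, hy, hy'⟩ := mem_closure_iff_seq_limit.1 (hd u)
    choose uk huk using hy
    exact ⟨uk, hy'.congr fun k => (huk k).symm⟩
  have hvk : Filter.Tendsto (fun k => J (schwartzMul χ (uk k))) Filter.atTop (nhds v) := by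
    rw [tendsto_iff_norm_sub_tendsto_zero] at huk ⊢
    refine squeeze_zero (fun k => norm_nonneg _) (fun k => ?_) huk
    refine Lp.norm_le_norm_of_ae_le ?_
    filter_upwards [Lp.coeFn_sub (J (schwartzMul χ (uk k))) v, Lp.coeFn_sub (J (uk k)) u, hv,
      SchwartzMap.coeFn_toLp (schwartzMul χ (uk k)) 2 volume,
      SchwartzMap.coeFn_toLp (uk k) 2 volume] with x h1 h2 h3 h4 h5
    rw [h1, h2, Pi.sub_apply, Pi.sub_apply, h3]
    change ‖(SchwartzMap.toLp (schwartzMul χ (uk k)) 2 volume : EuclideanSpace ℝ (Fin n) → ℂ) x - _‖ ≤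
      ‖(SchwartzMap.toLp (uk k) 2 volume : EuclideanSpace ℝ (Fin n) → ℂ) x - _‖
    rw [h4, h5, schwartzMul_apply hχt, ← mul_sub, norm_mul, Complex.norm_real, Real.norm_eq_abs]
    exact mul_le_of_le_one_left (norm_nonneg _) (hχ.abs_le_one x)
  -- the inequality before passage to the limit
  have hineq : ∀ ε : ℝ, 0 < ε → ε ≤ 1 → ∃ A : ℝ, ∀ u' s : 𝓢(EuclideanSpace ℝ (Fin n), ℂ),
      (l - C₂) * (2 * (inner ℂ (J (schwartzMul χ u')) (J s)).re - regNormSq ε s) ≤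
        γ * ‖u‖ ^ 2 + ‖u - J u'‖ * (A * ‖J (schwartzMul χ u')‖) := by
    intro ε hε hε1
    obtain ⟨A, hA⟩ := exists_cutoff_schwartzOp_bound (h := h) hT hχ.smooth hχ.compact hε l
    refine ⟨A, fun u' s => ?_⟩
    obtain ⟨w, hw⟩ := exists_regOp_eq ε (schwartzMul χ u')
    have hAw := hA w
    rw [hw] at hAw
    set D := schwartzOp h b c p (schwartzMul χ w) - schwartzMul χ (schwartzOp h b c p w) with hD
    set Y := schwartzMul χ (schwartzOp h b c p w + (l : ℂ) • w) with hY
    have hsplit : schwartzOp h b c p (schwartzMul χ w) + (l : ℂ) • schwartzMul χ w = D + Y := by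
      rw [hD, hY, map_add, map_smul]
      abel
    have h0 : (inner ℂ (u - J u') (J Y)).re + (inner ℂ (J u') (J Y)).re +
        (inner ℂ u (J D)).re = 0 := by
      have := hort w
      rw [hsplit, map_add, inner_add_right] at this
      have h1 := congrArg Complex.re this
      rw [Complex.add_re, Complex.zero_re] at h1
      rw [inner_sub_left, Complex.sub_re]
      linarith
    have h1 : (inner ℂ (J u') (J Y)).re =
        (schwartzInner (regOp ε w) (schwartzOp h b c p w)).re + l * regNormSq ε w := by
      have e : inner ℂ (J u') (J Y) = schwartzInner u' Y := rfl
      rw [e, hY, ← schwartzInner_mul hχt, ← hw, schwartzInner_add_right, schwartzInner_smul_right,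
        Complex.add_re, Complex.re_ofReal_mul, re_schwartzInner_regOp_self]
    have h2 := hC₁ ε hε.le hε1 w
    have h3 : -(‖u - J u'‖ * (A * ‖J (schwartzMul χ u')‖)) ≤ (inner ℂ (u - J u') (J Y)).re := by
      have h4 := (abs_le.1 (Complex.abs_re_le_norm (inner ℂ (u - J u') (J Y)))).1
      have h5 := norm_inner_le_norm (𝕜 := ℂ) (u - J u') (J Y)
      have h6 : ‖u - J u'‖ * ‖J Y‖ ≤ ‖u - J u'‖ * (A * ‖J (schwartzMul χ u')‖) :=
        mul_le_mul_of_nonneg_left hAw (norm_nonneg _)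
      linarith
    have h7 : -(γ * ‖u‖ ^ 2 + h ^ 2 * energy b w + K' ^ 2 * regNormSq ε w) ≤
        (inner ℂ u (J D)).re := by
      have h4 := (abs_le.1 (Complex.abs_re_le_norm (inner ℂ u (J D)))).1
      have h5 := norm_inner_le_norm (𝕜 := ℂ) u (J D)
      have h6 : ‖J D‖ ^ 2 ≤ 8 * h ^ 4 * K' * energy b w + 2 * K' ^ 2 * schwartzNorm w ^ 2 :=
        commutator_norm_sq_le hC hχ w
      have hE := energy_nonneg hC.form_nonneg w
      have hN : schwartzNorm w ^ 2 ≤ regNormSq ε w := by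
        rw [regNormSq]
        have := Finset.sum_nonneg fun (i : Fin n) (_ : i ∈ Finset.univ) =>
          sq_nonneg (schwartzNorm (schwartzPartial i w))
        have := mul_nonneg (sq_nonneg ε) this
        linarith
      -- Young's inequality with weight `γ`
      have h8 : ‖u‖ * ‖J D‖ ≤ γ * ‖u‖ ^ 2 + ‖J D‖ ^ 2 / (4 * γ) := by
        have e : γ * ‖u‖ ^ 2 + ‖J D‖ ^ 2 / (4 * γ) - ‖u‖ * ‖J D‖ =
            (2 * γ * ‖u‖ - ‖J D‖) ^ 2 / (4 * γ) := by
          field_simp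
          ring
        have : 0 ≤ (2 * γ * ‖u‖ - ‖J D‖) ^ 2 / (4 * γ) := by positivity
        linarith
      have h9 : ‖J D‖ ^ 2 / (4 * γ) ≤ h ^ 2 * energy b w + K' ^ 2 * regNormSq ε w := by
        rw [div_le_iff₀ (by linarith)]
        have e1 : 8 * h ^ 4 * K' * energy b w ≤ h ^ 2 * energy b w * (4 * γ) := by
          rw [hγ]
          have : 0 ≤ h ^ 2 * energy b w := by positivity
          nlinarith
        have e2 : 2 * K' ^ 2 * schwartzNorm w ^ 2 ≤ K' ^ 2 * regNormSq ε w * (4 * γ) := by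
          have e3 : K' ^ 2 * schwartzNorm w ^ 2 ≤ K' ^ 2 * regNormSq ε w := by gcongr
          have e4 : 0 ≤ K' ^ 2 * regNormSq ε w :=
            mul_nonneg (sq_nonneg _) (regNormSq_nonneg _ _)
          nlinarith
        linarith
      linarith
    have h10 : (l - C₂) * regNormSq ε w ≤
        γ * ‖u‖ ^ 2 + ‖u - J u'‖ * (A * ‖J (schwartzMul χ u')‖) := by
      rw [hC₂]
      linarith
    refine le_trans (mul_le_mul_of_nonneg_left ?_ (by linarith)) h10
    have h11 := le_regNormSq ε w s
    rw [hw] at h11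
    exact h11
  -- first limit: Schwartz approximations of `u`
  have hineq2 : ∀ ε : ℝ, 0 < ε → ε ≤ 1 → ∀ s : 𝓢(EuclideanSpace ℝ (Fin n), ℂ),
      (l - C₂) * (2 * (inner ℂ v (J s)).re - regNormSq ε s) ≤ γ * ‖u‖ ^ 2 := by
    intro ε hε hε1 s
    obtain ⟨A, hA⟩ := hineq ε hε hε1
    have hL : Filter.Tendsto (fun k => (l - C₂) *
        (2 * (inner ℂ (J (schwartzMul χ (uk k))) (J s)).re - regNormSq ε s)) Filter.atTop
        (nhds ((l - C₂) * (2 * (inner ℂ v (J s)).re - regNormSq ε s))) := by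
      have h1 : Filter.Tendsto (fun k => inner ℂ (J (schwartzMul χ (uk k))) (J s)) Filter.atTop
          (nhds (inner ℂ v (J s))) := hvk.inner tendsto_const_nhds
      have h2 := (Complex.continuous_re.tendsto _).comp h1
      exact ((h2.const_mul 2).sub_const _).const_mul _
    have hR : Filter.Tendsto (fun k => γ * ‖u‖ ^ 2 +
        ‖u - J (uk k)‖ * (A * ‖J (schwartzMul χ (uk k))‖)) Filter.atTop
        (nhds (γ * ‖u‖ ^ 2 + ‖u - u‖ * (A * ‖v‖))) :=
      ((huk.const_sub u).norm.mul (hvk.norm.const_mul A)).const_add _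
    rw [sub_self, norm_zero, zero_mul, add_zero] at hR
    exact le_of_tendsto_of_tendsto' hL hR fun k => hA _ _
  -- second limit: `ε → 0`
  have hineq3 : ∀ s : 𝓢(EuclideanSpace ℝ (Fin n), ℂ),
      (l - C₂) * (2 * (inner ℂ v (J s)).re - ‖J s‖ ^ 2) ≤ γ * ‖u‖ ^ 2 := by
    intro s
    have hcont : Continuous fun ε : ℝ => (l - C₂) * (2 * (inner ℂ v (J s)).re - regNormSq ε s) := by
      unfold regNormSq
      fun_prop
    have hlim := (hcont.tendsto 0).mono_left (nhdsWithin_le_nhds (s := Ioi 0))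
    have h0 : regNormSq 0 s = ‖J s‖ ^ 2 := by
      rw [regNormSq]
      simp [schwartzNorm, J]
    simp only [h0] at hlim
    refine le_of_tendsto hlim ?_
    filter_upwards [Ioc_mem_nhdsGT (zero_lt_one (α := ℝ))] with ε hε
    exact hineq2 ε hε.1 hε.2 s
  -- third limit: `s → v`
  have hfin : (l - C₂) * ‖v‖ ^ 2 ≤ γ * ‖u‖ ^ 2 := by
    have hL : Filter.Tendsto (fun k => (l - C₂) *
        (2 * (inner ℂ v (J (schwartzMul χ (uk k)))).re - ‖J (schwartzMul χ (uk k))‖ ^ 2))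
        Filter.atTop (nhds ((l - C₂) * (2 * (inner ℂ v v).re - ‖v‖ ^ 2))) := by
      have h1 : Filter.Tendsto (fun k => inner ℂ v (J (schwartzMul χ (uk k)))) Filter.atTop
          (nhds (inner ℂ v v)) := tendsto_const_nhds.inner hvk
      have h2 := (Complex.continuous_re.tendsto _).comp h1
      exact ((h2.const_mul 2).sub (hvk.norm.pow 2)).const_mul _
    have h3 := le_of_tendsto' hL fun k => hineq3 _
    have h4 : (inner ℂ v v).re = ‖v‖ ^ 2 := by
      rw [inner_self_eq_norm_sq_to_K]
      simp [← Complex.ofReal_pow]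
    rw [h4] at h3
    linarith
  have h5 : (l - max C₂ γ) * ‖v‖ ^ 2 ≤ (l - C₂) * ‖v‖ ^ 2 := by
    gcongr
    exact le_max_left _ _
  have h6 : γ * ‖u‖ ^ 2 ≤ max C₂ γ * ‖u‖ ^ 2 := by
    gcongr
    exact le_max_right _ _
  linarith

end LocalEstimate

/-! ### Coefficient bounds and cutoffs -/

section Bounds

variable {n : ℕ}

/-- A function whose derivative has temperate growth has temperate growth. -/
theorem Function.HasTemperateGrowth.of_fderiv_hasTemperateGrowth {E F : Type*}
    [NormedAddCommGroup E] [NormedSpace ℝ E] [NormedAddCommGroup F] [NormedSpace ℝ F] {g : E → F}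
    (hg : Differentiable ℝ g) (hg' : (_root_.fderiv ℝ g).HasTemperateGrowth) :
    g.HasTemperateGrowth := by
  obtain ⟨k, C, hC⟩ := hg'.2 0
  have hC0 : 0 ≤ C := by
    have := (norm_nonneg _).trans (hC 0)
    simpa using this
  refine .of_fderiv hg' hg (k := k + 1) (C := C + ‖g 0‖) fun x => ?_
  have h1 : ‖g x - g 0‖ ≤ C * (1 + ‖x‖) ^ k * ‖x - 0‖ := by
    refine (convex_closedBall (0 : E) ‖x‖).norm_image_sub_le_of_norm_fderiv_le (𝕜 := ℝ)
      (fun y _ => hg y) (fun y hy => ?_) (by simp) (by simp)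
    have h2 := hC y
    rw [norm_iteratedFDeriv_zero] at h2
    refine h2.trans ?_
    have h3 : ‖y‖ ≤ ‖x‖ := by simpa using hy
    gcongr
  rw [sub_zero] at h1
  have h4 : ‖g x‖ ≤ ‖g x - g 0‖ + ‖g 0‖ := by
    simpa using norm_add_le (g x - g 0) (g 0)
  have h5 : 1 ≤ (1 + ‖x‖) ^ (k + 1) := one_le_pow₀ (by linarith [norm_nonneg x])
  have h6 : C * (1 + ‖x‖) ^ k * ‖x‖ ≤ C * (1 + ‖x‖) ^ (k + 1) := by
    rw [pow_succ, ← mul_assoc]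
    gcongr
    linarith
  nlinarith [norm_nonneg (g 0)]

theorem hasTemperateGrowth_of_bounded {E F : Type*}
    [NormedAddCommGroup E] [NormedSpace ℝ E] [NormedAddCommGroup F] [NormedSpace ℝ F] {g : E → F}
    (hg : ContDiff ℝ ∞ g) (hb : ∀ m : ℕ, ∃ C : ℝ, ∀ x, ‖iteratedFDeriv ℝ m g x‖ ≤ C) :
    g.HasTemperateGrowth := by
  refine ⟨hg, fun m => ?_⟩
  obtain ⟨C, hC⟩ := hb m
  exact ⟨0, C, fun x => by simpa using hC x⟩

theorem abs_realPartial_le (g : EuclideanSpace ℝ (Fin n) → ℝ) (i : Fin n)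
    (x : EuclideanSpace ℝ (Fin n)) : |realPartial i g x| ≤ ‖iteratedFDeriv ℝ 1 g x‖ := by
  rw [realPartial, ← Real.norm_eq_abs, norm_iteratedFDeriv_one]
  have h1 := (fderiv ℝ g x).le_opNorm (EuclideanSpace.single i (1 : ℝ))
  rwa [PiLp.norm_single, norm_one, mul_one] at h1

theorem realPartial_realPartial_eq {g : EuclideanSpace ℝ (Fin n) → ℝ} (hg : ContDiff ℝ ∞ g)
    (i l : Fin n) (x : EuclideanSpace ℝ (Fin n)) : realPartial i (realPartial l g) x =
      fderiv ℝ (fderiv ℝ g) x (EuclideanSpace.single i 1) (EuclideanSpace.single l 1) := by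
  have hd : DifferentiableAt ℝ (fderiv ℝ g) x :=
    ((hg.fderiv_right (m := ∞) (by simp)).differentiable (by simp)).differentiableAt
  have h1 : HasFDerivAt (realPartial l g) ((ContinuousLinearMap.apply ℝ ℝ
      (EuclideanSpace.single l (1 : ℝ))).comp (fderiv ℝ (fderiv ℝ g) x)) x :=
    (ContinuousLinearMap.apply ℝ ℝ (EuclideanSpace.single l (1 : ℝ))).hasFDerivAt.comp x
      hd.hasFDerivAt
  rw [realPartial, h1.fderiv]
  rfl

theorem abs_realPartial_realPartial_le {g : EuclideanSpace ℝ (Fin n) → ℝ} (hg : ContDiff ℝ ∞ g)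
    (i l : Fin n) (x : EuclideanSpace ℝ (Fin n)) :
    |realPartial i (realPartial l g) x| ≤ ‖iteratedFDeriv ℝ 2 g x‖ := by
  rw [realPartial_realPartial_eq hg, ← Real.norm_eq_abs, ← norm_iteratedFDeriv_fderiv,
    norm_iteratedFDeriv_one]
  refine ((fderiv ℝ (fderiv ℝ g) x).le_opNorm₂ _ _).trans ?_
  simp

variable {h : ℝ} {b : Fin n → Fin n → EuclideanSpace ℝ (Fin n) → ℝ}
  {c : Fin n → EuclideanSpace ℝ (Fin n) → ℝ} {p : EuclideanSpace ℝ (Fin n) → ℝ}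
  {χ : EuclideanSpace ℝ (Fin n) → ℝ}

theorem exists_controlledCoeffs (hT : TemperateCoeffs b c p)
    (hadm : AdmissibleCoeffsOn univ b c p)
    (hb : ∀ j k, ∃ C : ℝ, ∀ x, ‖iteratedFDeriv ℝ 2 (b j k) x‖ ≤ C)
    (hc : ∀ j, ∃ C : ℝ, ∀ x, ‖iteratedFDeriv ℝ 1 (c j) x‖ ≤ C)
    (hc' : ∀ j, ∃ C : ℝ, ∀ x, ‖iteratedFDeriv ℝ 2 (c j) x‖ ≤ C)
    (hp : ∃ C : ℝ, ∀ x, ‖iteratedFDeriv ℝ 2 p x‖ ≤ C) : ∃ K, ControlledCoeffs K b c p := by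
  choose Cb hCb using hb
  choose Cc hCc using hc
  choose Cc' hCc' using hc'
  obtain ⟨Cp, hCp⟩ := hp
  obtain ⟨Mb, hMb⟩ := Finite.exists_le fun jk : Fin n × Fin n => Cb jk.1 jk.2
  obtain ⟨Mc, hMc⟩ := Finite.exists_le Cc
  obtain ⟨Mc', hMc'⟩ := Finite.exists_le Cc'
  obtain ⟨K, hK⟩ := Finite.exists_le ![Mb, Mc, Mc', Cp, 0]
  have h0 := hK 0
  have h1 := hK 1
  have h2 := hK 2
  have h3 := hK 3
  have h4 := hK 4
  simp only [Matrix.cons_val] at h0 h1 h2 h3 h4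
  exact ⟨K, hT, fun j k x => hadm.symm_b j k x (mem_univ x),
    fun x => hadm.nonneg_p₂ x (mem_univ x), fun x => hadm.nonneg_p₀ x (mem_univ x), h4,
    fun i l j k x => ((abs_realPartial_realPartial_le (hT.b j k).1 i l x).trans (hCb j k x)).trans
      ((hMb (j, k)).trans h0),
    fun i j x => ((abs_realPartial_le (c j) i x).trans (hCc j x)).trans ((hMc j).trans h1),
    fun i l j x => ((abs_realPartial_realPartial_le (hT.c j).1 i l x).trans (hCc' j x)).trans
      ((hMc' j).trans h2),
    fun i x => ((abs_realPartial_realPartial_le hT.p.1 i i x).trans (hCp x)).trans h3⟩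

theorem GrowthConditions.temperateCoeffs (hadm : AdmissibleCoeffsOn univ b c p)
    (hg : GrowthConditions b c p) : TemperateCoeffs b c p := by
  have hsb := fun j k => contDiffOn_univ.1 (hadm.smooth_b j k)
  have hsc := fun j => contDiffOn_univ.1 (hadm.smooth_c j)
  have hsp := contDiffOn_univ.1 hadm.smooth_p₀
  refine ⟨fun j k => hasTemperateGrowth_of_bounded (hsb j k) (hg.bound_b j k), fun j => ?_, ?_⟩
  · refine .of_fderiv_hasTemperateGrowth ((hsc j).differentiable (by simp)) ?_
    refine hasTemperateGrowth_of_bounded ((hsc j).fderiv_right (m := ∞) (by simp)) fun m => ?_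
    simp only [norm_iteratedFDeriv_fderiv]
    exact hg.bound_c j (m + 1) (by omega)
  · have hsp' : ContDiff ℝ ∞ (fderiv ℝ p) := hsp.fderiv_right (m := ∞) (by simp)
    refine .of_fderiv_hasTemperateGrowth (hsp.differentiable (by simp)) ?_
    refine .of_fderiv_hasTemperateGrowth (hsp'.differentiable (by simp)) ?_
    refine hasTemperateGrowth_of_bounded (hsp'.fderiv_right (m := ∞) (by simp)) fun m => ?_
    simp only [norm_iteratedFDeriv_fderiv]
    exact hg.bound_p₀ (m + 1 + 1) (by omega)

theorem GrowthConditions.exists_controlledCoeffs (hadm : AdmissibleCoeffsOn univ b c p)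
    (hg : GrowthConditions b c p) : ∃ K, ControlledCoeffs K b c p :=
  _root_.exists_controlledCoeffs (hg.temperateCoeffs hadm) hadm (fun j k => hg.bound_b j k 2)
    (fun j => hg.bound_c j 1 le_rfl) (fun j => hg.bound_c j 2 (by norm_num))
    (hg.bound_p₀ 2 le_rfl)

theorem ControlledCoeffs.neg {K : ℝ} (hC : ControlledCoeffs K b c p) :
    ControlledCoeffs K b (fun j x => -c j x) p := by
  have hneg : ∀ (g : EuclideanSpace ℝ (Fin n) → ℝ) (i : Fin n),
      realPartial i (fun x => -g x) = fun x => -realPartial i g x := by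
    intro g i
    funext x
    rw [realPartial, fderiv_fun_neg]
    rfl
  refine ⟨hC.temperate.neg, hC.symm, hC.form_nonneg, hC.p_nonneg, hC.K_nonneg, hC.bound_b, ?_, ?_,
    hC.bound_p⟩
  · intro i j x
    rw [hneg, abs_neg]
    exact hC.bound_c i j x
  · intro i l j x
    rw [hneg, hneg, abs_neg]
    exact hC.bound_c' i l j x

/-- Multiplication of an `L²` function by a function bounded by one. -/
theorem exists_Lp_mul {α : Type*} [MeasurableSpace α] {μ : Measure α} (u : Lp ℂ 2 μ) {g : α → ℝ}
    (hg : AEStronglyMeasurable g μ) (hg1 : ∀ x, |g x| ≤ 1) :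
    ∃ v : Lp ℂ 2 μ, (v =ᵐ[μ] fun x => (g x : ℂ) * u x) := by
  have hm : MemLp (fun x => (g x : ℂ) * u x) 2 μ := by
    refine (Lp.memLp u).of_le
      ((Complex.continuous_ofReal.comp_aestronglyMeasurable hg).mul (Lp.memLp u).1)
      (Filter.Eventually.of_forall fun x => ?_)
    rw [norm_mul, Complex.norm_real, Real.norm_eq_abs]
    exact mul_le_of_le_one_left (norm_nonneg _) (hg1 x)
  exact ⟨hm.toLp _, hm.coeFn_toLp⟩

theorem Lp_norm_sq_eq_integral {α : Type*} [MeasurableSpace α] {μ : Measure α} (u : Lp ℂ 2 μ) :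
    ‖u‖ ^ 2 = ∫ x, ‖u x‖ ^ 2 ∂μ := by
  have h1 : (inner ℂ u u).re = ‖u‖ ^ 2 := by
    rw [inner_self_eq_norm_sq_to_K]
    simp [← Complex.ofReal_pow]
  rw [← h1, L2.inner_def]
  have h2 : (fun x => inner ℂ (u x) (u x)) = fun x => ((‖u x‖ ^ 2 : ℝ) : ℂ) := by
    funext x
    rw [inner_self_eq_norm_sq_to_K]
    simp
  rw [h2, integral_complex_ofReal, Complex.ofReal_re]

theorem integrable_norm_sq_Lp {α : Type*} [MeasurableSpace α] {μ : Measure α} (u : Lp ℂ 2 μ) :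
    Integrable (fun x => ‖u x‖ ^ 2) μ :=
  (Lp.memLp u).integrable_norm_pow (by norm_num)

theorem realPartial_comp_smul {g : EuclideanSpace ℝ (Fin n) → ℝ} (hg : Differentiable ℝ g) (a : ℝ)
    (i : Fin n) : realPartial i (fun x => g (a • x)) = fun x => a * realPartial i g (a • x) := by
  funext x
  have h1 : HasFDerivAt (fun x : EuclideanSpace ℝ (Fin n) => a • x)
      (a • ContinuousLinearMap.id ℝ (EuclideanSpace ℝ (Fin n))) x :=
    (hasFDerivAt_id x).const_smul a
  have h2 : HasFDerivAt (fun x => g (a • x)) ((fderiv ℝ g (a • x)).comp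
      (a • ContinuousLinearMap.id ℝ (EuclideanSpace ℝ (Fin n)))) x :=
    (hg (a • x)).hasFDerivAt.comp x h1
  rw [realPartial, h2.fderiv, realPartial]
  simp

theorem realPartial_const_mul {g : EuclideanSpace ℝ (Fin n) → ℝ} (hg : Differentiable ℝ g) (a : ℝ)
    (i : Fin n) : realPartial i (fun x => a * g x) = fun x => a * realPartial i g x := by
  funext x
  rw [realPartial, fderiv_const_mul (hg x)]
  simp [realPartial]

/-- Dilated cutoffs are uniformly controlled: the coefficients `b` are bounded with one derivative,
and the linear growth of `c` is compensated by the factor `1 / R` from differentiation. -/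
theorem exists_controlledCutoff_seq (hT : TemperateCoeffs b c p)
    (hb : ∀ j k, ∃ C : ℝ, ∀ x, ‖iteratedFDeriv ℝ 0 (b j k) x‖ ≤ C)
    (hb' : ∀ j k, ∃ C : ℝ, ∀ x, ‖iteratedFDeriv ℝ 1 (b j k) x‖ ≤ C)
    (hc : ∀ j, ∃ C : ℝ, ∀ x, ‖iteratedFDeriv ℝ 1 (c j) x‖ ≤ C) :
    ∃ K : ℝ, 0 ≤ K ∧ ∃ χ : ℕ → EuclideanSpace ℝ (Fin n) → ℝ,
      (∀ m, ControlledCutoff K h b c (χ m)) ∧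
      ∀ x, ∀ᶠ m in Filter.atTop, χ m x = 1 := by
  choose Cb hCb using hb
  choose Cb' hCb' using hb'
  choose Cc hCc using hc
  obtain ⟨B, hB⟩ := Finite.exists_le fun jk : Fin n × Fin n => Cb jk.1 jk.2
  obtain ⟨B', hB'⟩ := Finite.exists_le fun jk : Fin n × Fin n => Cb' jk.1 jk.2
  obtain ⟨D, hD⟩ := Finite.exists_le Cc
  obtain ⟨D', hD'⟩ := Finite.exists_le fun j => |c j 0|
  let f : ContDiffBump (0 : EuclideanSpace ℝ (Fin n)) := ⟨1, 2, one_pos, one_lt_two⟩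
  have hfs : ContDiff ℝ ∞ f := f.contDiff
  have hfd : Differentiable ℝ f := hfs.differentiable (by simp)
  have hfc : HasCompactSupport f := f.hasCompactSupport
  have hfd1 : ∀ j, ContDiff ℝ ∞ (realPartial j f) := fun j => contDiff_realPartial hfs j
  have hder : ∀ m : ℕ, ∃ A : ℝ, ∀ x, ‖iteratedFDeriv ℝ m f x‖ ≤ A := fun m =>
    (hfs.continuous_iteratedFDeriv (by exact_mod_cast le_top)).bounded_above_of_compact_support
      (hfc.iteratedFDeriv m)
  obtain ⟨A₁, hA₁⟩ := hder 1
  obtain ⟨A₂, hA₂⟩ := hder 2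
  set A := max (max A₁ A₂) 0 with hA
  have hA0 : 0 ≤ A := le_max_right _ _
  have hp1 : ∀ j x, |realPartial j f x| ≤ A := fun j x =>
    (abs_realPartial_le f j x).trans ((hA₁ x).trans ((le_max_left _ _).trans (le_max_left _ _)))
  have hp2 : ∀ j k x, |realPartial j (realPartial k f) x| ≤ A := fun j k x =>
    (abs_realPartial_realPartial_le hfs j k x).trans
      ((hA₂ x).trans ((le_max_right _ _).trans (le_max_left _ _)))
  set M := max (max B B') (max (max D D') 0) with hM
  have hM0 : 0 ≤ M := (le_max_right _ _).trans (le_max_right _ _)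
  have hbM : ∀ j k x, |b j k x| ≤ M := fun j k x => by
    have h1 := hCb j k x
    rw [norm_iteratedFDeriv_zero, Real.norm_eq_abs] at h1
    exact h1.trans ((hB (j, k)).trans ((le_max_left _ _).trans (le_max_left _ _)))
  have hb'M : ∀ i j k x, |realPartial i (b j k) x| ≤ M := fun i j k x =>
    (abs_realPartial_le (b j k) i x).trans ((hCb' j k x).trans
      ((hB' (j, k)).trans ((le_max_right _ _).trans (le_max_left _ _))))
  have hcM : ∀ j x, |c j x| ≤ M * (1 + ‖x‖) := fun j x => by
    have h1 : ‖c j x - c j 0‖ ≤ M * ‖x - 0‖ :=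
      (convex_univ).norm_image_sub_le_of_norm_fderiv_le (𝕜 := ℝ)
        (fun y _ => ((hT.c j).1.differentiable (by simp)) y)
        (fun y _ => by
          rw [← norm_iteratedFDeriv_one]
          exact (hCc j y).trans ((hD j).trans (((le_max_left _ _).trans (le_max_left _ _)).trans
            (le_max_right _ _)))) (mem_univ _) (mem_univ _)
    have h2 : |c j 0| ≤ M := (hD' j).trans (((le_max_right _ _).trans (le_max_left _ _)).trans
            (le_max_right _ _))
    rw [sub_zero, Real.norm_eq_abs] at h1
    have h3 : |c j x| ≤ |c j x - c j 0| + |c j 0| := by simpa using abs_add_le (c j x - c j 0) (c j 0)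
    linarith
  set K : ℝ := max (n * (n * (M * A * A))) (h ^ 2 * (n * (n * (M * A + M * A))) +
    |h| * (n * (3 * M * A))) with hKdef
  let r : ℕ → ℝ := fun m => ((m : ℝ) + 1)⁻¹
  have hr0 : ∀ m, 0 < r m := fun m => by positivity
  have hr1 : ∀ m, r m ≤ 1 := fun m => inv_le_one_of_one_le₀ (by
    have : (0 : ℝ) ≤ m := Nat.cast_nonneg m
    linarith)
  refine ⟨K, le_max_of_le_left (by positivity), fun m x => f (r m • x), fun m => ?_, fun x => ?_⟩
  · have e1 : ∀ j, realPartial j (fun x => f (r m • x)) = fun x => r m * realPartial j f (r m • x) :=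
      fun j => realPartial_comp_smul hfd (r m) j
    have e2 : ∀ j k, realPartial j (fun x => r m * realPartial k f (r m • x)) =
        fun x => r m * (r m * realPartial j (realPartial k f) (r m • x)) := by
      intro j k
      have h1 : Differentiable ℝ (realPartial k f) := (hfd1 k).differentiable (by simp)
      have h2 : Differentiable ℝ (fun x : EuclideanSpace ℝ (Fin n) => realPartial k f (r m • x)) :=
        h1.comp (differentiable_id.const_smul (r m))
      rw [realPartial_const_mul h2, realPartial_comp_smul h1]
    have hq1 : ∀ j x, |r m * realPartial j f (r m • x)| ≤ A := by
      intro j x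
      rw [abs_mul, abs_of_pos (hr0 m)]
      calc r m * |realPartial j f (r m • x)| ≤ 1 * A := by
            gcongr
            · exact hr1 m
            · exact hp1 j _
        _ = A := one_mul A
    have hq2 : ∀ j k x, |r m * (r m * realPartial j (realPartial k f) (r m • x))| ≤ A := by
      intro j k x
      rw [abs_mul, abs_mul, abs_of_pos (hr0 m), ← mul_assoc]
      calc r m * r m * |realPartial j (realPartial k f) (r m • x)| ≤ 1 * 1 * A := by
            have := hr1 m
            have := (hr0 m).le
            gcongr
            exact hp2 j k _
        _ = A := by ring
    -- on the support of the derivative of the cutoff one has `r m * ‖x‖ ≤ 2`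
    have hq3 : ∀ j x, |c j x * (r m * realPartial j f (r m • x))| ≤ 3 * M * A := by
      intro j x
      by_cases hx : r m * ‖x‖ ≤ 2
      · rw [abs_mul, abs_mul, abs_of_pos (hr0 m)]
        calc |c j x| * (r m * |realPartial j f (r m • x)|)
            ≤ (M * (1 + ‖x‖)) * (r m * A) := by
              have := (hr0 m).le
              gcongr
              · exact hcM j x
              · exact hp1 j _
          _ = (r m + r m * ‖x‖) * (M * A) := by ring
          _ ≤ (1 + 2) * (M * A) := by
              gcongr
              exact hr1 m
          _ = 3 * M * A := by ring
      · have hz : realPartial j f (r m • x) = 0 := by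
          have hns : r m • x ∉ tsupport f := by
            rw [f.tsupport_eq, Metric.mem_closedBall, dist_zero_right, norm_smul,
              Real.norm_of_nonneg (hr0 m).le]
            exact hx
          rw [realPartial, fderiv_of_notMem_tsupport ℝ hns]
          rfl
        rw [hz, mul_zero, mul_zero, abs_zero]
        positivity
    refine ⟨hfs.comp (contDiff_const_smul (r m)), ?_, fun x => ?_, fun x => ?_, fun x => ?_⟩
    · exact hfc.comp_homeomorph (Homeomorph.smulOfNeZero (r m) (hr0 m).ne')
    · rw [abs_of_nonneg f.nonneg]
      exact f.le_one
    · refine le_trans ?_ (le_max_left _ _)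
      simp only [e1]
      calc ∑ j, ∑ k, b j k x * (r m * realPartial j f (r m • x)) *
            (r m * realPartial k f (r m • x)) ≤ ∑ j : Fin n, ∑ k : Fin n, M * A * A := by
            refine Finset.sum_le_sum fun j _ => Finset.sum_le_sum fun k _ => ?_
            refine (le_abs_self _).trans ?_
            rw [abs_mul, abs_mul]
            have h1 := hbM j k x
            have h2 := hq1 j x
            have h3 := hq1 k x
            gcongr
        _ = n * (n * (M * A * A)) := by simp
    · refine le_trans ?_ (le_max_right _ _)
      simp only [commutatorCoeff, e1, e2]
      refine (abs_add_le _ _).trans (add_le_add ?_ ?_)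
      · rw [abs_mul, abs_neg, abs_of_nonneg (sq_nonneg h)]
        refine mul_le_mul_of_nonneg_left ?_ (sq_nonneg h)
        calc _ ≤ ∑ j : Fin n, ∑ k : Fin n, (M * A + M * A) := by
              refine (Finset.abs_sum_le_sum_abs _ _).trans (Finset.sum_le_sum fun j _ => ?_)
              refine (Finset.abs_sum_le_sum_abs _ _).trans (Finset.sum_le_sum fun k _ => ?_)
              refine (abs_add_le _ _).trans ?_
              rw [abs_mul (realPartial j (b j k) x), abs_mul (b j k x)]
              have h1 := hbM j k x
              have h2 := hb'M j j k x
              have h3 := hq1 k x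
              have h4 := hq2 j k x
              gcongr
          _ = n * (n * (M * A + M * A)) := by
              simp only [Finset.sum_const, Finset.card_univ, Fintype.card_fin, nsmul_eq_mul]
      · rw [abs_mul]
        refine mul_le_mul_of_nonneg_left ?_ (abs_nonneg h)
        calc _ ≤ ∑ j : Fin n, 3 * M * A :=
              (Finset.abs_sum_le_sum_abs _ _).trans (Finset.sum_le_sum fun j _ => hq3 j x)
          _ = n * (3 * M * A) := by simp
  · obtain ⟨N, hN⟩ := exists_nat_ge ‖x‖
    filter_upwards [Filter.eventually_ge_atTop N] with m hm
    refine f.one_of_mem_closedBall ?_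
    rw [Metric.mem_closedBall, dist_zero_right, norm_smul, Real.norm_of_nonneg (hr0 m).le]
    change r m * ‖x‖ ≤ 1
    rw [inv_mul_le_iff₀ (by positivity), mul_one]
    have : (N : ℝ) ≤ m := by exact_mod_cast hm
    linarith

end Bounds

/-! ### The operator on Euclidean space -/

section Euclidean

/-- Integration of `L²` functions against a fixed `L²` function, without complex conjugation. -/
theorem exists_clm_integral_mul {α : Type*} [MeasurableSpace α] {μ : Measure α} {φ : α → ℂ}
    (hφ : MemLp φ 2 μ) : ∃ L : Lp ℂ 2 μ →L[ℂ] ℂ, ∀ w, L w = ∫ x, w x * φ x ∂μ := by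
  refine ⟨innerSL ℂ (star hφ.toLp), fun w => ?_⟩
  rw [innerSL_apply_apply, L2.inner_def]
  refine integral_congr_ae ?_
  filter_upwards [Lp.coeFn_star hφ.toLp, hφ.coeFn_toLp] with x h1 h2
  rw [h1, Pi.star_apply, h2]
  simp

/-- The set of pairs `(u, v)` cut out by a family of equations `L v = L' u` between continuous
linear functionals is closed. -/
theorem isClosed_setOf_clm_eq {H ι : Type*} [NormedAddCommGroup H] [InnerProductSpace ℂ H]
    (L L' : ι → H →L[ℂ] ℂ) : IsClosed {w : H × H | ∀ i, L i w.2 = L' i w.1} := by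
  simp only [ofPred_forall]
  exact isClosed_iInter fun i =>
    isClosed_eq ((L i).continuous.comp continuous_snd) ((L' i).continuous.comp continuous_fst)

theorem inner_eq_integral_conj_mul {α : Type*} [MeasurableSpace α] {μ : Measure α}
    (u v : Lp ℂ 2 μ) : inner ℂ u v = ∫ x, (starRingEnd ℂ) (u x) * v x ∂μ := by
  rw [L2.inner_def]
  refine integral_congr_ae (Filter.Eventually.of_forall fun x => ?_)
  simp only [RCLike.inner_apply]
  ring

variable {n : ℕ} {h : ℝ} {b : Fin n → Fin n → EuclideanSpace ℝ (Fin n) → ℝ}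
  {c : Fin n → EuclideanSpace ℝ (Fin n) → ℝ} {p : EuclideanSpace ℝ (Fin n) → ℝ}

theorem coeFn_toLpCLM (f : 𝓢(EuclideanSpace ℝ (Fin n), ℂ)) :
    SchwartzMap.toLpCLM ℂ ℂ 2 volume f =ᵐ[volume] f :=
  f.coeFn_toLp 2 volume

/-- The formal adjoint is obtained by changing the sign of the first order part. -/
theorem schwartzInner_schwartzOp_left (hT : TemperateCoeffs b c p)
    (hsymm : ∀ j k x, b j k x = b k j x) (f g : 𝓢(EuclideanSpace ℝ (Fin n), ℂ)) :
    schwartzInner (schwartzOp h b c p f) g =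
      schwartzInner f (schwartzOp h b (fun j x => -c j x) p g) := by
  have hneg : ∀ j (k : 𝓢(EuclideanSpace ℝ (Fin n), ℂ)),
      schwartzMul (fun x => -c j x) k = -schwartzMul (c j) k := by
    intro j k
    ext x
    rw [schwartzMul_apply (hT.neg.c j), neg_apply, schwartzMul_apply (hT.c j)]
    push_cast
    ring
  have hb : ∀ j k, b j k = b k j := fun j k => funext (hsymm j k)
  rw [schwartzOp_eq, schwartzOp_eq]
  simp only [schwartzInner_add_left, schwartzInner_add_right, schwartzInner_smul_left,
    schwartzInner_smul_right, schwartzInner_sum_left, schwartzInner_sum_right,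
    schwartzInner_partial, schwartzInner_mul hT.p, fun j => schwartzInner_mul (hT.c j),
    fun j k => schwartzInner_mul (hT.b j k), hneg, map_neg]
  have hn : ∀ f g : 𝓢(EuclideanSpace ℝ (Fin n), ℂ), schwartzInner f (-g) = -schwartzInner f g :=
    fun f g => by rw [← neg_one_smul ℂ g, schwartzInner_smul_right, neg_one_mul]
  simp only [hn, neg_neg]
  rw [Finset.sum_comm]
  congr 2
  · simp only [hb, map_pow, Complex.conj_ofReal]
  · rw [map_div₀, Complex.conj_ofReal, map_ofNat]
    congr 1
    exact Finset.sum_congr rfl fun j _ => add_comm _ _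

theorem schwartzOp_conj (hT : TemperateCoeffs b c p) (f : 𝓢(EuclideanSpace ℝ (Fin n), ℂ)) :
    schwartzOp h b c p (schwartzConj f) = schwartzConj (schwartzOp h b c p f) := by
  ext x
  rw [schwartzConj_apply, schwartzOp_apply_expand hT, schwartzOp_apply_expand hT]
  simp only [schwartzPartial_conj, schwartzConj_apply, map_add, map_mul, map_neg, map_pow, map_sum,
    Complex.conj_ofReal, map_div₀, map_one, map_ofNat]

/-- The formal transpose with respect to the bilinear pairing `∫ f g`. -/
theorem integral_schwartzOp_mul (hT : TemperateCoeffs b c p)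
    (hsymm : ∀ j k x, b j k x = b k j x) (f g : 𝓢(EuclideanSpace ℝ (Fin n), ℂ)) :
    ∫ x, schwartzOp h b c p f x * g x =
      ∫ x, f x * schwartzOp h b (fun j x => -c j x) p g x := by
  have h1 := schwartzInner_schwartzOp_left (h := h) hT hsymm (schwartzConj f) g
  rw [schwartzOp_conj hT, schwartzInner_eq_integral, schwartzInner_eq_integral] at h1
  simpa only [schwartzConj_apply, Complex.conj_conj] using h1

/-- If cutoffs exhaust the space with uniform control, the local estimates give the triviality of
the kernel of the formal adjoint of `P + l` in `L²` for large `l`; testing against functions of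
compact support is enough. -/
theorem exists_forall_eq_zero_of_inner_schwartzOp {K K' : ℝ} (hC : ControlledCoeffs K b c p)
    (hK' : 0 ≤ K') {χ : ℕ → EuclideanSpace ℝ (Fin n) → ℝ}
    (hχ : ∀ m, ControlledCutoff K' h b c (χ m))
    (hχ1 : ∀ x, ∀ᶠ m in Filter.atTop, χ m x = 1) :
    ∃ l₀ : ℝ, ∀ l, l₀ < l → ∀ u : Lp ℂ 2 (volume : Measure (EuclideanSpace ℝ (Fin n))),
      (∀ ψ : 𝓢(EuclideanSpace ℝ (Fin n), ℂ), HasCompactSupport ψ →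
        inner ℂ u (SchwartzMap.toLpCLM ℂ ℂ 2 volume (schwartzOp h b c p ψ + (l : ℂ) • ψ)) = 0) →
      u = 0 := by
  obtain ⟨C, hC0, hest⟩ := exists_local_estimate (h := h) hC hK'
  refine ⟨2 * C, fun l hl u hu => ?_⟩
  have hbound : ∀ m, (l - C) * ∫ x, ‖(χ m x : ℂ) * u x‖ ^ 2 ≤ C * ‖u‖ ^ 2 := by
    intro m
    obtain ⟨v, hv⟩ := exists_Lp_mul u (hχ m).smooth.continuous.aestronglyMeasurable
      (hχ m).abs_le_one
    have h1 := hest l (by linarith) (χ m) (hχ m) u v hv fun φ => hu _ ?_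
    · rw [Lp_norm_sq_eq_integral v] at h1
      rwa [integral_congr_ae (g := fun x => ‖v x‖ ^ 2) (by
        filter_upwards [hv] with x hx
        rw [hx])]
    · rw [coe_schwartzMul (hχ m).temperate]
      exact ((hχ m).compact.comp_left Complex.ofReal_zero).mul_right
  have hlim : Filter.Tendsto (fun m => ∫ x, ‖(χ m x : ℂ) * u x‖ ^ 2) Filter.atTop
      (nhds (∫ x, ‖u x‖ ^ 2)) := by
    refine tendsto_integral_of_dominated_convergence (fun x => ‖u x‖ ^ 2) (fun m => ?_)
      (integrable_norm_sq_Lp u) (fun m => ?_) (Filter.Eventually.of_forall fun x => ?_)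
    · exact ((Complex.continuous_ofReal.comp (hχ m).smooth.continuous).aestronglyMeasurable.mul
        (Lp.memLp u).1).norm.pow 2
    · refine Filter.Eventually.of_forall fun x => ?_
      rw [Real.norm_of_nonneg (by positivity), norm_mul, Complex.norm_real, Real.norm_eq_abs]
      have := (hχ m).abs_le_one x
      gcongr
      exact mul_le_of_le_one_left (norm_nonneg _) this
    · refine tendsto_const_nhds.congr' ?_
      filter_upwards [hχ1 x] with m hm
      rw [hm, Complex.ofReal_one, one_mul]
  have hfin : (l - C) * ‖u‖ ^ 2 ≤ C * ‖u‖ ^ 2 := by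
    rw [Lp_norm_sq_eq_integral u] at hbound ⊢
    exact le_of_tendsto' (hlim.const_mul _) hbound
  have h0 : ‖u‖ ^ 2 ≤ 0 := by
    by_contra hlt
    have : (l - 2 * C) * ‖u‖ ^ 2 > 0 := mul_pos (by linarith) (not_le.1 hlt)
    linarith
  have h1 : ‖u‖ = 0 := by nlinarith [norm_nonneg u]
  exact norm_eq_zero.1 h1

theorem GrowthConditions.exists_forall_eq_zero (hadm : AdmissibleCoeffsOn univ b c p)
    (hg : GrowthConditions b c p) :
    ∃ l₀ : ℝ, ∀ l, l₀ < l → ∀ u : Lp ℂ 2 (volume : Measure (EuclideanSpace ℝ (Fin n))),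
      (∀ ψ : 𝓢(EuclideanSpace ℝ (Fin n), ℂ), HasCompactSupport ψ →
        inner ℂ u (SchwartzMap.toLpCLM ℂ ℂ 2 volume (schwartzOp h b c p ψ + (l : ℂ) • ψ)) = 0) →
      u = 0 := by
  obtain ⟨K, hK⟩ := hg.exists_controlledCoeffs hadm
  obtain ⟨K', hK', χ, hχ, hχ1⟩ := exists_controlledCutoff_seq (h := h) hK.temperate
    (fun j k => hg.bound_b j k 0) (fun j k => hg.bound_b j k 1) (fun j => hg.bound_c j 1 le_rfl)
  exact exists_forall_eq_zero_of_inner_schwartzOp hK hK' hχ hχ1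

theorem AdmissibleCoeffsOn.neg {Ω : Set (EuclideanSpace ℝ (Fin n))}
    (hadm : AdmissibleCoeffsOn Ω b c p) : AdmissibleCoeffsOn Ω b (fun j x => -c j x) p :=
  ⟨hadm.smooth_b, fun j => (hadm.smooth_c j).neg, hadm.smooth_p₀, hadm.symm_b, hadm.nonneg_p₂,
    hadm.nonneg_p₀⟩

theorem GrowthConditions.neg (hg : GrowthConditions b c p) :
    GrowthConditions b (fun j x => -c j x) p := by
  refine ⟨hg.bound_b, fun j m hm => ?_, hg.bound_p₀⟩
  obtain ⟨C, hC⟩ := hg.bound_c j m hm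
  refine ⟨C, fun x => ?_⟩
  have h1 : iteratedFDeriv ℝ m (fun x => -c j x) x = -iteratedFDeriv ℝ m (c j) x :=
    iteratedFDeriv_neg_apply (f := c j)
  rw [h1, norm_neg]
  exact hC x

/-- The graph of `P` on the Schwartz space as a subspace of `L² × L²`. -/
noncomputable def schwartzGraph (h : ℝ) (b : Fin n → Fin n → EuclideanSpace ℝ (Fin n) → ℝ)
    (c : Fin n → EuclideanSpace ℝ (Fin n) → ℝ) (p : EuclideanSpace ℝ (Fin n) → ℝ) :
    Submodule ℂ (Lp ℂ 2 (volume : Measure (EuclideanSpace ℝ (Fin n))) ×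
      Lp ℂ 2 (volume : Measure (EuclideanSpace ℝ (Fin n)))) :=
  LinearMap.range (((SchwartzMap.toLpCLM ℂ ℂ 2 volume).toLinearMap).prod
    ((SchwartzMap.toLpCLM ℂ ℂ 2 volume).toLinearMap ∘ₗ (schwartzOp h b c p).toLinearMap))

theorem mem_schwartzGraph {w : Lp ℂ 2 (volume : Measure (EuclideanSpace ℝ (Fin n))) ×
      Lp ℂ 2 (volume : Measure (EuclideanSpace ℝ (Fin n)))} :
    w ∈ schwartzGraph h b c p ↔ ∃ φ : 𝓢(EuclideanSpace ℝ (Fin n), ℂ),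
      (SchwartzMap.toLpCLM ℂ ℂ 2 volume φ,
        SchwartzMap.toLpCLM ℂ ℂ 2 volume (schwartzOp h b c p φ)) = w :=
  Iff.rfl

theorem coe_schwartzGraph (hT : TemperateCoeffs b c p) :
    (schwartzGraph h b c p : Set _) = euclideanGraph h b c p := by
  ext w
  rw [SetLike.mem_coe, mem_schwartzGraph]
  refine ⟨?_, ?_⟩
  · rintro ⟨φ, rfl⟩
    refine ⟨φ, coeFn_toLpCLM φ, ?_⟩
    rw [← coe_schwartzOp hT]
    exact coeFn_toLpCLM _
  · rintro ⟨φ, h1, h2⟩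
    rw [← coe_schwartzOp hT] at h2
    exact ⟨φ, Prod.ext (Lp.ext ((coeFn_toLpCLM φ).trans h1.symm))
      (Lp.ext ((coeFn_toLpCLM _).trans h2.symm))⟩

/-- The maximal graph is cut out by continuous linear equations, one for each Schwartz function of
compact support. -/
theorem mem_euclideanMaxGraph_iff (hT : TemperateCoeffs b c p)
    {w : Lp ℂ 2 (volume : Measure (EuclideanSpace ℝ (Fin n))) ×
      Lp ℂ 2 (volume : Measure (EuclideanSpace ℝ (Fin n)))} :
    w ∈ euclideanMaxGraph h b c p ↔ ∀ φ : 𝓢(EuclideanSpace ℝ (Fin n), ℂ), HasCompactSupport φ →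
      ∫ x, w.2 x * φ x = ∫ x, w.1 x * schwartzOp h b (fun j x => -c j x) p φ x := by
  refine ⟨fun hw φ hφ => ?_, fun hw φ hs hφ => ?_⟩
  · rw [coe_schwartzOp hT.neg]
    exact hw φ (φ.smooth ⊤) hφ
  · have h1 := hw (hφ.toSchwartzMap hs) hφ
    rwa [coe_schwartzOp hT.neg] at h1

theorem euclidean_graph_closure (hadm : AdmissibleCoeffsOn univ b c p)
    (hg : GrowthConditions b c p) :
    ∃ A : Lp ℂ 2 (volume : Measure (EuclideanSpace ℝ (Fin n))) →ₗ.[ℂ]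
        Lp ℂ 2 (volume : Measure (EuclideanSpace ℝ (Fin n))),
      (A.graph : Set (_ × _)) = closure (euclideanGraph h b c p) ∧
      Dense (A.domain : Set (Lp ℂ 2 (volume : Measure (EuclideanSpace ℝ (Fin n))))) ∧
      LeftHalfPlaneResolvent A ∧ IsMaximalAccretiveOp A ∧
      (A.graph : Set (_ × _)) = euclideanMaxGraph h b c p := by
  have hT := hg.temperateCoeffs hadm
  have hsymm : ∀ j k x, b j k x = b k j x := fun j k x => hadm.symm_b j k x (mem_univ x)
  obtain ⟨l₁, hl₁⟩ := hg.exists_forall_eq_zero (h := h) hadm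
  obtain ⟨l₂, hl₂⟩ := hg.neg.exists_forall_eq_zero (h := h) hadm.neg
  choose L hL using fun φ : 𝓢(EuclideanSpace ℝ (Fin n), ℂ) =>
    exists_clm_integral_mul (φ.memLp 2 volume)
  have hmax : euclideanMaxGraph h b c p = {w | ∀ φ : {φ : 𝓢(EuclideanSpace ℝ (Fin n), ℂ) //
      HasCompactSupport φ}, L φ w.2 = L (schwartzOp h b (fun j x => -c j x) p φ) w.1} := by
    ext w
    rw [mem_euclideanMaxGraph_iff hT]
    simp only [hL, mem_ofPred_eq, Subtype.forall]
  rw [← coe_schwartzGraph hT]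
  refine exists_maximalAccretive_graph_closure (schwartzGraph h b c p) (euclideanMaxGraph h b c p)
    (max l₁ l₂) ?_ ?_ ?_ ?_ ?_ ?_ ?_
  · rintro w ⟨φ, rfl⟩
    change 0 ≤ (schwartzInner (schwartzOp h b c p φ) φ).re
    rw [re_schwartzInner_comm, re_schwartzInner_schwartzOp hT]
    refine add_nonneg (mul_nonneg (sq_nonneg h) (energy_nonneg (fun x =>
      hadm.nonneg_p₂ x (mem_univ x)) φ)) ?_
    exact re_schwartzInner_mul_nonneg hT.p (fun x => hadm.nonneg_p₀ x (mem_univ x)) φ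
  · have h1 : Prod.fst '' SetLike.coe (schwartzGraph h b c p) =
        range (SchwartzMap.toLpCLM ℝ ℂ 2 (volume : Measure (EuclideanSpace ℝ (Fin n)))) := by
      ext u
      constructor
      · rintro ⟨_, ⟨φ, rfl⟩, rfl⟩
        exact ⟨φ, rfl⟩
      · rintro ⟨φ, rfl⟩
        exact ⟨_, ⟨φ, rfl⟩, rfl⟩
    rw [h1]
    exact SchwartzMap.denseRange_toLpCLM (by norm_num)
  · intro l hl f hf
    refine hl₁ l ((le_max_left _ _).trans_lt hl) f fun ψ _ => ?_
    rw [map_add, map_smul]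
    exact hf _ ⟨ψ, rfl⟩
  · rintro w ⟨φ, rfl⟩
    rw [mem_euclideanMaxGraph_iff hT]
    intro ψ _
    calc _ = ∫ x, schwartzOp h b c p φ x * ψ x := by
          refine integral_congr_ae ?_
          filter_upwards [coeFn_toLpCLM (schwartzOp h b c p φ)] with x hx
          exact congrArg (· * ψ x) hx
      _ = ∫ x, φ x * schwartzOp h b (fun j x => -c j x) p ψ x := integral_schwartzOp_mul hT hsymm φ ψ
      _ = _ := by
          refine integral_congr_ae ?_
          filter_upwards [coeFn_toLpCLM φ] with x hx
          exact congrArg (· * _) hx.symm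
  · rw [hmax]
    exact isClosed_setOf_clm_eq (fun φ : {φ : 𝓢(EuclideanSpace ℝ (Fin n), ℂ) //
      HasCompactSupport φ} => L φ) fun φ => L (schwartzOp h b (fun j x => -c j x) p φ)
  · rw [hmax]
    intro w hw w' hw' φ
    simp only [Prod.fst_sub, Prod.snd_sub, map_sub, hw φ, hw' φ]
  · intro l hl u hu
    rw [mem_euclideanMaxGraph_iff hT] at hu
    -- the maximal graph is defined by the bilinear pairing, the adjoint by the sesquilinear one
    have h0 : star u = 0 := by
      refine hl₂ l ((le_max_right _ _).trans_lt hl) (star u) fun ψ hψ => ?_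
      have h1 := hu ψ hψ
      simp only [← hL] at h1
      have h2 : ∀ g : 𝓢(EuclideanSpace ℝ (Fin n), ℂ),
          inner ℂ (star u) (SchwartzMap.toLpCLM ℂ ℂ 2 volume g) = L g u := by
        intro g
        rw [hL, inner_eq_integral_conj_mul]
        refine integral_congr_ae ?_
        filter_upwards [Lp.coeFn_star u, coeFn_toLpCLM g] with x e1 e2
        rw [e1, e2, Pi.star_apply]
        simp
      rw [map_add, map_smul, inner_add_right, inner_smul_right, h2, h2, ← h1, map_neg, map_smul,
        smul_eq_mul, neg_add_cancel]
    rw [Lp.eq_zero_iff_ae_eq_zero] at h0 ⊢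
    filter_upwards [h0, Lp.coeFn_star u] with x e1 e2
    rw [e2, Pi.star_apply] at e1
    exact star_eq_zero.1 e1

end Euclidean

/-! ### Localization of the coefficients and of the accretivity -/

section Localization

variable {n : ℕ}

theorem exists_contDiff_cutoff {K Ω : Set (EuclideanSpace ℝ (Fin n))} (hK : IsCompact K)
    (hΩ : IsOpen Ω) (hKΩ : K ⊆ Ω) : ∃ θ : EuclideanSpace ℝ (Fin n) → ℝ, ContDiff ℝ ∞ θ ∧
      HasCompactSupport θ ∧ tsupport θ ⊆ Ω ∧ (∀ x, 0 ≤ θ x ∧ θ x ≤ 1) ∧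
      ∀ x ∈ K, ∀ᶠ y in nhds x, θ y = 1 := by
  obtain ⟨R, hR⟩ := hK.isBounded.subset_ball (0 : EuclideanSpace ℝ (Fin n))
  obtain ⟨f, hf0, hf1, hf⟩ := exists_contMDiffMap_zero_one_nhds_of_isClosed (n := ⊤)
    𝓘(ℝ, EuclideanSpace ℝ (Fin n)) (hΩ.inter Metric.isOpen_ball).isClosed_compl hK.isClosed
    (disjoint_compl_left_iff_subset.2 (subset_inter hKΩ hR))
  have hsupp : tsupport f ⊆ Ω ∩ Metric.ball 0 R := by
    intro x hx
    by_contra hx'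
    exact notMem_tsupport_iff_eventuallyEq.2
      (Filter.Eventually.filter_mono (nhds_le_nhdsSet hx') hf0) hx
  refine ⟨f, contMDiff_iff_contDiff.1 f.contMDiff, ?_, hsupp.trans inter_subset_left, hf,
    fun x hx => Filter.Eventually.filter_mono (nhds_le_nhdsSet hx) hf1⟩
  exact (ProperSpace.isCompact_closedBall (0 : EuclideanSpace ℝ (Fin n)) R).of_isClosed_subset
    (isClosed_tsupport _) (hsupp.trans (inter_subset_right.trans Metric.ball_subset_closedBall))

/-- A smooth function on an open set becomes a smooth function on the whole space when it is
multiplied by a cutoff supported in that set. -/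
theorem ContDiffOn.contDiff_smul_of_tsupport_subset {F : Type*} [NormedAddCommGroup F]
    [NormedSpace ℝ F] {Ω : Set (EuclideanSpace ℝ (Fin n))} (hΩ : IsOpen Ω)
    {f : EuclideanSpace ℝ (Fin n) → F} (hf : ContDiffOn ℝ ∞ f Ω)
    {θ : EuclideanSpace ℝ (Fin n) → ℝ} (hθ : ContDiff ℝ ∞ θ) (hs : tsupport θ ⊆ Ω) :
    ContDiff ℝ ∞ fun x => θ x • f x := by
  rw [contDiff_iff_contDiffAt]
  intro x
  by_cases hx : x ∈ tsupport θ
  · exact hθ.contDiffAt.smul (hf.contDiffAt (hΩ.mem_nhds (hs hx)))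
  · refine (contDiffAt_const (c := (0 : F))).congr_of_eventuallyEq ?_
    filter_upwards [notMem_tsupport_iff_eventuallyEq.1 hx] with y hy
    rw [hy, Pi.zero_apply, zero_smul]

variable {h : ℝ} {b b' : Fin n → Fin n → EuclideanSpace ℝ (Fin n) → ℝ}
  {c c' : Fin n → EuclideanSpace ℝ (Fin n) → ℝ} {p p' : EuclideanSpace ℝ (Fin n) → ℝ}

theorem partialDeriv_eventuallyEq {u u' : EuclideanSpace ℝ (Fin n) → ℂ}
    {x : EuclideanSpace ℝ (Fin n)} (hu : u =ᶠ[nhds x] u') (j : Fin n) :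
    partialDeriv j u =ᶠ[nhds x] partialDeriv j u' := by
  filter_upwards [hu.fderiv (𝕜 := ℝ)] with y hy
  rw [partialDeriv, partialDeriv, hy]

/-- The value of the differential expression depends only on germs. -/
theorem diffExpr_congr {x : EuclideanSpace ℝ (Fin n)} {u u' : EuclideanSpace ℝ (Fin n) → ℂ}
    (hb : ∀ j k, b j k =ᶠ[nhds x] b' j k) (hc : ∀ j, c j =ᶠ[nhds x] c' j)
    (hp : p =ᶠ[nhds x] p') (hu : u =ᶠ[nhds x] u') :
    diffExpr h b c p u x = diffExpr h b' c' p' u' x := by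
  have h1 : ∀ j k, partialDeriv j (fun y => (b j k y : ℂ) * semiD h k u y) x =
      partialDeriv j (fun y => (b' j k y : ℂ) * semiD h k u' y) x := fun j k => by
    refine (partialDeriv_eventuallyEq ?_ j).eq_of_nhds
    filter_upwards [hb j k, partialDeriv_eventuallyEq hu k] with y e1 e2
    rw [e1, semiD, semiD, e2]
  have h2 : ∀ j, partialDeriv j (fun y => (c j y : ℂ) * u y) x =
      partialDeriv j (fun y => (c' j y : ℂ) * u' y) x := fun j => by
    refine (partialDeriv_eventuallyEq ?_ j).eq_of_nhds
    filter_upwards [hc j, hu] with y e1 e2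
    rw [e1, e2]
  have h3 : ∀ j, partialDeriv j u x = partialDeriv j u' x := fun j =>
    (partialDeriv_eventuallyEq hu j).eq_of_nhds
  rw [diffExpr, diffExpr, hp.eq_of_nhds, hu.eq_of_nhds]
  congr 2
  · refine Finset.sum_congr rfl fun j _ => Finset.sum_congr rfl fun k _ => ?_
    rw [semiD, semiD, h1]
  · congr 1
    refine Finset.sum_congr rfl fun j _ => ?_
    rw [h2, h3, (hc j).eq_of_nhds]

theorem exists_iteratedFDeriv_bound {F : Type*} [NormedAddCommGroup F]
    [NormedSpace ℝ F] {g : EuclideanSpace ℝ (Fin n) → F} (hg : ContDiff ℝ ∞ g)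
    (hgc : HasCompactSupport g) (m : ℕ) : ∃ C : ℝ, ∀ x, ‖iteratedFDeriv ℝ m g x‖ ≤ C :=
  (hg.continuous_iteratedFDeriv (by exact_mod_cast le_top)).bounded_above_of_compact_support
    (hgc.iteratedFDeriv m)

/-- Coefficients on an open set can be modified outside a compact subset so as to be globally
controlled. -/
theorem AdmissibleCoeffsOn.exists_extension {K Ω : Set (EuclideanSpace ℝ (Fin n))}
    (hadm : AdmissibleCoeffsOn Ω b c p) (hK : IsCompact K) (hΩ : IsOpen Ω) (hKΩ : K ⊆ Ω) :
    ∃ b' c' p', AdmissibleCoeffsOn univ b' c' p' ∧ (∃ A, ControlledCoeffs A b' c' p') ∧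
      (∀ x ∈ K, ∀ᶠ y in nhds x, (∀ j k, b j k y = b' j k y) ∧ (∀ j, c j y = c' j y) ∧
        p y = p' y) := by
  obtain ⟨θ, hθ, hθc, hθs, hθ1, hθK⟩ := exists_contDiff_cutoff hK hΩ hKΩ
  have hsm : ∀ g : EuclideanSpace ℝ (Fin n) → ℝ, ContDiffOn ℝ ∞ g Ω →
      ContDiff ℝ ∞ fun x => θ x * g x := fun g hg => by
    simpa only [smul_eq_mul] using hg.contDiff_smul_of_tsupport_subset hΩ hθ hθs
  have hcs : ∀ g : EuclideanSpace ℝ (Fin n) → ℝ, HasCompactSupport fun x => θ x * g x :=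
    fun g => hθc.mul_right
  have hout : ∀ x, x ∉ Ω → θ x = 0 := fun x hx => image_eq_zero_of_notMem_tsupport fun hx' =>
    hx (hθs hx')
  have hadm' : AdmissibleCoeffsOn univ (fun j k x => θ x * b j k x) (fun j x => θ x * c j x)
      fun x => θ x * p x := by
    refine ⟨fun j k => (hsm _ (hadm.smooth_b j k)).contDiffOn,
      fun j => (hsm _ (hadm.smooth_c j)).contDiffOn, (hsm _ hadm.smooth_p₀).contDiffOn,
      fun j k x _ => ?_, fun x _ ξ => ?_, fun x _ => ?_⟩
    · by_cases hx : x ∈ Ω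
      · rw [hadm.symm_b j k x hx]
      · rw [hout x hx, zero_mul, zero_mul]
    · have h1 : ∑ j, ∑ k, θ x * b j k x * ξ j * ξ k = θ x * ∑ j, ∑ k, b j k x * ξ j * ξ k := by
        simp only [Finset.mul_sum, mul_assoc]
      rw [h1]
      by_cases hx : x ∈ Ω
      · exact mul_nonneg (hθ1 x).1 (hadm.nonneg_p₂ x hx ξ)
      · rw [hout x hx, zero_mul]
    · by_cases hx : x ∈ Ω
      · exact mul_nonneg (hθ1 x).1 (hadm.nonneg_p₀ x hx)
      · simp only [hout x hx, zero_mul, le_refl]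
  refine ⟨_, _, _, hadm', ?_, fun x hx => ?_⟩
  · have hbd : ∀ g : EuclideanSpace ℝ (Fin n) → ℝ, ContDiffOn ℝ ∞ g Ω → ∀ m : ℕ,
        ∃ C : ℝ, ∀ x, ‖iteratedFDeriv ℝ m (fun x => θ x * g x) x‖ ≤ C := fun g hg m =>
      exists_iteratedFDeriv_bound (hsm g hg) (hcs g) m
    refine exists_controlledCoeffs
      ⟨fun j k => (hcs _).hasTemperateGrowth (hsm _ (hadm.smooth_b j k)),
        fun j => (hcs _).hasTemperateGrowth (hsm _ (hadm.smooth_c j)),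
        (hcs _).hasTemperateGrowth (hsm _ hadm.smooth_p₀)⟩ hadm'
      (fun j k => hbd _ (hadm.smooth_b j k) 2) (fun j => hbd _ (hadm.smooth_c j) 1)
      (fun j => hbd _ (hadm.smooth_c j) 2) (hbd _ hadm.smooth_p₀ 2)
  · filter_upwards [hθK x hx] with y hy
    simp only [hy, one_mul, implies_true, and_self]

/-- Without uniformity in `χ` the control of a cutoff is a matter of compactness. -/
theorem exists_controlledCutoff_of_hasCompactSupport (hT : TemperateCoeffs b c p)
    {χ : EuclideanSpace ℝ (Fin n) → ℝ} (hχ : ContDiff ℝ ∞ χ) (hχc : HasCompactSupport χ)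
    (hχ1 : ∀ x, |χ x| ≤ 1) (h : ℝ) : ∃ K : ℝ, 0 ≤ K ∧ ControlledCutoff K h b c χ := by
  have hd : ∀ {g : EuclideanSpace ℝ (Fin n) → ℝ} (_ : ContDiff ℝ ∞ g) (j : Fin n),
      Continuous (realPartial j g) := fun hg j => (contDiff_realPartial hg j).continuous
  have hz : ∀ x ∉ tsupport χ, ∀ j, realPartial j χ x = 0 ∧
      ∀ i, realPartial i (realPartial j χ) x = 0 := by
    intro x hx j
    have h1 : realPartial j χ =ᶠ[nhds x] fun _ => 0 := by
      have h2 : χ =ᶠ[nhds x] fun _ => 0 := notMem_tsupport_iff_eventuallyEq.1 hx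
      filter_upwards [h2.fderiv (𝕜 := ℝ)] with y hy
      rw [realPartial, hy, fderiv_const_apply]
      rfl
    refine ⟨h1.eq_of_nhds, fun i => ?_⟩
    rw [realPartial, h1.fderiv_eq, fderiv_const_apply]
    rfl
  have hbc := fun j k => (hT.b j k).1.continuous
  have hcc := fun j => (hT.c j).1.continuous
  have hb1 := fun i j k => hd (hT.b j k).1 i
  have hx1 := fun j => hd hχ j
  have hx2 := fun i j => hd (contDiff_realPartial hχ j) i
  have hc1 : Continuous fun x => ∑ j, ∑ k, b j k x * realPartial j χ x * realPartial k χ x := by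
    fun_prop
  have hc2 : Continuous (commutatorCoeff h b c χ) := by
    unfold commutatorCoeff
    fun_prop
  obtain ⟨K₁, hK₁⟩ := hc1.bounded_above_of_compact_support
    (HasCompactSupport.intro hχc fun x hx => by simp [(hz x hx _).1])
  obtain ⟨K₂, hK₂⟩ := hc2.bounded_above_of_compact_support
    (HasCompactSupport.intro hχc fun x hx => by
      simp [commutatorCoeff, (hz x hx _).1, (hz x hx _).2])
  refine ⟨max K₁ K₂, le_max_of_le_left ((norm_nonneg _).trans (hK₁ 0)), hχ, hχc, hχ1, fun x => ?_,
    fun x => ?_⟩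
  · exact (le_abs_self _).trans ((hK₁ x).trans (le_max_left _ _))
  · exact (hK₂ x).trans (le_max_right _ _)

theorem integral_schwartzPartial (j : Fin n) (f : 𝓢(EuclideanSpace ℝ (Fin n), ℂ)) :
    ∫ x, schwartzPartial j f x = 0 := by
  have h1 := integral_mul_fderiv_eq_neg_fderiv_mul_of_integrable (𝕜 := ℂ) (μ := volume)
    (f := fun _ : EuclideanSpace ℝ (Fin n) => (1 : ℂ)) (g := f)
    (v := EuclideanSpace.single j (1 : ℝ)) (by simp)
    (by
      simp only [one_mul]
      exact (schwartzPartial j f).integrable.congr (Filter.Eventually.of_forall fun x =>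
        schwartzPartial_apply j f x))
    (by simpa only [one_mul] using f.integrable) (fun x _ => differentiableAt_const _)
    (fun x _ => f.differentiableAt)
  simp only [one_mul, fderiv_const_apply, zero_apply, zero_mul, integral_zero, neg_zero] at h1
  rw [← h1]
  exact integral_congr_ae (Filter.Eventually.of_forall fun x => schwartzPartial_apply j f x)

/-- Integrating `P f` leaves only the zeroth order part of the transpose. -/
theorem integral_schwartzOp (hT : TemperateCoeffs b c p)
    (f : 𝓢(EuclideanSpace ℝ (Fin n), ℂ)) :
    ∫ x, schwartzOp h b c p f x =
      ∫ x, ((p x - h / 2 * ∑ j, realPartial j (c j) x : ℝ) : ℂ) * f x := by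
  have h1 : schwartzOp h b c p f =
      (-(h : ℂ) ^ 2 • (∑ j, ∑ k, schwartzPartial j (schwartzMul (b j k) (schwartzPartial k f))) +
        (h : ℂ) • ∑ j, schwartzPartial j (schwartzMul (c j) f)) +
      (schwartzMul p f - ((h : ℂ) / 2) • ∑ j, schwartzMul (realPartial j (c j)) f) := by
    have h2 : ∀ j, schwartzMul (c j) (schwartzPartial j f) =
        schwartzPartial j (schwartzMul (c j) f) - schwartzMul (realPartial j (c j)) f := fun j => by
      rw [schwartzPartial_schwartzMul (hT.c j), add_sub_cancel_left]
    have h3 : (h : ℂ) • ∑ j, schwartzPartial j (schwartzMul (c j) f) =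
        ((h : ℂ) / 2) • ∑ j, schwartzPartial j (schwartzMul (c j) f) +
        ((h : ℂ) / 2) • ∑ j, schwartzPartial j (schwartzMul (c j) f) := by
      rw [← add_smul, add_halves]
    rw [schwartzOp_eq, h3]
    simp only [h2, Finset.sum_add_distrib, Finset.sum_sub_distrib, smul_add, smul_sub]
    abel
  have h4 : ∀ g : 𝓢(EuclideanSpace ℝ (Fin n), ℂ),
      ∫ x, g x = SchwartzMap.integralCLM ℂ volume g := fun g => rfl
  have h5 : ∀ j (g : 𝓢(EuclideanSpace ℝ (Fin n), ℂ)),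
      SchwartzMap.integralCLM ℂ volume (schwartzPartial j g) = 0 := integral_schwartzPartial
  rw [h4, h1, map_add, map_add, map_smul, map_smul, map_sum, map_sum]
  simp only [map_sum, h5, Finset.sum_const_zero, smul_zero, zero_add]
  rw [← h4]
  refine integral_congr_ae (Filter.Eventually.of_forall fun x => ?_)
  simp only [sub_apply, smul_apply, SchwartzMap.finset_sum_apply, schwartzMul_apply hT.p,
    fun j => schwartzMul_apply ((hT.c j).realPartial j), smul_eq_mul]
  push_cast
  rw [← Finset.sum_mul]
  ring

theorem partialDeriv_mul {f g : EuclideanSpace ℝ (Fin n) → ℂ} {x : EuclideanSpace ℝ (Fin n)}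
    (hf : DifferentiableAt ℝ f x) (hg : DifferentiableAt ℝ g x) (j : Fin n) :
    partialDeriv j (fun y => f y * g y) x =
      partialDeriv j f x * g x + f x * partialDeriv j g x := by
  rw [partialDeriv, fderiv_fun_mul hf hg]
  simp only [add_apply, smul_apply, smul_eq_mul, partialDeriv]
  ring

/-- The function `|f|²` as a complex Schwartz function. -/
noncomputable def schwartzNormSq (f : 𝓢(EuclideanSpace ℝ (Fin n), ℂ)) :
    𝓢(EuclideanSpace ℝ (Fin n), ℂ) :=
  SchwartzMap.pairing (ContinuousLinearMap.mul ℂ ℂ) (schwartzConj f) f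

theorem schwartzNormSq_apply (f : 𝓢(EuclideanSpace ℝ (Fin n), ℂ))
    (x : EuclideanSpace ℝ (Fin n)) : schwartzNormSq f x = (starRingEnd ℂ) (f x) * f x := by
  rw [schwartzNormSq, SchwartzMap.pairing_apply_apply, ContinuousLinearMap.mul_apply',
    schwartzConj_apply]

theorem schwartzPartial_pairing_mul (f g : 𝓢(EuclideanSpace ℝ (Fin n), ℂ)) (j : Fin n) :
    schwartzPartial j (SchwartzMap.pairing (ContinuousLinearMap.mul ℂ ℂ) f g) =
      SchwartzMap.pairing (ContinuousLinearMap.mul ℂ ℂ) (schwartzPartial j f) g +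
      SchwartzMap.pairing (ContinuousLinearMap.mul ℂ ℂ) f (schwartzPartial j g) := by
  ext x
  rw [add_apply, schwartzPartial_apply, SchwartzMap.pairing_apply_apply,
    SchwartzMap.pairing_apply_apply, schwartzPartial_apply, schwartzPartial_apply]
  exact partialDeriv_mul f.differentiableAt g.differentiableAt j

/-- The second order part of `P` measures the defect in the product rule for `|f|²`. -/
theorem two_mul_re_conj_mul_schwartzOp_sub (hT : TemperateCoeffs b c p)
    (f : 𝓢(EuclideanSpace ℝ (Fin n), ℂ)) (x : EuclideanSpace ℝ (Fin n)) :
    2 * ((starRingEnd ℂ) (f x) * schwartzOp h b c p f x).re -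
        (schwartzOp h b c p (schwartzNormSq f) x).re =
      2 * h ^ 2 * energyDensity b f x +
        (p x + h / 2 * ∑ j, realPartial j (c j) x) * ‖f x‖ ^ 2 := by
  have hre : ∀ z : ℂ, z.re = ((z + (starRingEnd ℂ) z) / 2).re := fun z => by
    simp
  have key : (starRingEnd ℂ) (f x) * schwartzOp h b c p f x +
      f x * (starRingEnd ℂ) (schwartzOp h b c p f x) - schwartzOp h b c p (schwartzNormSq f) x =
      (h : ℂ) ^ 2 * (∑ j, ∑ k, (b j k x : ℂ) *
        ((starRingEnd ℂ) (schwartzPartial j f x) * schwartzPartial k f x +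
          schwartzPartial j f x * (starRingEnd ℂ) (schwartzPartial k f x))) +
      ((p x : ℂ) + (h : ℂ) / 2 * ∑ j, (realPartial j (c j) x : ℂ)) *
        ((starRingEnd ℂ) (f x) * f x) := by
    set F := f x
    set a : Fin n → ℂ := fun j => schwartzPartial j f x
    set a₂ : Fin n → Fin n → ℂ := fun j k => schwartzPartial j (schwartzPartial k f) x
    set A : ℂ := ∑ j, ∑ k, ((realPartial j (b j k) x : ℂ) * a k + (b j k x : ℂ) * a₂ j k) with hA
    set B : ℂ := ∑ j, ((c j x : ℂ) * a j + 1 / 2 * (realPartial j (c j) x : ℂ) * F) with hB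
    have e0 : schwartzOp h b c p f x = -(h : ℂ) ^ 2 * A + (h : ℂ) * B + (p x : ℂ) * F :=
      schwartzOp_apply_expand hT f x
    have e1 : ∑ j, ∑ k, ((realPartial j (b j k) x : ℂ) *
          ((starRingEnd ℂ) (a k) * F + (starRingEnd ℂ) F * a k) + (b j k x : ℂ) *
          ((starRingEnd ℂ) (a₂ j k) * F + (starRingEnd ℂ) (a k) * a j +
            ((starRingEnd ℂ) (a j) * a k + (starRingEnd ℂ) F * a₂ j k))) =
        F * (starRingEnd ℂ) A + (starRingEnd ℂ) F * A +
          ∑ j, ∑ k, (b j k x : ℂ) * ((starRingEnd ℂ) (a j) * a k +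
            a j * (starRingEnd ℂ) (a k)) := by
      rw [hA]
      simp only [map_sum, map_add, map_mul, Complex.conj_ofReal, Finset.mul_sum,
        ← Finset.sum_add_distrib]
      exact Finset.sum_congr rfl fun j _ => Finset.sum_congr rfl fun k _ => by ring
    have e2 : ∑ j, ((c j x : ℂ) * ((starRingEnd ℂ) (a j) * F + (starRingEnd ℂ) F * a j) +
          1 / 2 * (realPartial j (c j) x : ℂ) * ((starRingEnd ℂ) F * F)) =
        F * (starRingEnd ℂ) B + (starRingEnd ℂ) F * B -
          1 / 2 * (∑ j, (realPartial j (c j) x : ℂ)) * ((starRingEnd ℂ) F * F) := by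
      rw [hB]
      simp only [map_sum, map_add, map_mul, Complex.conj_ofReal, Finset.mul_sum, Finset.sum_mul,
        ← Finset.sum_add_distrib, ← Finset.sum_sub_distrib, map_div₀, map_one, map_ofNat]
      exact Finset.sum_congr rfl fun j _ => by ring
    have e3 : schwartzOp h b c p (schwartzNormSq f) x =
        -(h : ℂ) ^ 2 * (F * (starRingEnd ℂ) A + (starRingEnd ℂ) F * A +
          ∑ j, ∑ k, (b j k x : ℂ) * ((starRingEnd ℂ) (a j) * a k +
            a j * (starRingEnd ℂ) (a k))) +
        (h : ℂ) * (F * (starRingEnd ℂ) B + (starRingEnd ℂ) F * B -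
          1 / 2 * (∑ j, (realPartial j (c j) x : ℂ)) * ((starRingEnd ℂ) F * F)) +
        (p x : ℂ) * ((starRingEnd ℂ) F * F) := by
      rw [schwartzOp_apply_expand hT, ← e1, ← e2]
      simp only [schwartzNormSq, schwartzPartial_pairing_mul, map_add, add_apply,
        SchwartzMap.pairing_apply_apply, ContinuousLinearMap.mul_apply', schwartzPartial_conj,
        schwartzConj_apply]
      rfl
    rw [e0, e3]
    simp only [map_add, map_mul, map_neg, map_pow, Complex.conj_ofReal]
    ring
  have key' := congrArg Complex.re key
  have hz : ∀ z w : ℂ, (z * (starRingEnd ℂ) w).re = ((starRingEnd ℂ) z * w).re := fun z w => by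
    simp
  have hF : (starRingEnd ℂ) (f x) * f x = ((‖f x‖ ^ 2 : ℝ) : ℂ) := by
    rw [mul_comm, Complex.mul_conj, Complex.normSq_eq_norm_sq]
  have hr : ((p x : ℂ) + (h : ℂ) / 2 * ∑ j, (realPartial j (c j) x : ℂ)) =
      ((p x + h / 2 * ∑ j, realPartial j (c j) x : ℝ) : ℂ) := by
    push_cast
    rfl
  rw [hF, hr, ← Complex.ofReal_mul, ← Complex.ofReal_pow, Complex.add_re, Complex.re_ofReal_mul,
    Complex.ofReal_re, Complex.sub_re, Complex.add_re, hz] at key'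
  simp only [Complex.re_sum, Complex.re_ofReal_mul, Complex.add_re, hz] at key'
  have hE : ∑ j, ∑ k, b j k x * (((starRingEnd ℂ) (schwartzPartial j f x) *
      schwartzPartial k f x).re + ((starRingEnd ℂ) (schwartzPartial j f x) *
      schwartzPartial k f x).re) = 2 * energyDensity b f x := by
    simp only [energyDensity, Finset.mul_sum]
    exact Finset.sum_congr rfl fun j _ => Finset.sum_congr rfl fun k _ => by ring
  rw [hE] at key'
  linarith

/-- Accretivity localized by a nonnegative weight `η`. The terms are arranged so that the two which
involve `|f|²` cancel when the weights are summed over a partition of unity. -/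
theorem integral_localized_accretivity_nonneg (hT : TemperateCoeffs b c p)
    (hb : ∀ x, ∀ ξ : Fin n → ℝ, 0 ≤ ∑ j, ∑ k, b j k x * ξ j * ξ k) (hp : ∀ x, 0 ≤ p x)
    {η : EuclideanSpace ℝ (Fin n) → ℝ} (hη : ContDiff ℝ ∞ η) (hηc : HasCompactSupport η)
    (hη0 : ∀ x, 0 ≤ η x) (f : 𝓢(EuclideanSpace ℝ (Fin n), ℂ)) :
    0 ≤ ∫ x, (η x * (2 * ((starRingEnd ℂ) (f x) * schwartzOp h b c p f x).re -
      (schwartzOp h b c p (schwartzNormSq f) x).re) +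
      (schwartzOp h b c p (schwartzMul η (schwartzNormSq f)) x).re) := by
  have hηt : η.HasTemperateGrowth := hηc.hasTemperateGrowth hη
  set g := schwartzMul η (schwartzNormSq f) with hg
  have hgx : ∀ x, g x = ((η x * ‖f x‖ ^ 2 : ℝ) : ℂ) := fun x => by
    rw [hg, schwartzMul_apply hηt, schwartzNormSq_apply, mul_comm ((starRingEnd ℂ) _),
      Complex.mul_conj, Complex.normSq_eq_norm_sq]
    push_cast
    rfl
  have hcont : Continuous (energyDensity b f) := by
    unfold energyDensity
    have h1 := fun j k => (hT.b j k).1.continuous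
    have h2 := fun j => (schwartzPartial j f).continuous
    fun_prop
  have hdiv : ∀ j, Continuous (realPartial j (c j)) := fun j =>
    (contDiff_realPartial (hT.c j).1 j).continuous
  have hpc : Continuous p := hT.p.1.continuous
  have hfc := f.continuous
  have hηc' := hη.continuous
  have hi1 : Integrable (fun x => η x * (2 * h ^ 2 * energyDensity b f x +
      (p x + h / 2 * ∑ j, realPartial j (c j) x) * ‖f x‖ ^ 2)) :=
    (by fun_prop : Continuous _).integrable_of_hasCompactSupport hηc.mul_right
  have hi2 : Integrable (fun x => (schwartzOp h b c p g x).re) := (schwartzOp h b c p g).integrable.re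
  have hi3 : Integrable (fun x => (p x - h / 2 * ∑ j, realPartial j (c j) x) *
      (η x * ‖f x‖ ^ 2)) :=
    (by fun_prop : Continuous _).integrable_of_hasCompactSupport hηc.mul_right.mul_left
  have h1 : ∫ x, (schwartzOp h b c p g x).re =
      ∫ x, (p x - h / 2 * ∑ j, realPartial j (c j) x) * (η x * ‖f x‖ ^ 2) := by
    have h2 := integral_schwartzOp (h := h) hT g
    simp only [hgx, ← Complex.ofReal_mul] at h2
    rw [integral_complex_ofReal] at h2
    have h3 := congrArg Complex.re h2
    rw [Complex.ofReal_re] at h3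
    rw [← h3]
    exact integral_re (schwartzOp h b c p g).integrable
  simp only [two_mul_re_conj_mul_schwartzOp_sub hT]
  rw [integral_add hi1 hi2, h1, ← integral_add hi1 hi3]
  refine integral_nonneg fun x => ?_
  have h4 : 0 ≤ energyDensity b f x := energyDensity_nonneg hb f x
  have h5 := hη0 x
  have h6 := hp x
  have h7 : η x * (2 * h ^ 2 * energyDensity b f x +
      (p x + h / 2 * ∑ j, realPartial j (c j) x) * ‖f x‖ ^ 2) +
      (p x - h / 2 * ∑ j, realPartial j (c j) x) * (η x * ‖f x‖ ^ 2) =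
      η x * (2 * h ^ 2 * energyDensity b f x + 2 * p x * ‖f x‖ ^ 2) := by ring
  change 0 ≤ _ + _
  rw [h7]
  positivity

end Localization

/-! ### Charts, measures and smooth functions -/

section Charts

variable {n : ℕ} {M : Type*} [TopologicalSpace M] [MeasurableSpace M] [BorelSpace M]
  {μ : Measure M}
  {e : OpenPartialHomeomorph M (EuclideanSpace ℝ (Fin n))}

theorem aemeasurable_chart (e : OpenPartialHomeomorph M (EuclideanSpace ℝ (Fin n)))
    (μ : Measure M) : AEMeasurable e (μ.restrict e.source) :=
  e.continuousOn.aemeasurable e.open_source.measurableSet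

theorem aemeasurable_chart_symm (e : OpenPartialHomeomorph M (EuclideanSpace ℝ (Fin n))) :
    AEMeasurable e.symm (volume.restrict e.target) :=
  e.continuousOn_symm.aemeasurable e.open_target.measurableSet

theorem map_chart_symm (hmap : Measure.map e (μ.restrict e.source) = volume.restrict e.target) :
    Measure.map e.symm (volume.restrict e.target) = μ.restrict e.source := by
  rw [← hmap, AEMeasurable.map_map_of_aemeasurable (by rw [hmap]; exact aemeasurable_chart_symm e)
    (aemeasurable_chart e μ)]
  have h1 : (e.symm ∘ e : M → M) =ᵐ[μ.restrict e.source] id := by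
    filter_upwards [ae_restrict_mem e.open_source.measurableSet] with x hx
    exact e.left_inv hx
  rw [Measure.map_congr h1, Measure.map_id]

/-- Change of variables in a chart in which the measure is Lebesgue measure. -/
theorem setIntegral_chart {F : Type*} [NormedAddCommGroup F] [NormedSpace ℝ F]
    (hmap : Measure.map e (μ.restrict e.source) = volume.restrict e.target) {g : M → F}
    (hg : AEStronglyMeasurable g (μ.restrict e.source)) :
    ∫ x in e.source, g x ∂μ = ∫ y in e.target, g (e.symm y) := by
  rw [← map_chart_symm hmap, integral_map (aemeasurable_chart_symm e)]
  rwa [map_chart_symm hmap]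

theorem aestronglyMeasurable_comp_chart_symm {F : Type*} [TopologicalSpace F]
    (hmap : Measure.map e (μ.restrict e.source) = volume.restrict e.target) {g : M → F}
    (hg : AEStronglyMeasurable g (μ.restrict e.source)) :
    AEStronglyMeasurable (fun y => g (e.symm y)) (volume.restrict e.target) := by
  rw [← map_chart_symm hmap] at hg
  exact hg.comp_aemeasurable (aemeasurable_chart_symm e)

theorem aestronglyMeasurable_comp_chart {ψ : EuclideanSpace ℝ (Fin n) → ℂ} (hψ : Continuous ψ) :
    AEStronglyMeasurable (fun x => ψ (e x)) (μ.restrict e.source) :=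
  (hψ.comp_continuousOn e.continuousOn).aestronglyMeasurable e.open_source.measurableSet

theorem memLp_indicator_comp_chart [IsFiniteMeasure μ] {ψ : EuclideanSpace ℝ (Fin n) → ℂ}
    (hψ : Continuous ψ) {C : ℝ} (hC : ∀ y, ‖ψ y‖ ≤ C) :
    MemLp (e.source.indicator fun x => ψ (e x)) 2 μ := by
  rw [memLp_indicator_iff_restrict e.open_source.measurableSet]
  exact MemLp.of_bound (aestronglyMeasurable_comp_chart hψ) C
    (Filter.Eventually.of_forall fun x => hC _)

/-- Testing against a function supported in a chart is a continuous linear functional on `L²`. -/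
theorem exists_clm_setIntegral_chart [IsFiniteMeasure μ]
    (e : OpenPartialHomeomorph M (EuclideanSpace ℝ (Fin n)))
    (ψ : 𝓢(EuclideanSpace ℝ (Fin n), ℂ)) :
    ∃ L : Lp ℂ 2 μ →L[ℂ] ℂ, ∀ w, L w = ∫ x in e.source, w x * ψ (e x) ∂μ := by
  obtain ⟨C, hC⟩ : ∃ C : ℝ, ∀ y, ‖ψ y‖ ≤ C := by
    obtain ⟨C, hC⟩ := ψ.decay 0 0
    exact ⟨C, fun y => by simpa using hC.2 y⟩
  obtain ⟨L, hL⟩ := exists_clm_integral_mul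
    (memLp_indicator_comp_chart (μ := μ) (e := e) ψ.continuous hC)
  refine ⟨L, fun w => ?_⟩
  rw [hL, ← integral_indicator e.open_source.measurableSet]
  refine integral_congr_ae (Filter.Eventually.of_forall fun x => ?_)
  simp only [indicator]
  split_ifs <;> simp

theorem integrableOn_mul_comp_chart [IsFiniteMeasure μ] (u : Lp ℂ 2 μ)
    (ψ : 𝓢(EuclideanSpace ℝ (Fin n), ℂ)) :
    IntegrableOn (fun x => u x * ψ (e x)) e.source μ := by
  obtain ⟨C, hC⟩ := ψ.decay 0 0
  exact ((Lp.memLp u).integrable (by norm_num)).integrableOn.mul_bdd (c := C)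
    (aestronglyMeasurable_comp_chart ψ.continuous)
    (Filter.Eventually.of_forall fun x => by simpa using hC.2 (e x))

end Charts

section LocalForms

variable {n : ℕ} {M : Type*} [TopologicalSpace M] [ChartedSpace (EuclideanSpace ℝ (Fin n)) M]
  {e : OpenPartialHomeomorph M (EuclideanSpace ℝ (Fin n))}

theorem contDiffOn_comp_chart_symm (he : e ∈ IsManifold.maximalAtlas (𝓡 n) ∞ M) {F : Type*}
    [NormedAddCommGroup F] [NormedSpace ℝ F] {φ : M → F}
    (hφ : ContMDiff (𝓡 n) 𝓘(ℝ, F) ∞ φ) : ContDiffOn ℝ ∞ (fun y => φ (e.symm y)) e.target :=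
  contMDiffOn_iff_contDiffOn.1
    (hφ.comp_contMDiffOn (contMDiffOn_symm_of_mem_maximalAtlas he))

/-- A smooth function on `M`, cut off in a chart, as a Schwartz function. -/
theorem exists_schwartz_chart (he : e ∈ IsManifold.maximalAtlas (𝓡 n) ∞ M)
    {θ : EuclideanSpace ℝ (Fin n) → ℝ} (hθ : ContDiff ℝ ∞ θ) (hθc : HasCompactSupport θ)
    (hθs : tsupport θ ⊆ e.target) (φ : C^∞⟮𝓡 n, M; 𝓘(ℝ, ℂ), ℂ⟯) :
    ∃ f : 𝓢(EuclideanSpace ℝ (Fin n), ℂ), ∀ y, f y = (θ y : ℂ) * φ (e.symm y) := by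
  have h1 := (contDiffOn_comp_chart_symm he φ.contMDiff).contDiff_smul_of_tsupport_subset
    e.open_target hθ hθs
  have h2 : HasCompactSupport fun y => θ y • φ (e.symm y) := hθc.smul_right
  exact ⟨h2.toSchwartzMap h1, fun y => Complex.real_smul⟩

variable [MeasurableSpace M] {μ : Measure M} {h : ℝ}
  {P : C^∞⟮𝓡 n, M; 𝓘(ℝ, ℂ), ℂ⟯ → C^∞⟮𝓡 n, M; 𝓘(ℝ, ℂ), ℂ⟯}
  {b : Fin n → Fin n → EuclideanSpace ℝ (Fin n) → ℝ}
  {c : Fin n → EuclideanSpace ℝ (Fin n) → ℝ} {p : EuclideanSpace ℝ (Fin n) → ℝ}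

theorem HasLocalForm.apply_eq_schwartzOp (hL : HasLocalForm h μ P e b c p)
    (hT : TemperateCoeffs b c p) {φ : C^∞⟮𝓡 n, M; 𝓘(ℝ, ℂ), ℂ⟯}
    {f : 𝓢(EuclideanSpace ℝ (Fin n), ℂ)} {x : M} (hx : x ∈ e.source)
    (hf : ∀ᶠ y in nhds (e x), f y = φ (e.symm y)) : P φ x = schwartzOp h b c p f (e x) := by
  rw [hL.form φ x hx, schwartzOp_apply hT]
  refine diffExpr_congr (fun _ _ => .rfl) (fun _ => .rfl) .rfl ?_
  filter_upwards [hf] with y hy using hy.symm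

/-- Near every point there is a chart in which the coefficients of the operator are the
restrictions of globally controlled ones. -/
theorem IsAdmissibleOperator.exists_controlled_chart [BorelSpace M]
    (hP : IsAdmissibleOperator h μ P) (x : M) :
    ∃ e b c p, x ∈ e.source ∧ HasLocalForm h μ P e b c p ∧ ∃ K, ControlledCoeffs K b c p := by
  obtain ⟨e, b, c, p, hx, hL⟩ := hP x
  obtain ⟨b', c', p', hadm, hK, heq⟩ := hL.admissible.exists_extension (K := {e x})
    isCompact_singleton e.open_target (singleton_subset_iff.2 (e.map_source hx))
  obtain ⟨V, hV, hVo, hxV⟩ := eventually_nhds_iff.1 (heq (e x) rfl)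
  have hs : IsOpen (e.source ∩ e ⁻¹' V) := e.isOpen_inter_preimage hVo
  have hsrc : (e.restr (e.source ∩ e ⁻¹' V)).source = e.source ∩ e ⁻¹' V := by
    rw [OpenPartialHomeomorph.restr_source, hs.interior_eq, inter_eq_right]
    exact inter_subset_left
  have htgt : (e.restr (e.source ∩ e ⁻¹' V)).target = e.target ∩ V := by
    ext y
    rw [OpenPartialHomeomorph.restr_toPartialEquiv, PartialEquiv.restr_target, hs.interior_eq]
    refine and_congr_right fun hy => ?_
    change e.symm y ∈ e.source ∧ e (e.symm y) ∈ V ↔ y ∈ V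
    rw [e.right_inv hy]
    exact and_iff_right (e.map_target hy)
  refine ⟨e.restr (e.source ∩ e ⁻¹' V), b', c', p', ?_, ⟨?_, ?_, ?_, ?_⟩, hK⟩
  · rw [hsrc]
    exact ⟨hx, hxV⟩
  · exact restr_mem_maximalAtlas _ hL.smooth_chart hs
  · rw [hsrc, htgt]
    change Measure.map e _ = _
    have h1 := Measure.restrict_map_of_aemeasurable (aemeasurable_chart e μ) hVo.measurableSet
    rw [hL.lebesgue, Measure.restrict_restrict hVo.measurableSet,
      Measure.restrict_restrict' e.open_source.measurableSet, inter_comm, inter_comm _ e.source] at h1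
    exact h1.symm
  · exact ⟨fun j k => (hadm.smooth_b j k).mono (subset_univ _),
      fun j => (hadm.smooth_c j).mono (subset_univ _), hadm.smooth_p₀.mono (subset_univ _),
      fun j k x _ => hadm.symm_b j k x (mem_univ _), fun x _ => hadm.nonneg_p₂ x (mem_univ _),
      fun x _ => hadm.nonneg_p₀ x (mem_univ _)⟩
  · intro u z hz
    rw [hsrc] at hz
    rw [hL.form u z hz.1]
    have h1 := eventually_nhds_iff.2 ⟨V, hV, hVo, hz.2⟩
    exact diffExpr_congr (fun j k => h1.mono fun y hy => hy.1 j k)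
      (fun j => h1.mono fun y hy => hy.2.1 j) (h1.mono fun y hy => hy.2.2) .rfl

/-- The operator is local. -/
theorem IsAdmissibleOperator.congr (hP : IsAdmissibleOperator h μ P)
    {φ ψ : C^∞⟮𝓡 n, M; 𝓘(ℝ, ℂ), ℂ⟯} {x : M} (hφ : ∀ᶠ y in nhds x, φ y = ψ y) :
    P φ x = P ψ x := by
  obtain ⟨e, b, c, p, hx, hL⟩ := hP x
  rw [hL.form φ x hx, hL.form ψ x hx]
  refine diffExpr_congr (fun _ _ => .rfl) (fun _ => .rfl) .rfl ?_
  have h1 : Filter.Tendsto e.symm (nhds (e x)) (nhds x) := by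
    have h2 := e.continuousAt_symm (e.map_source hx)
    rwa [ContinuousAt, e.left_inv hx] at h2
  exact h1.eventually hφ

theorem IsAdmissibleOperator.apply_linear [BorelSpace M] (hP : IsAdmissibleOperator h μ P) (a : ℂ)
    {φ ψ ζ : C^∞⟮𝓡 n, M; 𝓘(ℝ, ℂ), ℂ⟯} (hζ : ∀ x, ζ x = a * φ x + ψ x) (x : M) :
    P ζ x = a * P φ x + P ψ x := by
  obtain ⟨e, b, c, p, hx, hL, K, hK⟩ := hP.exists_controlled_chart x
  obtain ⟨θ, hθ, hθc, hθs, hθ1, hθx⟩ := exists_contDiff_cutoff (isCompact_singleton (x := e x))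
    e.open_target (singleton_subset_iff.2 (e.map_source hx))
  obtain ⟨f, hf⟩ := exists_schwartz_chart hL.smooth_chart hθ hθc hθs φ
  obtain ⟨g, hg⟩ := exists_schwartz_chart hL.smooth_chart hθ hθc hθs ψ
  have hnear := hθx (e x) rfl
  rw [hL.apply_eq_schwartzOp hK.temperate hx (φ := φ) (f := f)
      (hnear.mono fun y hy => by rw [hf, hy, Complex.ofReal_one, one_mul]),
    hL.apply_eq_schwartzOp hK.temperate hx (φ := ψ) (f := g)
      (hnear.mono fun y hy => by rw [hg, hy, Complex.ofReal_one, one_mul]),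
    hL.apply_eq_schwartzOp hK.temperate hx (φ := ζ) (f := a • f + g)
      (hnear.mono fun y hy => by
        rw [add_apply, smul_apply, hf, hg, hy, hζ, Complex.ofReal_one, one_mul, one_mul,
          smul_eq_mul]),
    map_add, map_smul, add_apply, smul_apply, smul_eq_mul]

theorem IsAdmissibleOperator.apply_zero [BorelSpace M] (hP : IsAdmissibleOperator h μ P) (x : M) :
    P 0 x = 0 := by
  have h1 := hP.apply_linear (-1) (φ := 0) (ψ := 0) (ζ := 0) (fun x => by simp) x
  rwa [neg_one_mul, neg_add_cancel] at h1

theorem IsAdmissibleOperator.apply_add [BorelSpace M] (hP : IsAdmissibleOperator h μ P)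
    (φ ψ : C^∞⟮𝓡 n, M; 𝓘(ℝ, ℂ), ℂ⟯) : P (φ + ψ) = P φ + P ψ := by
  ext x
  have h1 := hP.apply_linear 1 (φ := φ) (ψ := ψ) (ζ := φ + ψ) (fun x => by simp) x
  rw [h1, one_mul]
  rfl

theorem IsAdmissibleOperator.apply_sum [BorelSpace M]
    (hP : IsAdmissibleOperator h μ P) {ι : Type*}
    (s : Finset ι) (φ : ι → C^∞⟮𝓡 n, M; 𝓘(ℝ, ℂ), ℂ⟯) :
    P (∑ i ∈ s, φ i) = ∑ i ∈ s, P (φ i) := by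
  classical
  induction s using Finset.induction_on with
  | empty =>
    ext x
    rw [Finset.sum_empty, Finset.sum_empty]
    exact hP.apply_zero x
  | insert i s hi ih => rw [Finset.sum_insert hi, Finset.sum_insert hi, hP.apply_add, ih]

theorem IsAdmissibleOperator.isFiniteMeasure [BorelSpace M] [CompactSpace M]
    (hP : IsAdmissibleOperator h μ P) :
    IsFiniteMeasure μ := by
  have h1 : IsLocallyFiniteMeasure μ := by
    refine ⟨fun x => ?_⟩
    obtain ⟨e, b, c, p, hx, hL⟩ := hP x
    obtain ⟨r, hr, hball⟩ := Metric.isOpen_iff.1 e.open_target (e x) (e.map_source hx)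
    refine ⟨e.source ∩ e ⁻¹' Metric.ball (e x) r, (e.isOpen_inter_preimage
      Metric.isOpen_ball).mem_nhds ⟨hx, Metric.mem_ball_self hr⟩, ?_⟩
    have h2 := Measure.map_apply_of_aemeasurable (aemeasurable_chart e μ)
      (Metric.isOpen_ball (x := e x) (ε := r)).measurableSet
    rw [hL.lebesgue, Measure.restrict_apply' e.open_source.measurableSet, inter_comm] at h2
    rw [← h2]
    exact (Measure.restrict_apply_le _ _).trans_lt measure_ball_lt_top
  infer_instance

end LocalForms

/-! ### Finite controlled atlases and the kernel of the adjoint on a compact manifold -/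

section Atlas

variable {n : ℕ} {M : Type*} [TopologicalSpace M] [ChartedSpace (EuclideanSpace ℝ (Fin n)) M]
  [MeasurableSpace M] {μ : Measure M} {h : ℝ}
  {P : C^∞⟮𝓡 n, M; 𝓘(ℝ, ℂ), ℂ⟯ → C^∞⟮𝓡 n, M; 𝓘(ℝ, ℂ), ℂ⟯} {ι : Type*}

/-- A finite family of local forms of `P` with globally controlled coefficients, together with a
subordinate partition of unity `η` and cutoffs `θ` in the coordinate spaces which are equal to one
near the image of the support of `η`. -/
structure ControlledAtlas (h : ℝ) (μ : Measure M)
    (P : C^∞⟮𝓡 n, M; 𝓘(ℝ, ℂ), ℂ⟯ → C^∞⟮𝓡 n, M; 𝓘(ℝ, ℂ), ℂ⟯) (ι : Type*) [Fintype ι] where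
  chart : ι → OpenPartialHomeomorph M (EuclideanSpace ℝ (Fin n))
  b : ι → Fin n → Fin n → EuclideanSpace ℝ (Fin n) → ℝ
  c : ι → Fin n → EuclideanSpace ℝ (Fin n) → ℝ
  p : ι → EuclideanSpace ℝ (Fin n) → ℝ
  form : ∀ i, HasLocalForm h μ P (chart i) (b i) (c i) (p i)
  controlled : ∀ i, ∃ K, ControlledCoeffs K (b i) (c i) (p i)
  η : ι → M → ℝ
  smooth_η : ∀ i, ContMDiff (𝓡 n) 𝓘(ℝ, ℝ) ∞ (η i)
  nonneg_η : ∀ i x, 0 ≤ η i x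
  sum_η : ∀ x, ∑ i, η i x = 1
  tsupport_η : ∀ i, tsupport (η i) ⊆ (chart i).source
  θ : ι → EuclideanSpace ℝ (Fin n) → ℝ
  smooth_θ : ∀ i, ContDiff ℝ ∞ (θ i)
  compact_θ : ∀ i, HasCompactSupport (θ i)
  tsupport_θ : ∀ i, tsupport (θ i) ⊆ (chart i).target
  θ_mem : ∀ i y, 0 ≤ θ i y ∧ θ i y ≤ 1
  θ_eq_one : ∀ i, ∀ x ∈ tsupport (η i), ∀ᶠ y in nhds (chart i x), θ i y = 1

theorem IsAdmissibleOperator.exists_controlledAtlas [IsManifold (𝓡 n) ∞ M] [CompactSpace M]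
    [T2Space M] [BorelSpace M] (hP : IsAdmissibleOperator h μ P) :
    ∃ t : Finset M, Nonempty (ControlledAtlas h μ P t) := by
  choose e b c p hx hL hK using hP.exists_controlled_chart
  obtain ⟨t, ht⟩ := CompactSpace.elim_nhds_subcover (fun x => (e x).source)
    fun x => (e x).open_source.mem_nhds (hx x)
  obtain ⟨ρ, hρ⟩ := SmoothPartitionOfUnity.exists_isSubordinate (𝓡 n) (isClosed_univ (X := M))
    (fun x : t => (e x).source) (fun x => (e x).open_source) (by
      intro x _
      have h1 : x ∈ ⋃ x ∈ t, (e x).source := by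
        rw [ht]
        trivial
      simp only [mem_iUnion] at h1 ⊢
      obtain ⟨y, hy, hxy⟩ := h1
      exact ⟨⟨y, hy⟩, hxy⟩)
  have hcpt : ∀ i : t, IsCompact (e i '' tsupport (ρ i)) := fun i =>
    (isClosed_tsupport _).isCompact.image_of_continuousOn ((e i).continuousOn.mono (hρ i))
  choose θ h1 h2 h3 h4 h5 using fun i : t => exists_contDiff_cutoff (hcpt i) (e i).open_target
    (by
      rintro _ ⟨x, hxi, rfl⟩
      exact (e i).map_source (hρ i hxi))
  exact ⟨t, ⟨{
    chart := fun i => e i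
    b := fun i => b i
    c := fun i => c i
    p := fun i => p i
    form := fun i => hL i
    controlled := fun i => hK i
    η := fun i => ρ i
    smooth_η := fun i => (ρ i).contMDiff
    nonneg_η := fun i x => ρ.nonneg i x
    sum_η := fun x => by
      rw [← finsum_eq_sum_of_fintype]
      exact ρ.sum_eq_one (mem_univ x)
    tsupport_η := hρ
    θ := θ
    smooth_θ := h1
    compact_θ := h2
    tsupport_θ := h3
    θ_mem := h4
    θ_eq_one := fun i x hxi => h5 i _ ⟨x, hxi, rfl⟩ }⟩⟩

namespace ControlledAtlas

variable [Fintype ι] (𝒜 : ControlledAtlas h μ P ι)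

/-- The partition function `η` in coordinates, extended by zero: on the range of the chart the factor
`θ` changes nothing, and outside it removes the meaningless values of the inverse chart. -/
noncomputable def χ (i : ι) (y : EuclideanSpace ℝ (Fin n)) : ℝ :=
  𝒜.θ i y * 𝒜.η i ((𝒜.chart i).symm y)

theorem η_le_one (i : ι) (x : M) : 𝒜.η i x ≤ 1 := by
  rw [← 𝒜.sum_η x]
  exact Finset.single_le_sum (fun j _ => 𝒜.nonneg_η j x) (Finset.mem_univ i)

theorem θ_eq_one_of_ne {i : ι} {x : M} (hx : 𝒜.η i x ≠ 0) : 𝒜.θ i (𝒜.chart i x) = 1 :=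
  (𝒜.θ_eq_one i x (subset_tsupport _ hx)).self_of_nhds

theorem χ_eq {i : ι} {y : EuclideanSpace ℝ (Fin n)} (hy : y ∈ (𝒜.chart i).target) :
    𝒜.χ i y = 𝒜.η i ((𝒜.chart i).symm y) := by
  rw [χ]
  by_cases h0 : 𝒜.η i ((𝒜.chart i).symm y) = 0
  · rw [h0, mul_zero]
  · have h1 := 𝒜.θ_eq_one_of_ne h0
    rw [(𝒜.chart i).right_inv hy] at h1
    rw [h1, one_mul]

theorem smooth_χ (i : ι) : ContDiff ℝ ∞ (𝒜.χ i) := by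
  change ContDiff ℝ ∞ fun y => 𝒜.θ i y * 𝒜.η i ((𝒜.chart i).symm y)
  simpa only [smul_eq_mul] using (contDiffOn_comp_chart_symm (𝒜.form i).smooth_chart
    (𝒜.smooth_η i)).contDiff_smul_of_tsupport_subset (𝒜.chart i).open_target (𝒜.smooth_θ i)
      (𝒜.tsupport_θ i)

theorem compact_χ (i : ι) : HasCompactSupport (𝒜.χ i) :=
  (𝒜.compact_θ i).mul_right

theorem tsupport_χ (i : ι) : tsupport (𝒜.χ i) ⊆ (𝒜.chart i).target :=
  (tsupport_mul_subset_left).trans (𝒜.tsupport_θ i)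

theorem temperate_χ (i : ι) : (𝒜.χ i).HasTemperateGrowth :=
  (𝒜.compact_χ i).hasTemperateGrowth (𝒜.smooth_χ i)

theorem χ_nonneg (i : ι) (y : EuclideanSpace ℝ (Fin n)) : 0 ≤ 𝒜.χ i y :=
  mul_nonneg (𝒜.θ_mem i y).1 (𝒜.nonneg_η i _)

theorem abs_χ_le_one (i : ι) (y : EuclideanSpace ℝ (Fin n)) : |𝒜.χ i y| ≤ 1 := by
  rw [abs_of_nonneg (𝒜.χ_nonneg i y)]
  exact mul_le_one₀ (𝒜.θ_mem i y).2 (𝒜.nonneg_η i _) (𝒜.η_le_one i _)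

/-- If `u` annihilates `(P + l) ψ` for all `ψ` of compact support in the charts, then `u = 0` as
soon as `l` is large: the local estimates for the finitely many functions `η u` are summed. -/
theorem exists_forall_eq_zero [BorelSpace M] (c' : ι → Fin n → EuclideanSpace ℝ (Fin n) → ℝ)
    (hc' : ∀ i, ∃ K, ControlledCoeffs K (𝒜.b i) (c' i) (𝒜.p i)) :
    ∃ l₀ : ℝ, ∀ l, l₀ < l → ∀ u : Lp ℂ 2 μ,
      (∀ i, ∀ φ : 𝓢(EuclideanSpace ℝ (Fin n), ℂ), ∫ x in (𝒜.chart i).source,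
        u x * (schwartzOp h (𝒜.b i) (c' i) (𝒜.p i) (schwartzMul (𝒜.χ i) φ) +
          (l : ℂ) • schwartzMul (𝒜.χ i) φ) (𝒜.chart i x) ∂μ = 0) → u = 0 := by
  choose K hK using hc'
  choose K' hK'0 hK' using fun i => exists_controlledCutoff_of_hasCompactSupport (hK i).temperate
    (𝒜.smooth_χ i) (𝒜.compact_χ i) (𝒜.abs_χ_le_one i) h
  choose C hC0 hC using fun i => exists_local_estimate (h := h) (hK i) (hK'0 i)
  set D := ∑ i, C i with hD
  have hD0 : 0 ≤ D := Finset.sum_nonneg fun i _ => hC0 i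
  have hCD : ∀ i, C i ≤ D := fun i => Finset.single_le_sum (fun j _ => hC0 j) (Finset.mem_univ i)
  set N : ℝ := (Fintype.card ι : ℝ) with hN
  refine ⟨D + N * D, fun l hl u hu => ?_⟩
  have hND : 0 ≤ N * D := mul_nonneg (Nat.cast_nonneg _) hD0
  have hηm : ∀ i, Continuous (𝒜.η i) := fun i => (𝒜.smooth_η i).continuous
  have hint : ∀ i, Integrable (fun x => 𝒜.η i x ^ 2 * ‖u x‖ ^ 2) μ := fun i => by
    refine (integrable_norm_sq_Lp u).mono
      (((hηm i).pow 2).aestronglyMeasurable.mul (integrable_norm_sq_Lp u).1)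
      (Filter.Eventually.of_forall fun x => ?_)
    rw [norm_mul]
    refine mul_le_of_le_one_left (norm_nonneg _) ?_
    rw [Real.norm_of_nonneg (sq_nonneg _)]
    exact pow_le_one₀ (𝒜.nonneg_η i x) (𝒜.η_le_one i x)
  have hloc : ∀ i, (l - D) * ∫ x, 𝒜.η i x ^ 2 * ‖u x‖ ^ 2 ∂μ ≤ C i * ‖u‖ ^ 2 := by
    intro i
    have hmap := (𝒜.form i).lebesgue
    have hus : AEStronglyMeasurable u (μ.restrict (𝒜.chart i).source) :=
      (Lp.memLp u).1.restrict
    have hum := aestronglyMeasurable_comp_chart_symm hmap hus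
    -- the complex conjugate of `u` in the coordinates of the chart, extended by zero
    set g : EuclideanSpace ℝ (Fin n) → ℂ := (𝒜.chart i).target.indicator
      fun y => (starRingEnd ℂ) (u ((𝒜.chart i).symm y)) with hg
    have hgm : AEStronglyMeasurable g volume :=
      (aestronglyMeasurable_indicator_iff (𝒜.chart i).open_target.measurableSet).2
        (Complex.continuous_conj.comp_aestronglyMeasurable hum)
    have hgn : ∀ y, ‖g y‖ ^ 2 = (𝒜.chart i).target.indicator
        (fun y => ‖u ((𝒜.chart i).symm y)‖ ^ 2) y := fun y => by
      rw [hg]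
      simp only [indicator]
      split_ifs
      · rw [RCLike.norm_conj]
      · simp
    have hui : Integrable (fun y => ‖g y‖ ^ 2) := by
      simp only [hgn]
      rw [integrable_indicator_iff (𝒜.chart i).open_target.measurableSet]
      have h1 := (integrable_norm_sq_Lp u).integrableOn (s := (𝒜.chart i).source)
      rw [IntegrableOn, ← map_chart_symm hmap] at h1
      exact h1.comp_aemeasurable (aemeasurable_chart_symm _)
    have hgL : MemLp g 2 volume := (memLp_two_iff_integrable_sq_norm hgm).2 hui
    obtain ⟨U, hae⟩ : ∃ U : Lp ℂ 2 (volume : Measure (EuclideanSpace ℝ (Fin n))),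
        U =ᵐ[volume] g := ⟨hgL.toLp g, hgL.coeFn_toLp⟩
    have hnorm : ‖U‖ ^ 2 ≤ ‖u‖ ^ 2 := by
      rw [Lp_norm_sq_eq_integral, Lp_norm_sq_eq_integral u]
      calc ∫ y, ‖U y‖ ^ 2 = ∫ y, ‖g y‖ ^ 2 := integral_congr_ae (by
            filter_upwards [hae] with y hy
            rw [hy])
        _ = ∫ y in (𝒜.chart i).target, ‖u ((𝒜.chart i).symm y)‖ ^ 2 := by
            simp only [hgn]
            rw [integral_indicator (𝒜.chart i).open_target.measurableSet]
        _ = ∫ x in (𝒜.chart i).source, ‖u x‖ ^ 2 ∂μ :=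
            (setIntegral_chart hmap (g := fun x => ‖u x‖ ^ 2) (hus.norm.pow 2)).symm
        _ ≤ ∫ x, ‖u x‖ ^ 2 ∂μ := setIntegral_le_integral (integrable_norm_sq_Lp u)
            (Filter.Eventually.of_forall fun x => sq_nonneg _)
    obtain ⟨v, hv⟩ := exists_Lp_mul U (𝒜.smooth_χ i).continuous.aestronglyMeasurable
      (𝒜.abs_χ_le_one i)
    have hvn : ‖v‖ ^ 2 = ∫ x, 𝒜.η i x ^ 2 * ‖u x‖ ^ 2 ∂μ := by
      rw [Lp_norm_sq_eq_integral]
      calc ∫ y, ‖v y‖ ^ 2 = ∫ y, (𝒜.chart i).target.indicator (fun y =>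
            𝒜.η i ((𝒜.chart i).symm y) ^ 2 * ‖u ((𝒜.chart i).symm y)‖ ^ 2) y := by
            refine integral_congr_ae ?_
            filter_upwards [hv, hae] with y e1 e2
            rw [e1, e2, norm_mul, mul_pow, hgn, Complex.norm_real, Real.norm_eq_abs, sq_abs]
            simp only [indicator]
            split_ifs with hy
            · rw [𝒜.χ_eq hy]
            · rw [mul_zero]
        _ = ∫ x in (𝒜.chart i).source, 𝒜.η i x ^ 2 * ‖u x‖ ^ 2 ∂μ := by
            rw [integral_indicator (𝒜.chart i).open_target.measurableSet]
            exact (setIntegral_chart hmap (g := fun x => 𝒜.η i x ^ 2 * ‖u x‖ ^ 2)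
              (hint i).1.restrict).symm
        _ = ∫ x, 𝒜.η i x ^ 2 * ‖u x‖ ^ 2 ∂μ := by
            refine setIntegral_eq_integral_of_forall_compl_eq_zero fun x hx => ?_
            rw [image_eq_zero_of_notMem_tsupport fun h => hx (𝒜.tsupport_η i h)]
            simp
    have h1 := hC i l (by linarith [hCD i]) (𝒜.χ i) (hK' i) U v hv fun φ => by
      have h2 := hu i φ
      rw [setIntegral_chart hmap (g := fun x => u x * _) (hus.mul (aestronglyMeasurable_comp_chart
        (SchwartzMap.continuous _))), ← integral_indicator
          (𝒜.chart i).open_target.measurableSet] at h2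
      rw [inner_eq_integral_conj_mul, ← h2]
      refine integral_congr_ae ?_
      filter_upwards [hae, coeFn_toLpCLM (schwartzOp h (𝒜.b i) (c' i) (𝒜.p i)
        (schwartzMul (𝒜.χ i) φ) + (l : ℂ) • schwartzMul (𝒜.χ i) φ)] with y e1 e2
      rw [e1, e2, hg]
      simp only [indicator]
      split_ifs with hy
      · rw [Complex.conj_conj, (𝒜.chart i).right_inv hy]
      · rw [map_zero, zero_mul]
    rw [hvn] at h1
    have h3 : 0 ≤ ∫ x, 𝒜.η i x ^ 2 * ‖u x‖ ^ 2 ∂μ :=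
      integral_nonneg fun x => mul_nonneg (sq_nonneg _) (sq_nonneg _)
    calc (l - D) * ∫ x, 𝒜.η i x ^ 2 * ‖u x‖ ^ 2 ∂μ
        ≤ (l - C i) * ∫ x, 𝒜.η i x ^ 2 * ‖u x‖ ^ 2 ∂μ :=
          mul_le_mul_of_nonneg_right (by linarith [hCD i]) h3
      _ ≤ C i * ‖U‖ ^ 2 := h1
      _ ≤ C i * ‖u‖ ^ 2 := mul_le_mul_of_nonneg_left hnorm (hC0 i)
  have hsum : ‖u‖ ^ 2 ≤ N * ∑ i, ∫ x, 𝒜.η i x ^ 2 * ‖u x‖ ^ 2 ∂μ := by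
    rw [Lp_norm_sq_eq_integral, ← integral_finsetSum _ fun i _ => hint i, ← integral_const_mul]
    refine integral_mono (integrable_norm_sq_Lp u)
      ((integrable_finsetSum _ fun i _ => hint i).const_mul _) fun x => ?_
    have h1 := sq_sum_le_card_mul_sum_sq (s := (Finset.univ : Finset ι)) (f := fun i => 𝒜.η i x)
    rw [𝒜.sum_η, one_pow, Finset.card_univ] at h1
    simp only [← Finset.sum_mul, ← mul_assoc]
    exact le_mul_of_one_le_left (sq_nonneg _) h1
  have hfin : (l - D) * ‖u‖ ^ 2 ≤ N * D * ‖u‖ ^ 2 := by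
    calc (l - D) * ‖u‖ ^ 2 ≤ (l - D) * (N * ∑ i, ∫ x, 𝒜.η i x ^ 2 * ‖u x‖ ^ 2 ∂μ) :=
          mul_le_mul_of_nonneg_left hsum (by linarith)
      _ = N * ∑ i, (l - D) * ∫ x, 𝒜.η i x ^ 2 * ‖u x‖ ^ 2 ∂μ := by
          rw [← Finset.mul_sum]
          ring
      _ ≤ N * ∑ i, C i * ‖u‖ ^ 2 := by
          exact mul_le_mul_of_nonneg_left (Finset.sum_le_sum fun i _ => hloc i)
            (Nat.cast_nonneg _)
      _ = N * D * ‖u‖ ^ 2 := by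
          rw [← Finset.sum_mul]
          ring
  have h0 : ‖u‖ ^ 2 ≤ 0 := by
    by_contra hlt
    have : (l - D - N * D) * ‖u‖ ^ 2 > 0 := mul_pos (by linarith) (not_le.1 hlt)
    linarith
  have h1 : ‖u‖ = 0 := by nlinarith [norm_nonneg u]
  exact norm_eq_zero.1 h1

end ControlledAtlas

end Atlas

/-! ### Accretivity on a compact manifold -/

section ManifoldAccretive

variable {n : ℕ} {M : Type*} [TopologicalSpace M] [ChartedSpace (EuclideanSpace ℝ (Fin n)) M]
  [MeasurableSpace M] {μ : Measure M} {h : ℝ}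
  {P : C^∞⟮𝓡 n, M; 𝓘(ℝ, ℂ), ℂ⟯ → C^∞⟮𝓡 n, M; 𝓘(ℝ, ℂ), ℂ⟯} {ι : Type*} [Fintype ι]

/-- The function `|φ|²` on `M`, as a complex function. -/
noncomputable def normSqMap (φ : C^∞⟮𝓡 n, M; 𝓘(ℝ, ℂ), ℂ⟯) : C^∞⟮𝓡 n, M; 𝓘(ℝ, ℂ), ℂ⟯ :=
  ⟨fun x => (starRingEnd ℂ) (φ x) * φ x, by
    have h1 : ContDiff ℝ ∞ fun z : ℂ => (starRingEnd ℂ) z * z :=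
      Complex.conjCLE.contDiff.mul contDiff_id
    exact h1.contMDiff.comp φ.contMDiff⟩

namespace ControlledAtlas

variable (𝒜 : ControlledAtlas h μ P ι)

/-- Multiplication by a member of the partition of unity. -/
noncomputable def smulη (i : ι) (φ : C^∞⟮𝓡 n, M; 𝓘(ℝ, ℂ), ℂ⟯) : C^∞⟮𝓡 n, M; 𝓘(ℝ, ℂ), ℂ⟯ :=
  ⟨fun x => 𝒜.η i x • φ x, (𝒜.smooth_η i).smul φ.contMDiff⟩

theorem smulη_apply (i : ι) (φ : C^∞⟮𝓡 n, M; 𝓘(ℝ, ℂ), ℂ⟯) (x : M) :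
    𝒜.smulη i φ x = (𝒜.η i x : ℂ) * φ x :=
  Complex.real_smul

theorem sum_apply_smulη [BorelSpace M] (hP : IsAdmissibleOperator h μ P)
    (φ : C^∞⟮𝓡 n, M; 𝓘(ℝ, ℂ), ℂ⟯) (x : M) :
    ∑ i, P (𝒜.smulη i φ) x = P φ x := by
  have hcoe : ∀ (f : ι → C^∞⟮𝓡 n, M; 𝓘(ℝ, ℂ), ℂ⟯) (y : M), (∑ i, f i) y = ∑ i, f i y := by
    intro f y
    have h1 := congrFun (map_sum (ContMDiffMap.coeFnAddMonoidHom (I := 𝓡 n) (N := M)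
      (I' := 𝓘(ℝ, ℂ)) (n := ∞) (G := ℂ)) f Finset.univ) y
    rw [Finset.sum_apply] at h1
    exact h1
  have h1 : ∑ i, 𝒜.smulη i φ = φ := by
    ext y
    rw [hcoe]
    simp only [smulη_apply]
    rw [← Finset.sum_mul, ← Complex.ofReal_sum, 𝒜.sum_η, Complex.ofReal_one, one_mul]
  rw [← hcoe, ← hP.apply_sum, h1]

/-- The localized form of accretivity, transported to `M`. -/
theorem integral_localized_nonneg [BorelSpace M] (hP : IsAdmissibleOperator h μ P) (i : ι)
    (φ : C^∞⟮𝓡 n, M; 𝓘(ℝ, ℂ), ℂ⟯) :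
    0 ≤ ∫ x, (𝒜.η i x * (2 * ((starRingEnd ℂ) (φ x) * P φ x).re - (P (normSqMap φ) x).re) +
      (P (𝒜.smulη i (normSqMap φ)) x).re) ∂μ := by
  obtain ⟨K, hK⟩ := 𝒜.controlled i
  have hT := hK.temperate
  obtain ⟨f, hf⟩ := exists_schwartz_chart (𝒜.form i).smooth_chart (𝒜.smooth_θ i) (𝒜.compact_θ i)
    (𝒜.tsupport_θ i) φ
  have h0 := integral_localized_accretivity_nonneg (h := h) hT hK.form_nonneg hK.p_nonneg
    (𝒜.smooth_χ i) (𝒜.compact_χ i) (𝒜.χ_nonneg i) f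
  refine h0.trans_eq ?_
  have hηc : Continuous (𝒜.η i) := (𝒜.smooth_η i).continuous
  have hφc : Continuous φ := φ.contMDiff.continuous
  have hPc : ∀ ψ : C^∞⟮𝓡 n, M; 𝓘(ℝ, ℂ), ℂ⟯, Continuous (P ψ) :=
    fun ψ => (P ψ).contMDiff.continuous
  have hc1 := hPc φ
  have hc2 := hPc (normSqMap φ)
  have hc3 := hPc (𝒜.smulη i (normSqMap φ))
  have hcont : Continuous fun x => 𝒜.η i x * (2 * ((starRingEnd ℂ) (φ x) * P φ x).re -
      (P (normSqMap φ) x).re) + (P (𝒜.smulη i (normSqMap φ)) x).re := by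
    fun_prop
  rw [← setIntegral_eq_integral_of_forall_compl_eq_zero (s := (𝒜.chart i).source),
    setIntegral_chart (𝒜.form i).lebesgue
      (g := fun x => 𝒜.η i x * (2 * ((starRingEnd ℂ) (φ x) * P φ x).re -
        (P (normSqMap φ) x).re) + (P (𝒜.smulη i (normSqMap φ)) x).re)
      hcont.measurable.aestronglyMeasurable,
    ← setIntegral_eq_integral_of_forall_compl_eq_zero (s := (𝒜.chart i).target)]
  · refine setIntegral_congr_fun (𝒜.chart i).open_target.measurableSet fun y hy => ?_
    set x := (𝒜.chart i).symm y with hx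
    have hxs : x ∈ (𝒜.chart i).source := (𝒜.chart i).map_target hy
    have hxy : 𝒜.chart i x = y := (𝒜.chart i).right_inv hy
    have e3 : P (𝒜.smulη i (normSqMap φ)) x = schwartzOp h (𝒜.b i) (𝒜.c i) (𝒜.p i)
        (schwartzMul (𝒜.χ i) (schwartzNormSq f)) y := by
      rw [← hxy]
      refine (𝒜.form i).apply_eq_schwartzOp hT hxs ?_
      rw [hxy]
      filter_upwards [(𝒜.chart i).open_target.mem_nhds hy] with z hz
      rw [schwartzMul_apply (𝒜.temperate_χ i), schwartzNormSq_apply, hf, 𝒜.χ_eq hz, smulη_apply]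
      by_cases h1 : 𝒜.η i ((𝒜.chart i).symm z) = 0
      · rw [h1, Complex.ofReal_zero, zero_mul, zero_mul]
      · have h2 := 𝒜.θ_eq_one_of_ne h1
        rw [(𝒜.chart i).right_inv hz] at h2
        rw [h2, Complex.ofReal_one, one_mul]
        rfl
    rw [e3, 𝒜.χ_eq hy, ← hx]
    by_cases h1 : 𝒜.η i x = 0
    · rw [h1, zero_mul, zero_mul]
    · have hnear := 𝒜.θ_eq_one i x (subset_tsupport _ h1)
      have h2 := 𝒜.θ_eq_one_of_ne h1
      rw [hxy] at h2
      have e1 : P φ x = schwartzOp h (𝒜.b i) (𝒜.c i) (𝒜.p i) f y := by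
        rw [← hxy]
        refine (𝒜.form i).apply_eq_schwartzOp hT hxs ?_
        filter_upwards [hnear] with z hz
        rw [hf, hz, Complex.ofReal_one, one_mul]
      have e2 : P (normSqMap φ) x =
          schwartzOp h (𝒜.b i) (𝒜.c i) (𝒜.p i) (schwartzNormSq f) y := by
        rw [← hxy]
        refine (𝒜.form i).apply_eq_schwartzOp hT hxs ?_
        filter_upwards [hnear] with z hz
        rw [schwartzNormSq_apply, hf, hz, Complex.ofReal_one, one_mul]
        rfl
      rw [e1, e2, hf, h2, Complex.ofReal_one, one_mul]
  · intro y hy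
    have h1 : 𝒜.χ i =ᶠ[nhds y] 0 := notMem_tsupport_iff_eventuallyEq.1 fun h1 =>
      hy (𝒜.tsupport_χ i h1)
    have h2 : schwartzOp h (𝒜.b i) (𝒜.c i) (𝒜.p i) (schwartzMul (𝒜.χ i) (schwartzNormSq f)) y =
        schwartzOp h (𝒜.b i) (𝒜.c i) (𝒜.p i) 0 y := by
      rw [schwartzOp_apply hT, schwartzOp_apply hT]
      refine diffExpr_congr (fun _ _ => .rfl) (fun _ => .rfl) .rfl ?_
      filter_upwards [h1] with z hz
      rw [schwartzMul_apply (𝒜.temperate_χ i), hz, Pi.zero_apply, Complex.ofReal_zero, zero_mul]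
      rfl
    rw [h2, map_zero, h1.eq_of_nhds]
    simp
  · intro x hx
    have h1 : 𝒜.η i =ᶠ[nhds x] 0 := notMem_tsupport_iff_eventuallyEq.1 fun h1 =>
      hx (𝒜.tsupport_η i h1)
    have h2 : P (𝒜.smulη i (normSqMap φ)) x = P 0 x := by
      refine hP.congr ?_
      filter_upwards [h1] with z hz
      rw [smulη_apply, hz, Pi.zero_apply, Complex.ofReal_zero, zero_mul]
      rfl
    rw [h2, hP.apply_zero, h1.eq_of_nhds]
    simp

theorem re_integral_conj_mul_nonneg (𝒜 : ControlledAtlas h μ P ι) [BorelSpace M] [CompactSpace M]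
    (hP : IsAdmissibleOperator h μ P) (φ : C^∞⟮𝓡 n, M; 𝓘(ℝ, ℂ), ℂ⟯) :
    0 ≤ ∫ x, ((starRingEnd ℂ) (φ x) * P φ x).re ∂μ := by
  have := hP.isFiniteMeasure
  have hηc : ∀ i, Continuous (𝒜.η i) := fun i => (𝒜.smooth_η i).continuous
  have hφc : Continuous φ := φ.contMDiff.continuous
  have hPc : ∀ ψ : C^∞⟮𝓡 n, M; 𝓘(ℝ, ℂ), ℂ⟯, Continuous (P ψ) :=
    fun ψ => (P ψ).contMDiff.continuous
  have hc1 := hPc φ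
  have hc2 := hPc (normSqMap φ)
  have hsum : ∀ x, 2 * ((starRingEnd ℂ) (φ x) * P φ x).re =
      ∑ i, (𝒜.η i x * (2 * ((starRingEnd ℂ) (φ x) * P φ x).re - (P (normSqMap φ) x).re) +
        (P (𝒜.smulη i (normSqMap φ)) x).re) := fun x => by
    rw [Finset.sum_add_distrib, ← Finset.sum_mul, 𝒜.sum_η, ← Complex.re_sum,
      𝒜.sum_apply_smulη hP]
    ring
  have h1 : 0 ≤ ∫ x, 2 * ((starRingEnd ℂ) (φ x) * P φ x).re ∂μ := by
    rw [integral_congr_ae (Filter.Eventually.of_forall hsum)]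
    rw [integral_finsetSum]
    · exact Finset.sum_nonneg fun i _ => 𝒜.integral_localized_nonneg hP i φ
    · intro i _
      have hc3 := hPc (𝒜.smulη i (normSqMap φ))
      have hc := hηc i
      exact (by fun_prop : Continuous _).integrable_of_hasCompactSupport
        (HasCompactSupport.of_compactSpace _)
  rw [integral_const_mul] at h1
  linarith

end ControlledAtlas

end ManifoldAccretive

/-! ### Graphs on a compact manifold -/

section ManifoldGraph

variable {n : ℕ} {h : ℝ} {b : Fin n → Fin n → EuclideanSpace ℝ (Fin n) → ℝ}
  {c : Fin n → EuclideanSpace ℝ (Fin n) → ℝ} {p : EuclideanSpace ℝ (Fin n) → ℝ}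

theorem diffExpr_eq_zero_of_eventuallyEq {u : EuclideanSpace ℝ (Fin n) → ℂ}
    {x : EuclideanSpace ℝ (Fin n)} (hu : u =ᶠ[nhds x] 0) : diffExpr h b c p u x = 0 := by
  have hz : ∀ j (y : EuclideanSpace ℝ (Fin n)),
      partialDeriv j (fun _ : EuclideanSpace ℝ (Fin n) => (0 : ℂ)) y = 0 := fun j y => by
    rw [partialDeriv, fderiv_const_apply]
    rfl
  have hu' : u =ᶠ[nhds x] fun _ => 0 := hu
  rw [diffExpr_congr (fun _ _ => .rfl) (fun _ => .rfl) .rfl hu']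
  simp [diffExpr, semiD, hz]

/-- For a fixed test function the coefficients of a local form may be replaced by globally
controlled ones, both in the operator and in its transpose. -/
theorem AdmissibleCoeffsOn.exists_global {Ω : Set (EuclideanSpace ℝ (Fin n))}
    (hadm : AdmissibleCoeffsOn Ω b c p) (hΩ : IsOpen Ω) (ψ : 𝓢(EuclideanSpace ℝ (Fin n), ℂ))
    (hψ : HasCompactSupport ψ) (hψs : tsupport ψ ⊆ Ω) :
    ∃ b' c' p', (∃ K, ControlledCoeffs K b' c' p') ∧
      (∀ u, ∀ y ∈ tsupport ψ, diffExpr h b c p u y = diffExpr h b' c' p' u y) ∧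
      ∀ y, diffExprTranspose h b c p ψ y = schwartzOp h b' (fun j x => -c' j x) p' ψ y := by
  obtain ⟨b', c', p', -, ⟨K, hK⟩, heq⟩ := hadm.exists_extension hψ hΩ hψs
  refine ⟨b', c', p', ⟨K, hK⟩, fun u y hy => ?_, fun y => ?_⟩
  · have h1 := heq y hy
    exact diffExpr_congr (fun j k => h1.mono fun y hy => hy.1 j k)
      (fun j => h1.mono fun y hy => hy.2.1 j) (h1.mono fun y hy => hy.2.2) .rfl
  · rw [schwartzOp_apply hK.temperate.neg, diffExprTranspose]
    by_cases hy : y ∈ tsupport ψ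
    · have h1 := heq y hy
      exact diffExpr_congr (fun j k => h1.mono fun y hy => hy.1 j k)
        (fun j => h1.mono fun y hy => congrArg Neg.neg (hy.2.1 j))
        (h1.mono fun y hy => hy.2.2) .rfl
    · have h1 := notMem_tsupport_iff_eventuallyEq.1 hy
      rw [diffExpr_eq_zero_of_eventuallyEq h1, diffExpr_eq_zero_of_eventuallyEq h1]

variable {M : Type*} [TopologicalSpace M] [ChartedSpace (EuclideanSpace ℝ (Fin n)) M]
  [MeasurableSpace M] {μ : Measure M}
  {P : C^∞⟮𝓡 n, M; 𝓘(ℝ, ℂ), ℂ⟯ → C^∞⟮𝓡 n, M; 𝓘(ℝ, ℂ), ℂ⟯}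
  {e : OpenPartialHomeomorph M (EuclideanSpace ℝ (Fin n))}

/-- A Schwartz function multiplied by a member of the partition of unity, as a function on `M`. -/
noncomputable def ControlledAtlas.pullback {ι : Type*} [Fintype ι] (𝒜 : ControlledAtlas h μ P ι)
    (i : ι) (φ : 𝓢(EuclideanSpace ℝ (Fin n), ℂ)) : C^∞⟮𝓡 n, M; 𝓘(ℝ, ℂ), ℂ⟯ :=
  ⟨fun x => 𝒜.η i x • φ (𝒜.chart i x), contMDiff_of_tsupport fun x hx => by
    have h1 : x ∈ (𝒜.chart i).source := 𝒜.tsupport_η i (tsupport_smul_subset_left _ _ hx)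
    exact ((𝒜.smooth_η i) x).smul (((φ.smooth ⊤).contMDiff.contMDiffAt).comp x
      (contMDiffAt_of_mem_maximalAtlas (𝒜.form i).smooth_chart h1))⟩

theorem ControlledAtlas.pullback_apply {ι : Type*} [Fintype ι] (𝒜 : ControlledAtlas h μ P ι)
    (i : ι) (φ : 𝓢(EuclideanSpace ℝ (Fin n), ℂ)) (x : M) :
    𝒜.pullback i φ x = (𝒜.η i x : ℂ) * φ (𝒜.chart i x) :=
  Complex.real_smul

variable [BorelSpace M]

/-- Integration by parts in a chart. -/
theorem HasLocalForm.setIntegral_mul (hL : HasLocalForm h μ P e b c p)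
    (φ : C^∞⟮𝓡 n, M; 𝓘(ℝ, ℂ), ℂ⟯) (ψ : 𝓢(EuclideanSpace ℝ (Fin n), ℂ))
    (hψ : HasCompactSupport ψ) (hψs : tsupport ψ ⊆ e.target) :
    ∫ x in e.source, P φ x * ψ (e x) ∂μ =
      ∫ x in e.source, φ x * diffExprTranspose h b c p ψ (e x) ∂μ := by
  -- transfer to `ℝⁿ`, where both functions and the coefficients have global replacements
  obtain ⟨b', c', p', ⟨K, hK⟩, h1, h2⟩ :=
    hL.admissible.exists_global (h := h) e.open_target ψ hψ hψs
  have hT := hK.temperate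
  obtain ⟨θ, hθ, hθc, hθs, -, hθ1⟩ := exists_contDiff_cutoff hψ e.open_target hψs
  obtain ⟨f, hf⟩ := exists_schwartz_chart hL.smooth_chart hθ hθc hθs φ
  have hφm := φ.contMDiff.continuous.measurable.aestronglyMeasurable (μ := μ.restrict e.source)
  have hPm := (P φ).contMDiff.continuous.measurable.aestronglyMeasurable
    (μ := μ.restrict e.source)
  simp only [h2]
  have hz : ∀ y ∉ e.target, ψ y = 0 := fun y hy => image_eq_zero_of_notMem_tsupport fun h3 =>
    hy (hψs h3)
  have hz' : ∀ y ∉ tsupport ψ, schwartzOp h b' (fun j x => -c' j x) p' ψ y = 0 := fun y hy => by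
    rw [schwartzOp_apply hT.neg]
    exact diffExpr_eq_zero_of_eventuallyEq (notMem_tsupport_iff_eventuallyEq.1 hy)
  rw [setIntegral_chart hL.lebesgue (g := fun x => P φ x * ψ (e x))
      (hPm.mul (aestronglyMeasurable_comp_chart ψ.continuous)),
    setIntegral_chart hL.lebesgue (g := fun x => φ x * _)
      (hφm.mul (aestronglyMeasurable_comp_chart (SchwartzMap.continuous _)))]
  calc ∫ y in e.target, P φ (e.symm y) * ψ (e (e.symm y))
      = ∫ y in e.target, schwartzOp h b' c' p' f y * ψ y := by
        refine setIntegral_congr_fun e.open_target.measurableSet fun y hy => ?_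
        simp only [e.right_inv hy]
        by_cases hy' : y ∈ tsupport ψ
        · rw [hL.form φ _ (e.map_target hy), e.right_inv hy, h1 _ y hy', schwartzOp_apply hT]
          congr 1
          refine diffExpr_congr (fun _ _ => .rfl) (fun _ => .rfl) .rfl ?_
          filter_upwards [hθ1 y hy'] with z hz
          rw [hf, hz, Complex.ofReal_one, one_mul]
        · rw [image_eq_zero_of_notMem_tsupport hy', mul_zero, mul_zero]
    _ = ∫ y, schwartzOp h b' c' p' f y * ψ y :=
        setIntegral_eq_integral_of_forall_compl_eq_zero fun y hy => by rw [hz y hy, mul_zero]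
    _ = ∫ y, f y * schwartzOp h b' (fun j x => -c' j x) p' ψ y :=
        integral_schwartzOp_mul hT hK.symm f ψ
    _ = ∫ y in e.target, f y * schwartzOp h b' (fun j x => -c' j x) p' ψ y :=
        (setIntegral_eq_integral_of_forall_compl_eq_zero fun y hy => by
          rw [hz' y fun h3 => hy (hψs h3), mul_zero]).symm
    _ = _ := by
        refine setIntegral_congr_fun e.open_target.measurableSet fun y hy => ?_
        simp only [e.right_inv hy]
        by_cases hy' : y ∈ tsupport ψ
        · rw [hf, (hθ1 y hy').self_of_nhds, Complex.ofReal_one, one_mul]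
        · rw [hz' y hy', mul_zero, mul_zero]

theorem memLp_contMDiffMap [CompactSpace M] [IsFiniteMeasure μ]
    (φ : C^∞⟮𝓡 n, M; 𝓘(ℝ, ℂ), ℂ⟯) : MemLp φ 2 μ := by
  have h1 : Continuous φ := φ.contMDiff.continuous
  obtain ⟨C, hC⟩ := h1.bounded_above_of_compact_support (HasCompactSupport.of_compactSpace _)
  exact MemLp.of_bound h1.measurable.aestronglyMeasurable C (Filter.Eventually.of_forall hC)

/-- The graph of `P` on `C^∞(M)` as a subspace of `L² × L²`. -/
noncomputable def IsAdmissibleOperator.graph (hP : IsAdmissibleOperator h μ P) :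
    Submodule ℂ (Lp ℂ 2 μ × Lp ℂ 2 μ) where
  carrier := manifoldGraph μ P
  add_mem' := by
    rintro w w' ⟨φ, h1, h2⟩ ⟨φ', h1', h2'⟩
    refine ⟨φ + φ', ?_, ?_⟩
    · filter_upwards [h1, h1', Lp.coeFn_add w.1 w'.1] with x e1 e2 e3
      rw [Prod.fst_add, e3, Pi.add_apply, e1, e2]
      rfl
    · rw [hP.apply_add]
      filter_upwards [h2, h2', Lp.coeFn_add w.2 w'.2] with x e1 e2 e3
      rw [Prod.snd_add, e3, Pi.add_apply, e1, e2]
      rfl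
  zero_mem' := by
    refine ⟨0, ?_, ?_⟩
    · filter_upwards [Lp.coeFn_zero ℂ 2 μ] with x e1
      rw [Prod.fst_zero, e1]
      rfl
    · filter_upwards [Lp.coeFn_zero ℂ 2 μ] with x e1
      rw [Prod.snd_zero, e1, hP.apply_zero]
      rfl
  smul_mem' := by
    rintro a w ⟨φ, h1, h2⟩
    let ψ : C^∞⟮𝓡 n, M; 𝓘(ℝ, ℂ), ℂ⟯ := ⟨fun x => a * φ x,
      (contDiff_const.mul contDiff_id : ContDiff ℝ ∞ fun z : ℂ => a * z).contMDiff.comp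
        φ.contMDiff⟩
    refine ⟨ψ, ?_, ?_⟩
    · filter_upwards [h1, Lp.coeFn_smul a w.1] with x e1 e2
      rw [Prod.smul_fst, e2, Pi.smul_apply, e1]
      rfl
    · filter_upwards [h2, Lp.coeFn_smul a w.2] with x e1 e2
      rw [Prod.smul_snd, e2, Pi.smul_apply, e1, hP.apply_linear a (φ := φ) (ψ := 0) (ζ := ψ)
        (fun x => (add_zero _).symm), hP.apply_zero, add_zero]
      rfl

theorem IsAdmissibleOperator.toLp_mem_graph [CompactSpace M] [IsFiniteMeasure μ]
    (hP : IsAdmissibleOperator h μ P) (φ : C^∞⟮𝓡 n, M; 𝓘(ℝ, ℂ), ℂ⟯) :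
    ((memLp_contMDiffMap φ).toLp φ, (memLp_contMDiffMap (P φ)).toLp (P φ)) ∈ hP.graph :=
  ⟨φ, (memLp_contMDiffMap φ).coeFn_toLp, (memLp_contMDiffMap (P φ)).coeFn_toLp⟩

/-- Already real smooth functions separate the elements of `L²`. -/
theorem IsAdmissibleOperator.dense_domain [IsManifold (𝓡 n) ∞ M] [CompactSpace M] [T2Space M]
    (hP : IsAdmissibleOperator h μ P) : Dense (Prod.fst '' (SetLike.coe hP.graph)) := by
  have := hP.isFiniteMeasure
  set S : Submodule ℂ (Lp ℂ 2 μ) := hP.graph.map (LinearMap.fst ℂ _ _) with hS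
  have h1 : Sᗮ = ⊥ := by
    rw [Submodule.eq_bot_iff]
    intro u hu
    rw [Submodule.mem_orthogonal] at hu
    rw [Lp.eq_zero_iff_ae_eq_zero]
    refine ae_eq_zero_of_integral_contMDiff_smul_eq_zero (𝓡 n)
      ((Lp.memLp u).locallyIntegrable (by norm_num)) fun g hg _ => ?_
    let φ : C^∞⟮𝓡 n, M; 𝓘(ℝ, ℂ), ℂ⟯ :=
      ⟨fun x => (g x : ℂ), Complex.ofRealCLM.contDiff.contMDiff.comp hg⟩
    have h2 := hu _ ⟨_, hP.toLp_mem_graph φ, rfl⟩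
    rw [LinearMap.fst_apply, inner_eq_integral_conj_mul] at h2
    rw [← h2]
    refine integral_congr_ae ?_
    filter_upwards [(memLp_contMDiffMap (μ := μ) φ).coeFn_toLp] with x hx
    rw [hx, Complex.real_smul]
    congr 1
    exact (Complex.conj_ofReal _).symm
  have h2 : S.topologicalClosure = ⊤ := (Submodule.topologicalClosure_eq_top_iff).2 h1
  have h3 : Dense (S : Set (Lp ℂ 2 μ)) := Submodule.dense_iff_topologicalClosure_eq_top.2 h2
  exact h3

/-- A function orthogonal to the range of `P + l` annihilates `(P + l) ψ` for all test functions in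
the charts. -/
theorem ControlledAtlas.setIntegral_star_eq_zero [CompactSpace M] [IsFiniteMeasure μ] {ι : Type*}
    [Fintype ι] (𝒜 : ControlledAtlas h μ P ι) (hP : IsAdmissibleOperator h μ P) {l : ℝ}
    {u : Lp ℂ 2 μ} (hu : ∀ w ∈ hP.graph, inner ℂ u (w.2 + (l : ℂ) • w.1) = 0) (i : ι)
    (φ : 𝓢(EuclideanSpace ℝ (Fin n), ℂ)) : ∫ x in (𝒜.chart i).source,
      (star u) x * (schwartzOp h (𝒜.b i) (𝒜.c i) (𝒜.p i) (schwartzMul (𝒜.χ i) φ) +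
        (l : ℂ) • schwartzMul (𝒜.χ i) φ) (𝒜.chart i x) ∂μ = 0 := by
  obtain ⟨K, hK⟩ := 𝒜.controlled i
  set w := 𝒜.pullback i φ with hw
  have hloc : ∀ x ∈ (𝒜.chart i).source, P w x + l * w x =
      (schwartzOp h (𝒜.b i) (𝒜.c i) (𝒜.p i) (schwartzMul (𝒜.χ i) φ) +
        (l : ℂ) • schwartzMul (𝒜.χ i) φ) (𝒜.chart i x) := by
    intro x hx
    have h1 : ∀ y ∈ (𝒜.chart i).target, schwartzMul (𝒜.χ i) φ y = w ((𝒜.chart i).symm y) :=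
      fun y hy => by
        rw [schwartzMul_apply (𝒜.temperate_χ i), 𝒜.χ_eq hy, hw, 𝒜.pullback_apply,
          (𝒜.chart i).right_inv hy]
    have h2 := (𝒜.chart i).map_source hx
    rw [add_apply, smul_apply, smul_eq_mul, h1 _ h2, (𝒜.chart i).left_inv hx,
      (𝒜.form i).apply_eq_schwartzOp hK.temperate hx
        (Filter.eventually_of_mem ((𝒜.chart i).open_target.mem_nhds h2) h1)]
  have hout : ∀ x ∉ (𝒜.chart i).source, P w x + l * w x = 0 := by
    intro x hx
    have h1 : 𝒜.η i =ᶠ[nhds x] 0 := notMem_tsupport_iff_eventuallyEq.1 fun h1 =>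
      hx (𝒜.tsupport_η i h1)
    have h2 : ∀ᶠ z in nhds x, w z = (0 : C^∞⟮𝓡 n, M; 𝓘(ℝ, ℂ), ℂ⟯) z := by
      filter_upwards [h1] with z hz
      rw [hw, 𝒜.pullback_apply, hz, Pi.zero_apply, Complex.ofReal_zero, zero_mul]
      rfl
    rw [hP.congr h2, hP.apply_zero, h2.self_of_nhds]
    exact (zero_add _).trans (mul_zero _)
  have h3 := hu _ (hP.toLp_mem_graph w)
  rw [inner_eq_integral_conj_mul] at h3
  rw [← h3]
  calc _ = ∫ x in (𝒜.chart i).source, (star u) x * (P w x + l * w x) ∂μ :=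
        setIntegral_congr_fun (𝒜.chart i).open_source.measurableSet fun x hx => by
          simp only [hloc x hx]
    _ = ∫ x, (star u) x * (P w x + l * w x) ∂μ :=
        setIntegral_eq_integral_of_forall_compl_eq_zero fun x hx => by
          rw [hout x hx, mul_zero]
    _ = _ := by
        refine integral_congr_ae ?_
        filter_upwards [Lp.coeFn_star u, (memLp_contMDiffMap (μ := μ) w).coeFn_toLp,
          (memLp_contMDiffMap (μ := μ) (P w)).coeFn_toLp,
          Lp.coeFn_add ((memLp_contMDiffMap (μ := μ) (P w)).toLp (P w))
            ((l : ℂ) • (memLp_contMDiffMap (μ := μ) w).toLp w),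
          Lp.coeFn_smul (l : ℂ) ((memLp_contMDiffMap (μ := μ) w).toLp w)] with x e1 e2 e3 e4 e5
        rw [e4, Pi.add_apply, e5, Pi.smul_apply, e2, e3, e1]
        rfl

theorem manifold_graph_closure [IsManifold (𝓡 n) ∞ M] [CompactSpace M] [T2Space M]
    (hP : IsAdmissibleOperator h μ P) :
    ∃ A : Lp ℂ 2 μ →ₗ.[ℂ] Lp ℂ 2 μ,
      (A.graph : Set (_ × _)) = closure (manifoldGraph μ P) ∧
      Dense (A.domain : Set (Lp ℂ 2 μ)) ∧ LeftHalfPlaneResolvent A ∧ IsMaximalAccretiveOp A ∧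
      (A.graph : Set (_ × _)) = manifoldMaxGraph h μ P := by
  have := hP.isFiniteMeasure
  obtain ⟨t, ⟨𝒜⟩⟩ := hP.exists_controlledAtlas
  obtain ⟨l₁, hl₁⟩ := 𝒜.exists_forall_eq_zero 𝒜.c 𝒜.controlled
  obtain ⟨l₂, hl₂⟩ := 𝒜.exists_forall_eq_zero (fun i j x => -𝒜.c i j x) fun i => by
    obtain ⟨K, hK⟩ := 𝒜.controlled i
    exact ⟨K, hK.neg⟩
  have hpair : ∀ w : Lp ℂ 2 μ × Lp ℂ 2 μ, w ∈ manifoldMaxGraph h μ P ↔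
      ∀ e b c p, HasLocalForm h μ P e b c p → ∀ ψ : 𝓢(EuclideanSpace ℝ (Fin n), ℂ),
        HasCompactSupport ψ → tsupport ψ ⊆ e.target →
        ∫ x in e.source, w.2 x * ψ (e x) ∂μ =
          ∫ x in e.source, w.1 x * diffExprTranspose h b c p ψ (e x) ∂μ := by
    intro w
    refine ⟨fun hw e b c p hL ψ hψ hψs => hw e b c p hL ψ (ψ.smooth ⊤) hψ hψs,
      fun hw e b c p hL ψ hs hψ hψs => hw e b c p hL (hψ.toSchwartzMap hs) hψ hψs⟩
  -- each test function gives an equation between continuous linear functionals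
  have hclm : ∀ e b c p, HasLocalForm h μ P e b c p → ∀ ψ : 𝓢(EuclideanSpace ℝ (Fin n), ℂ),
      HasCompactSupport ψ → tsupport ψ ⊆ e.target → ∃ L L' : Lp ℂ 2 μ →L[ℂ] ℂ,
        (∀ u, L u = ∫ x in e.source, u x * ψ (e x) ∂μ) ∧
        ∀ u, L' u = ∫ x in e.source, u x * diffExprTranspose h b c p ψ (e x) ∂μ := by
    intro e b c p hL ψ hψ hψs
    obtain ⟨b', c', p', -, -, h2⟩ :=
      hL.admissible.exists_global (h := h) e.open_target ψ hψ hψs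
    obtain ⟨L, hL1⟩ := exists_clm_setIntegral_chart (μ := μ) e ψ
    obtain ⟨L', hL2⟩ := exists_clm_setIntegral_chart (μ := μ) e
      (schwartzOp h b' (fun j x => -c' j x) p' ψ)
    exact ⟨L, L', hL1, fun u => by simp only [hL2, h2]⟩
  change ∃ A : Lp ℂ 2 μ →ₗ.[ℂ] Lp ℂ 2 μ,
      (A.graph : Set (_ × _)) = closure (SetLike.coe hP.graph) ∧ _
  refine exists_maximalAccretive_graph_closure hP.graph (manifoldMaxGraph h μ P)
    (max l₁ l₂) ?_ hP.dense_domain ?_ ?_ ?_ ?_ ?_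
  · rintro w ⟨φ, h1, h2⟩
    have h3 := 𝒜.re_integral_conj_mul_nonneg hP φ
    have hcφ : Continuous φ := φ.contMDiff.continuous
    have hcP : Continuous (P φ) := (P φ).contMDiff.continuous
    have h4 : Integrable (fun x => (starRingEnd ℂ) (φ x) * P φ x) μ :=
      (by fun_prop : Continuous _).integrable_of_hasCompactSupport
        (HasCompactSupport.of_compactSpace _)
    have h5 := integral_re h4
    rw [← inner_conj_symm, Complex.conj_re, inner_eq_integral_conj_mul]
    have h6 : ∫ x, (starRingEnd ℂ) (w.1 x) * w.2 x ∂μ =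
        ∫ x, (starRingEnd ℂ) (φ x) * P φ x ∂μ := integral_congr_ae (by
      filter_upwards [h1, h2] with x e1 e2
      rw [e1, e2])
    rw [h6]
    exact h3.trans_eq h5
  · intro l hl u hu
    have h0 := hl₁ l ((le_max_left _ _).trans_lt hl) (star u)
      (𝒜.setIntegral_star_eq_zero hP hu)
    rw [Lp.eq_zero_iff_ae_eq_zero] at h0 ⊢
    filter_upwards [h0, Lp.coeFn_star u] with x e1 e2
    rw [e2, Pi.star_apply] at e1
    exact star_eq_zero.1 e1
  · rintro w ⟨φ, h1, h2⟩
    rw [hpair]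
    intro e b c p hL ψ hψ hψs
    calc _ = ∫ x in e.source, P φ x * ψ (e x) ∂μ := integral_congr_ae (by
          filter_upwards [ae_restrict_of_ae h2] with x hx
          rw [hx])
      _ = _ := hL.setIntegral_mul φ ψ hψ hψs
      _ = _ := integral_congr_ae (by
          filter_upwards [ae_restrict_of_ae h1] with x hx
          rw [hx])
  · refine isClosed_of_closure_subset fun w hw => ?_
    rw [hpair]
    intro e b c p hL ψ hψ hψs
    obtain ⟨L, L', h1, h2⟩ := hclm e b c p hL ψ hψ hψs
    have h3 : manifoldMaxGraph h μ P ⊆ {w | ∀ _ : Unit, L w.2 = L' w.1} := fun w hw _ => by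
      rw [h1, h2]
      exact (hpair w).1 hw e b c p hL ψ hψ hψs
    rw [← h1, ← h2]
    exact closure_minimal h3 (isClosed_setOf_clm_eq (fun _ => L) fun _ => L') hw ()
  · intro w hw w' hw'
    rw [hpair]
    intro e b c p hL ψ hψ hψs
    obtain ⟨L, L', h1, h2⟩ := hclm e b c p hL ψ hψ hψs
    have e1 := (hpair w).1 hw e b c p hL ψ hψ hψs
    have e2 := (hpair w').1 hw' e b c p hL ψ hψ hψs
    rw [← h1, ← h2] at e1 e2 ⊢
    rw [Prod.fst_sub, Prod.snd_sub, map_sub, map_sub, e1, e2]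
  · intro l hl u hu
    refine hl₂ l ((le_max_right _ _).trans_lt hl) u fun i φ => ?_
    obtain ⟨K, hK⟩ := 𝒜.controlled i
    have hcoe := coe_schwartzMul (𝒜.temperate_χ i) φ
    have hc : HasCompactSupport (schwartzMul (𝒜.χ i) φ) := by
      rw [hcoe]
      exact ((𝒜.compact_χ i).comp_left Complex.ofReal_zero).mul_right
    have hs : tsupport (schwartzMul (𝒜.χ i) φ) ⊆ (𝒜.chart i).target := by
      refine subset_trans (closure_mono fun y hy => ?_) (𝒜.tsupport_χ i)
      rw [Function.mem_support] at hy ⊢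
      intro h0
      rw [schwartzMul_apply (𝒜.temperate_χ i), h0, Complex.ofReal_zero, zero_mul] at hy
      exact hy rfl
    have h1 := (hpair _).1 hu _ _ _ _ (𝒜.form i) _ hc hs
    simp only [diffExprTranspose, ← schwartzOp_apply hK.temperate.neg] at h1
    simp only [add_apply, mul_add]
    rw [integral_add (integrableOn_mul_comp_chart u _) ((integrableOn_mul_comp_chart u
      ((l : ℂ) • schwartzMul (𝒜.χ i) φ))), ← h1,
      ← integral_add (integrableOn_mul_comp_chart _ _) ((integrableOn_mul_comp_chart u
        ((l : ℂ) • schwartzMul (𝒜.χ i) φ)))]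
    refine integral_eq_zero_of_ae ?_
    filter_upwards [ae_restrict_of_ae (Lp.coeFn_neg ((l : ℂ) • u)),
      ae_restrict_of_ae (Lp.coeFn_smul (l : ℂ) u)] with x e1 e2
    simp only [smul_apply, smul_eq_mul, Pi.zero_apply]
    rw [e1, Pi.neg_apply, e2, Pi.smul_apply, smul_eq_mul]
    ring

end ManifoldGraph

theorem mainTheorem6 (n : ℕ) (h : ℝ) (hh : 0 < h) :
    -- the case of `ℝⁿ`
    (∀ (b : Fin n → Fin n → EuclideanSpace ℝ (Fin n) → ℝ)
      (c : Fin n → EuclideanSpace ℝ (Fin n) → ℝ)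
      (p₀ : EuclideanSpace ℝ (Fin n) → ℝ),
      AdmissibleCoeffsOn univ b c p₀ → GrowthConditions b c p₀ →
      (∀ φ : 𝓢(EuclideanSpace ℝ (Fin n), ℂ), ∃ ψ : 𝓢(EuclideanSpace ℝ (Fin n), ℂ),
        ∀ x, ψ x = diffExpr h b c p₀ φ x) ∧
      ∃ A : Lp ℂ 2 (volume : Measure (EuclideanSpace ℝ (Fin n))) →ₗ.[ℂ]
          Lp ℂ 2 (volume : Measure (EuclideanSpace ℝ (Fin n))),
        (A.graph : Set (_ × _)) = closure (euclideanGraph h b c p₀) ∧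
        Dense (A.domain : Set (Lp ℂ 2 (volume : Measure (EuclideanSpace ℝ (Fin n))))) ∧
        LeftHalfPlaneResolvent A ∧
        IsMaximalAccretiveOp A ∧
        (A.graph : Set (_ × _)) = euclideanMaxGraph h b c p₀) ∧
    -- the case of a compact manifold with a smooth density
    (∀ (M : Type*) [TopologicalSpace M] [ChartedSpace (EuclideanSpace ℝ (Fin n)) M]
      [IsManifold (𝓡 n) ∞ M] [CompactSpace M] [T2Space M] [MeasurableSpace M] [BorelSpace M]
      (μ : Measure M) (P : C^∞⟮𝓡 n, M; 𝓘(ℝ, ℂ), ℂ⟯ → C^∞⟮𝓡 n, M; 𝓘(ℝ, ℂ), ℂ⟯),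
      IsSmoothPosDensity n μ → IsAdmissibleOperator h μ P →
      ∃ A : Lp ℂ 2 μ →ₗ.[ℂ] Lp ℂ 2 μ,
        (A.graph : Set (_ × _)) = closure (manifoldGraph μ P) ∧
        Dense (A.domain : Set (Lp ℂ 2 μ)) ∧
        LeftHalfPlaneResolvent A ∧
        IsMaximalAccretiveOp A ∧
        (A.graph : Set (_ × _)) = manifoldMaxGraph h μ P) := by
  refine ⟨fun b c p₀ hadm hg => ⟨fun φ => ?_, euclidean_graph_closure hadm hg⟩, ?_⟩
  · exact ⟨schwartzOp h b c p₀ φ, schwartzOp_apply (hg.temperateCoeffs hadm) φ⟩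
  · intro M _ _ _ _ _ _ _ μ P _ hP
    exact manifold_graph_closure hP
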